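/- Let $k$ be a field; $\otimes$ and $\mathrm{Hom}$ are over $k$. Let $A$ be a bialgebra over $k$, with Sweedler notation $\Delta(a)=\sum a_1\otimes a_2$. A left-right Yetter-Drinfel'd module over $A$ is a $k$-vector space $M$ that is a left $A$-module via $a\otimes m\mapsto a\cdot m$ and a right $A$-comodule via $\rho_M(m)=\sum m_0\otimes m_1\in M\otimes A$, such that $\sum (a_2\cdot m)_0\otimes (a_2\cdot m)_1a_1=\sum a_1\cdot m_0\otimes a_2m_1$ for all $a\in A$, $m\in M$. Morphisms are the $k$-linear maps that are $A$-linear and $A$-colinear; these modules form an abelian category. For Yetter-Drinfel'd modules $M,N$ over $A$ and $n,p\ge 0$ let $Y^{n,p}(M,N)=\mathrm{Hom}(A^{\otimes n}\otimes M,\,N\otimes A^{\otimes p})$. For $f\in Y^{n,p}(M,N)$ write $f(a^1\otimes\dots\otimes a^n\otimes m)=\sum f(a^1\otimes\dots\otimes m)^0\otimes\dots\otimes f(a^1\otimes\dots\otimes m)^p$. Define $d_m=\sum_{i=0}^{n+1}(-1)^ib_i:Y^{n,p}\to Y^{n+1,p}$ and $d_c=\sum_{i=0}^{p+1}(-1)^ic_i:Y^{n,p}\to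 Y^{n,p+1}$, where $$b_0(f)(a^1\otimes\dots\otimes a^{n+1}\otimes m)=\sum (a^1)_1\cdot f(a^2\otimes\dots\otimes m)^0\otimes (a^1)_2f(a^2\otimes\dots\otimes m)^1\otimes\dots\otimes (a^1)_{p+1}f(a^2\otimes\dots\otimes m)^p,$$ $$b_i(f)(a^1\otimes\dots\otimes a^{n+1}\otimes m)=f(a^1\otimes\dots\otimes a^ia^{i+1}\otimes\dots\otimes a^{n+1}\otimes m)\quad(1\le i\le n),$$ $$b_{n+1}(f)(a^1\otimes\dots\otimes a^{n+1}\otimes m)=\sum g^0\otimes g^1(a^{n+1})_1\otimes\dots\otimes g^p(a^{n+1})_p,\quad g=f(a^1\otimes\dots\otimes a^n\otimes (a^{n+1})_{p+1}\cdot m),$$ $$c_0(f)(a^1\otimes\dots\otimes a^n\otimes m)=\sum (h^0)_0\otimes (h^0)_1(a^1)_1\cdots(a^n)_1\otimes h^1\otimes\dots\otimes h^p,\quad h=f((a^1)_2\otimes\dots\otimes(a^n)_2\otimes m),$$ $$c_i(f)=\text{($f$ followed by $\Delta$ applied to the $i$-th factor of $A^{\otimes p}$)}\quad(1\le i\le p),$$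 $$c_{p+1}(f)(a^1\otimes\dots\otimes a^n\otimes m)=\sum f((a^1)_1\otimes\dots\otimes(a^n)_1\otimes m_0)\otimes(a^1)_2\cdots(a^n)_2m_1 .$$ Then $(Y^{n,p}(M,N),d_m,d_c)$ is a double complex; let $H^r(M,N)$ be the cohomology in degree $r$ of its total complex, whose differential on $Y^{n,p}(M,N)$ is $d_m+(-1)^nd_c$. A $1$-cocycle is thus a pair $(\omega',\rho')$ with $\omega'\in\mathrm{Hom}(A\otimes M,N)$ and $\rho'\in\mathrm{Hom}(M,N\otimes A)$. For objects $M,N$ of an abelian category let $\mathrm{Ext}^1(M,N)$ be the group of equivalence classes of extensions $0\to N\to X\to M\to 0$ under the Baer sum. **Proposition.** (a) For every bialgebra $A$ over $k$ and all left-right Yetter-Drinfel'd modules $M,N$ over $A$, the groups $H^1(M,N)$ and $\mathrm{Ext}^1(M,N)$ are isomorphic, where $\mathrm{Ext}^1$ is taken in the category of left-right Yetter-Drinfel'd modules over $A$. An isomorphism is given by sending the class of a $1$-cocycle $(\omega',\rho')$ to the class of the extension $0\to N\to N\oplus_{(\omega',\rho')}M\to M\to 0$, where $N\oplus_{(\omega',\rho')}M$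 is the space $N\oplus M$ with action $a\cdot(n,m)=(a\cdot n+\omega'(a\otimes m),\,a\cdot m)$ and coaction $(n,m)\mapsto\rho_N(n)+\rho'(m)+\rho_M(m)$ in $(N\oplus M)\otimes A\simeq (N\otimes A)\oplus(M\otimes A)$, and the maps are the inclusion and the projection. (b) If $A$ is a finite-dimensional Hopf algebra, then $H^1(M,N)\simeq \mathrm{Ext}^1_{D(A)}(M,N)$ as groups. Here $D(A)$ is the Drinfel'd double: the space $A^*\otimes A$ with unit $\varepsilon\otimes 1$ and multiplication $(p\otimes a)(q\otimes b)=\sum p*q(S^{-1}(a_3)\,-\,a_1)\otimes a_2b$, where $*$ is the convolution product of $A^*$ and $q(S^{-1}(a_3)\,-\,a_1)$ is the functional $w\mapsto q(S^{-1}(a_3)\,w\,a_1)$; the group $\mathrm{Ext}^1_{D(A)}$ is taken in the category of left $D(A)$-modules, and a Yetter-Drinfel'd module $M$ is a left $D(A)$-module by $(p\otimes a)\cdot m=\sum p((a\cdot m)_1)\,(a\cdot m)_0$. -/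

import Mathlib

open scoped TensorProduct

universe u

section YetterDrinfeldAxioms

variable {k A V W : Type u} [Field k] [Ring A] [Bialgebra k A]
  [AddCommGroup V] [Module k V] [AddCommGroup W] [Module k W]

/-- The map `a ⊗ m ↦ ∑ (a₂ · m)₀ ⊗ (a₂ · m)₁ a₁`. -/
noncomputable def ydLeft (act : A ⊗[k] V →ₗ[k] V) (coact : V →ₗ[k] V ⊗[k] A) :
    A ⊗[k] V →ₗ[k] V ⊗[k] A :=
  (LinearMap.mul' k A).lTensor V ∘ₗ (TensorProduct.assoc k V A A).toLinearMap ∘ₗ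
    coact.rTensor A ∘ₗ (TensorProduct.comm k A V).toLinearMap ∘ₗ act.lTensor A ∘ₗ
    (TensorProduct.assoc k A A V).toLinearMap ∘ₗ (Coalgebra.comul (R := k) (A := A)).rTensor V

/-- The map `a ⊗ m ↦ ∑ a₁ · m₀ ⊗ a₂ m₁`. -/
noncomputable def ydRight (act : A ⊗[k] V →ₗ[k] V) (coact : V →ₗ[k] V ⊗[k] A) :
    A ⊗[k] V →ₗ[k] V ⊗[k] A :=
  TensorProduct.map act (LinearMap.mul' k A) ∘ₗ
    (TensorProduct.tensorTensorTensorComm k A A V A).toLinearMap ∘ₗ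
    TensorProduct.map (Coalgebra.comul (R := k) (A := A)) coact

/-- The axioms of a left-right Yetter-Drinfel'd module on a vector space `V` with action
`a ⊗ m ↦ a · m` and coaction `m ↦ ∑ m₀ ⊗ m₁`: left module, right comodule, and
`∑ (a₂ · m)₀ ⊗ (a₂ · m)₁ a₁ = ∑ a₁ · m₀ ⊗ a₂ m₁`. -/
structure IsYetterDrinfeld (act : A ⊗[k] V →ₗ[k] V) (coact : V →ₗ[k] V ⊗[k] A) : Prop where
  one_act : ∀ m, act (1 ⊗ₜ m) = m
  mul_act : ∀ a b m, act ((a * b) ⊗ₜ m) = act (a ⊗ₜ act (b ⊗ₜ m))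
  coassoc : ∀ m, TensorProduct.assoc k V A A (coact.rTensor A (coact m)) =
    (Coalgebra.comul (R := k) (A := A)).lTensor V (coact m)
  counit : ∀ m, TensorProduct.rid k V
    ((Coalgebra.counit (R := k) (A := A)).lTensor V (coact m)) = m
  compat : ∀ a m, ydLeft act coact (a ⊗ₜ m) = ydRight act coact (a ⊗ₜ m)

variable {actV : A ⊗[k] V →ₗ[k] V} {coactV : V →ₗ[k] V ⊗[k] A}
  {actW : A ⊗[k] W →ₗ[k] W} {coactW : W →ₗ[k] W ⊗[k] A} {g : V →ₗ[k] W}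

theorem ydLeft_natural (h1 : ∀ a v, g (actV (a ⊗ₜ v)) = actW (a ⊗ₜ g v))
    (h2 : ∀ v, g.rTensor A (coactV v) = coactW (g v)) (a : A) (v : V) :
    g.rTensor A (ydLeft actV coactV (a ⊗ₜ v)) = ydLeft actW coactW (a ⊗ₜ g v) := by
  have key : ∀ (z : V ⊗[k] A) (x : A),
      g.rTensor A ((LinearMap.mul' k A).lTensor V (TensorProduct.assoc k V A A (z ⊗ₜ x))) =
      (LinearMap.mul' k A).lTensor W (TensorProduct.assoc k W A A (g.rTensor A z ⊗ₜ x)) := by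
    intro z x
    induction z using TensorProduct.induction_on with
    | zero => simp
    | tmul p q => simp
    | add p q hp hq => simp only [TensorProduct.add_tmul, map_add, hp, hq]
  simp only [ydLeft, LinearMap.comp_apply, LinearMap.rTensor_tmul, LinearEquiv.coe_coe]
  induction (Coalgebra.comul (R := k) a) using TensorProduct.induction_on with
  | zero => simp
  | tmul x y => simp [key, h1, h2]
  | add p q hp hq => simp only [TensorProduct.add_tmul, map_add, hp, hq]

theorem ydRight_natural (h1 : ∀ a v, g (actV (a ⊗ₜ v)) = actW (a ⊗ₜ g v))
    (h2 : ∀ v, g.rTensor A (coactV v) = coactW (g v)) (a : A) (v : V) :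
    g.rTensor A (ydRight actV coactV (a ⊗ₜ v)) = ydRight actW coactW (a ⊗ₜ g v) := by
  simp only [ydRight, LinearMap.comp_apply, TensorProduct.map_tmul, LinearEquiv.coe_coe, ← h2]
  induction (Coalgebra.comul (R := k) a) using TensorProduct.induction_on with
  | zero => simp
  | tmul x y =>
    induction (coactV v) using TensorProduct.induction_on with
    | zero => simp
    | tmul p q => simp [h1]
    | add p q hp hq => simp only [TensorProduct.tmul_add, map_add, hp, hq]
  | add p q hp hq => simp only [TensorProduct.add_tmul, map_add, hp, hq]

theorem yd_coassoc_natural (h2 : ∀ v, g.rTensor A (coactV v) = coactW (g v)) (v : V) :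
    g.rTensor (A ⊗[k] A) (TensorProduct.assoc k V A A (coactV.rTensor A (coactV v))) =
      TensorProduct.assoc k W A A (coactW.rTensor A (coactW (g v))) := by
  have key : ∀ (z : V ⊗[k] A) (x : A),
      g.rTensor (A ⊗[k] A) (TensorProduct.assoc k V A A (z ⊗ₜ x)) =
      TensorProduct.assoc k W A A (g.rTensor A z ⊗ₜ x) := by
    intro z x
    induction z using TensorProduct.induction_on with
    | zero => simp
    | tmul p q => simp
    | add p q hp hq => simp only [TensorProduct.add_tmul, map_add, hp, hq]
  rw [← h2]
  induction (coactV v) using TensorProduct.induction_on with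
  | zero => simp
  | tmul x y => simp [key, h2]
  | add p q hp hq => simp only [map_add, hp, hq]

theorem yd_comul_natural (z : V ⊗[k] A) :
    g.rTensor (A ⊗[k] A) ((Coalgebra.comul (R := k) (A := A)).lTensor V z) =
      (Coalgebra.comul (R := k) (A := A)).lTensor W (g.rTensor A z) := by
  induction z using TensorProduct.induction_on with
  | zero => simp
  | tmul x y => simp
  | add p q hp hq => simp only [map_add, hp, hq]

theorem yd_counit_natural (z : V ⊗[k] A) :
    g (TensorProduct.rid k V ((Coalgebra.counit (R := k) (A := A)).lTensor V z)) =
      TensorProduct.rid k W ((Coalgebra.counit (R := k) (A := A)).lTensor W (g.rTensor A z)) := by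
  induction z using TensorProduct.induction_on with
  | zero => simp
  | tmul x y => simp
  | add p q hp hq => simp only [map_add, hp, hq]

/-- Structure maps that restrict from a Yetter-Drinfel'd module along an injection. -/
theorem IsYetterDrinfeld.of_injective (hW : IsYetterDrinfeld actW coactW)
    (h1 : ∀ a v, g (actV (a ⊗ₜ v)) = actW (a ⊗ₜ g v))
    (h2 : ∀ v, g.rTensor A (coactV v) = coactW (g v)) (hg : Function.Injective g) :
    IsYetterDrinfeld actV coactV where
  one_act m := hg (by rw [h1, hW.one_act])
  mul_act a b m := hg (by rw [h1, h1, h1, hW.mul_act])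
  coassoc m := Module.Flat.rTensor_preserves_injective_linearMap g hg (by
    rw [yd_coassoc_natural h2, hW.coassoc, yd_comul_natural, h2])
  counit m := hg (by rw [yd_counit_natural, h2, hW.counit])
  compat a m := Module.Flat.rTensor_preserves_injective_linearMap g hg (by
    rw [ydLeft_natural h1 h2, ydRight_natural h1 h2, hW.compat])

/-- Structure maps whose underlying space is the sum of the images of two Yetter-Drinfel'd
modules. -/
theorem IsYetterDrinfeld.of_jointly_surjective {V' : Type u} [AddCommGroup V'] [Module k V']
    {actV' : A ⊗[k] V' →ₗ[k] V'} {coactV' : V' →ₗ[k] V' ⊗[k] A} {g' : V' →ₗ[k] W}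
    (hV : IsYetterDrinfeld actV coactV) (hV' : IsYetterDrinfeld actV' coactV')
    (h1 : ∀ a v, g (actV (a ⊗ₜ v)) = actW (a ⊗ₜ g v))
    (h2 : ∀ v, g.rTensor A (coactV v) = coactW (g v))
    (h1' : ∀ a v, g' (actV' (a ⊗ₜ v)) = actW (a ⊗ₜ g' v))
    (h2' : ∀ v, g'.rTensor A (coactV' v) = coactW (g' v))
    (hg : ∀ w, ∃ v v', g v + g' v' = w) : IsYetterDrinfeld actW coactW where
  one_act m := by
    obtain ⟨v, v', rfl⟩ := hg m
    rw [TensorProduct.tmul_add, map_add, ← h1, ← h1', hV.one_act, hV'.one_act]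
  mul_act a b m := by
    obtain ⟨v, v', rfl⟩ := hg m
    simp only [TensorProduct.tmul_add, map_add, ← h1, ← h1', hV.mul_act, hV'.mul_act]
  coassoc m := by
    obtain ⟨v, v', rfl⟩ := hg m
    simp only [map_add]
    rw [← yd_coassoc_natural h2, ← yd_coassoc_natural h2', hV.coassoc, hV'.coassoc, ← h2, ← h2',
      yd_comul_natural, yd_comul_natural]
  counit m := by
    obtain ⟨v, v', rfl⟩ := hg m
    simp only [map_add, ← h2, ← h2', ← yd_counit_natural, hV.counit, hV'.counit]
  compat a m := by
    obtain ⟨v, v', rfl⟩ := hg m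
    simp only [TensorProduct.tmul_add, map_add, ← ydLeft_natural h1 h2, ← ydLeft_natural h1' h2',
      ← ydRight_natural h1 h2, ← ydRight_natural h1' h2', hV.compat, hV'.compat]

theorem IsYetterDrinfeld.of_surjective (hV : IsYetterDrinfeld actV coactV)
    (h1 : ∀ a v, g (actV (a ⊗ₜ v)) = actW (a ⊗ₜ g v))
    (h2 : ∀ v, g.rTensor A (coactV v) = coactW (g v)) (hg : Function.Surjective g) :
    IsYetterDrinfeld actW coactW :=
  .of_jointly_surjective hV hV h1 h2 h1 h2 fun w => by
    obtain ⟨v, hv⟩ := hg w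
    exact ⟨v, 0, by simp [hv]⟩

end YetterDrinfeldAxioms

open CategoryTheory CategoryTheory.Limits

/-- A left-right Yetter-Drinfel'd module over the bialgebra `A`. -/
structure YetterDrinfeld (k A : Type u) [Field k] [Ring A] [Bialgebra k A] where
  carrier : Type u
  [addCommGroup : AddCommGroup carrier]
  [module : Module k carrier]
  act : A ⊗[k] carrier →ₗ[k] carrier
  coact : carrier →ₗ[k] carrier ⊗[k] A
  isYetterDrinfeld : IsYetterDrinfeld act coact

attribute [instance] YetterDrinfeld.addCommGroup YetterDrinfeld.module

namespace YetterDrinfeld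

variable {k A : Type u} [Field k] [Ring A] [Bialgebra k A]

/-- Morphisms of Yetter-Drinfel'd modules: linear, `A`-linear and `A`-colinear maps. -/
@[ext]
structure Hom (M N : YetterDrinfeld k A) where
  toLin : M.carrier →ₗ[k] N.carrier
  map_act : ∀ a m, toLin (M.act (a ⊗ₜ m)) = N.act (a ⊗ₜ toLin m)
  map_coact : ∀ m, toLin.rTensor A (M.coact m) = N.coact (toLin m)

instance : Category (YetterDrinfeld k A) where
  Hom := Hom
  id M := ⟨LinearMap.id, by simp, by simp⟩
  comp f g := ⟨g.toLin ∘ₗ f.toLin, by simp [f.map_act, g.map_act], by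
    simp [LinearMap.rTensor_comp, f.map_coact, g.map_coact]⟩

variable {M N P : YetterDrinfeld k A}

/-- The underlying linear map of a morphism. -/
def lin (f : M ⟶ N) : M.carrier →ₗ[k] N.carrier := Hom.toLin f

theorem lin_act (f : M ⟶ N) (a : A) (m : M.carrier) :
    lin f (M.act (a ⊗ₜ m)) = N.act (a ⊗ₜ lin f m) := Hom.map_act f a m

theorem lin_coact (f : M ⟶ N) (m : M.carrier) :
    (lin f).rTensor A (M.coact m) = N.coact (lin f m) := Hom.map_coact f m

theorem hom_ext {f g : M ⟶ N} (h : lin f = lin g) : f = g := Hom.ext h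

@[simp] theorem lin_id : lin (𝟙 M) = LinearMap.id := rfl

@[simp] theorem lin_comp (f : M ⟶ N) (g : N ⟶ P) : lin (f ≫ g) = lin g ∘ₗ lin f := rfl

instance : Zero (M ⟶ N) := ⟨⟨0, by simp, by simp⟩⟩
instance : Add (M ⟶ N) := ⟨fun f g => ⟨lin f + lin g,
  by simp [TensorProduct.tmul_add, lin_act], by simp [LinearMap.rTensor_add, lin_coact]⟩⟩
instance : Neg (M ⟶ N) := ⟨fun f => ⟨-lin f,
  by simp [TensorProduct.tmul_neg, lin_act], by simp [LinearMap.rTensor_neg, lin_coact]⟩⟩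
instance : Sub (M ⟶ N) := ⟨fun f g => ⟨lin f - lin g,
  by simp [TensorProduct.tmul_sub, lin_act], by simp [LinearMap.rTensor_sub, lin_coact]⟩⟩
instance : SMul ℕ (M ⟶ N) := ⟨fun n f => ⟨n • lin f,
  by simp [lin_act], by
    intro m
    have : (n • lin f).rTensor A = n • (lin f).rTensor A := by
      rw [← Nat.cast_smul_eq_nsmul k, ← Nat.cast_smul_eq_nsmul k, LinearMap.rTensor_smul]
    simp [this, lin_coact]⟩⟩
instance : SMul ℤ (M ⟶ N) := ⟨fun n f => ⟨n • lin f,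
  by simp [lin_act], by
    intro m
    have : (n • lin f).rTensor A = n • (lin f).rTensor A := by
      rw [← Int.cast_smul_eq_zsmul k, ← Int.cast_smul_eq_zsmul k, LinearMap.rTensor_smul]
    simp [this, lin_coact]⟩⟩

@[simp] theorem lin_zero : lin (0 : M ⟶ N) = 0 := rfl
@[simp] theorem lin_add (f g : M ⟶ N) : lin (f + g) = lin f + lin g := rfl

instance : AddCommGroup (M ⟶ N) :=
  Function.Injective.addCommGroup (fun f : M ⟶ N => lin f) (fun _ _ h => hom_ext h)
    rfl (fun _ _ => rfl) (fun _ => rfl) (fun _ _ => rfl) (fun _ _ => rfl) (fun _ _ => rfl)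

instance : Preadditive (YetterDrinfeld k A) where
  add_comp _ _ _ f g h := hom_ext (by simp [LinearMap.comp_add])
  comp_add _ _ _ f g h := hom_ext (by simp [LinearMap.add_comp])

/-- The componentwise action on a direct sum. -/
noncomputable def prodAct (M N : YetterDrinfeld k A) :
    A ⊗[k] (M.carrier × N.carrier) →ₗ[k] M.carrier × N.carrier :=
  (M.act.prodMap N.act) ∘ₗ (TensorProduct.prodRight k k A M.carrier N.carrier).toLinearMap

/-- The componentwise coaction on a direct sum. -/
noncomputable def prodCoact (M N : YetterDrinfeld k A) :
    M.carrier × N.carrier →ₗ[k] (M.carrier × N.carrier) ⊗[k] A :=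
  ((LinearMap.inl k _ _).rTensor A ∘ₗ M.coact).coprod
    ((LinearMap.inr k _ _).rTensor A ∘ₗ N.coact)

theorem prodAct_apply (M N : YetterDrinfeld k A) (a : A) (v : M.carrier × N.carrier) :
    prodAct M N (a ⊗ₜ v) = (M.act (a ⊗ₜ v.1), N.act (a ⊗ₜ v.2)) := by
  obtain ⟨v, w⟩ := v
  simp [prodAct]

theorem prodCoact_apply (M N : YetterDrinfeld k A) (v : M.carrier × N.carrier) :
    prodCoact M N v = (LinearMap.inl k _ _).rTensor A (M.coact v.1) +
      (LinearMap.inr k _ _).rTensor A (N.coact v.2) := by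
  simp [prodCoact]

theorem fst_prodCoact (M N : YetterDrinfeld k A) (v : M.carrier × N.carrier) :
    (LinearMap.fst k M.carrier N.carrier).rTensor A (prodCoact M N v) = M.coact v.1 := by
  rw [prodCoact_apply, map_add, ← LinearMap.rTensor_comp_apply, ← LinearMap.rTensor_comp_apply]
  simp

theorem snd_prodCoact (M N : YetterDrinfeld k A) (v : M.carrier × N.carrier) :
    (LinearMap.snd k M.carrier N.carrier).rTensor A (prodCoact M N v) = N.coact v.2 := by
  rw [prodCoact_apply, map_add, ← LinearMap.rTensor_comp_apply, ← LinearMap.rTensor_comp_apply]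
  simp

theorem inl_prodAct (M N : YetterDrinfeld k A) (a : A) (v : M.carrier) :
    LinearMap.inl k M.carrier N.carrier (M.act (a ⊗ₜ v)) =
      prodAct M N (a ⊗ₜ LinearMap.inl k M.carrier N.carrier v) := by simp [prodAct_apply]

theorem inr_prodAct (M N : YetterDrinfeld k A) (a : A) (v : N.carrier) :
    LinearMap.inr k M.carrier N.carrier (N.act (a ⊗ₜ v)) =
      prodAct M N (a ⊗ₜ LinearMap.inr k M.carrier N.carrier v) := by simp [prodAct_apply]

theorem inl_prodCoact (M N : YetterDrinfeld k A) (v : M.carrier) :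
    (LinearMap.inl k M.carrier N.carrier).rTensor A (M.coact v) =
      prodCoact M N (LinearMap.inl k M.carrier N.carrier v) := by simp [prodCoact_apply]

theorem inr_prodCoact (M N : YetterDrinfeld k A) (v : N.carrier) :
    (LinearMap.inr k M.carrier N.carrier).rTensor A (N.coact v) =
      prodCoact M N (LinearMap.inr k M.carrier N.carrier v) := by simp [prodCoact_apply]

/-- The direct sum of two Yetter-Drinfel'd modules. -/
noncomputable def prod (M N : YetterDrinfeld k A) : YetterDrinfeld k A where
  carrier := M.carrier × N.carrier
  act := prodAct M N
  coact := prodCoact M N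
  isYetterDrinfeld := .of_jointly_surjective M.isYetterDrinfeld N.isYetterDrinfeld
    (inl_prodAct M N) (inl_prodCoact M N) (inr_prodAct M N) (inr_prodCoact M N)
    fun v => ⟨v.1, v.2, by simp⟩

/-- The first inclusion. -/
noncomputable def inl (M N : YetterDrinfeld k A) : M ⟶ prod M N :=
  Hom.mk (N := prod M N) (LinearMap.inl k M.carrier N.carrier) (inl_prodAct M N) (inl_prodCoact M N)

/-- The second inclusion. -/
noncomputable def inr (M N : YetterDrinfeld k A) : N ⟶ prod M N :=
  Hom.mk (N := prod M N) (LinearMap.inr k M.carrier N.carrier) (inr_prodAct M N) (inr_prodCoact M N)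

/-- The first projection. -/
noncomputable def fst (M N : YetterDrinfeld k A) : prod M N ⟶ M :=
  Hom.mk (M := prod M N) (LinearMap.fst k M.carrier N.carrier)
    (fun a v => congrArg Prod.fst (prodAct_apply M N a v)) (fst_prodCoact M N)

/-- The second projection. -/
noncomputable def snd (M N : YetterDrinfeld k A) : prod M N ⟶ N :=
  Hom.mk (M := prod M N) (LinearMap.snd k M.carrier N.carrier)
    (fun a v => congrArg Prod.snd (prodAct_apply M N a v)) (snd_prodCoact M N)

instance : HasBinaryBiproducts (YetterDrinfeld k A) :=
  ⟨fun {M N} => hasBinaryBiproduct_of_total (b :=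
    { pt := prod M N, fst := fst M N, snd := snd M N, inl := inl M N, inr := inr M N
      inl_fst := hom_ext (LinearMap.fst_comp_inl _ _ _)
      inl_snd := hom_ext (LinearMap.snd_comp_inl _ _ _)
      inr_fst := hom_ext (LinearMap.fst_comp_inr _ _ _)
      inr_snd := hom_ext (LinearMap.snd_comp_inr _ _ _) })
    (hom_ext (LinearMap.ext fun v => by
      exact Prod.ext (add_zero v.1) (zero_add v.2)))⟩

/-- The zero Yetter-Drinfel'd module. -/
noncomputable def zero : YetterDrinfeld k A where
  carrier := PUnit
  act := 0
  coact := 0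
  isYetterDrinfeld := by
    constructor
    · intro; rfl
    · intros; rfl
    · intro m; simp
    · intro; rfl
    · intro a m; rw [Subsingleton.elim m 0, TensorProduct.tmul_zero, map_zero, map_zero]

instance : HasZeroObject (YetterDrinfeld k A) :=
  ⟨zero, (IsZero.iff_id_eq_zero _).2 (hom_ext (LinearMap.ext fun _ => rfl))⟩

instance : HasFiniteProducts (YetterDrinfeld k A) :=
  have : HasTerminal (YetterDrinfeld k A) := HasZeroObject.hasTerminal
  hasFiniteProducts_of_has_binary_and_terminal

section Kernel

variable (f : M ⟶ N)

theorem coact_ker (m : LinearMap.ker (lin f)) :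
    M.coact m ∈ LinearMap.range ((LinearMap.ker (lin f)).subtype.rTensor A) := by
  have h : Function.Exact (LinearMap.ker (lin f)).subtype (lin f) :=
    LinearMap.exact_subtype_ker_map _
  have := Module.Flat.rTensor_exact A h
  exact (this (M.coact m)).1 (by rw [lin_coact, m.2, map_zero])

/-- The restriction of the coaction to the kernel of a morphism. -/
noncomputable def kerCoact :
    LinearMap.ker (lin f) →ₗ[k] LinearMap.ker (lin f) ⊗[k] A :=
  (LinearEquiv.ofInjective ((LinearMap.ker (lin f)).subtype.rTensor A)
    (Module.Flat.rTensor_preserves_injective_linearMap _ Subtype.val_injective)).symm.toLinearMap ∘ₗ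
    (M.coact ∘ₗ (LinearMap.ker (lin f)).subtype).codRestrict _ (coact_ker f)

theorem kerCoact_spec (m : LinearMap.ker (lin f)) :
    (LinearMap.ker (lin f)).subtype.rTensor A (kerCoact f m) = M.coact m :=
  congrArg Subtype.val (LinearEquiv.apply_symm_apply (LinearEquiv.ofInjective
    ((LinearMap.ker (lin f)).subtype.rTensor A)
    (Module.Flat.rTensor_preserves_injective_linearMap _ Subtype.val_injective))
    ((M.coact ∘ₗ (LinearMap.ker (lin f)).subtype).codRestrict _ (coact_ker f) m))

theorem act_ker (x : A ⊗[k] LinearMap.ker (lin f)) :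
    (M.act ∘ₗ (LinearMap.ker (lin f)).subtype.lTensor A) x ∈ LinearMap.ker (lin f) := by
  induction x using TensorProduct.induction_on with
  | zero => simp
  | tmul a m =>
    have h : lin f m = 0 := m.2
    simp [lin_act, h]
  | add x y hx hy => rw [map_add]; exact add_mem hx hy

/-- The kernel of a morphism. -/
noncomputable def ker : YetterDrinfeld k A where
  carrier := LinearMap.ker (lin f)
  act := (M.act ∘ₗ (LinearMap.ker (lin f)).subtype.lTensor A).codRestrict _ (act_ker f)
  coact := kerCoact f
  isYetterDrinfeld := M.isYetterDrinfeld.of_injective (g := (LinearMap.ker (lin f)).subtype)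
    (fun _ _ => rfl) (kerCoact_spec f) Subtype.val_injective

/-- The inclusion of the kernel. -/
noncomputable def kerι : ker f ⟶ M :=
  Hom.mk (LinearMap.ker (lin f)).subtype (fun _ _ => rfl) (kerCoact_spec f)

theorem kerι_comp : kerι f ≫ f = 0 := hom_ext (LinearMap.ext fun m => m.2)

/-- The universal property of the kernel. -/
noncomputable def kerLift (g : P ⟶ M) (h : g ≫ f = 0) : P ⟶ ker f :=
  have h' : ∀ x, lin f (lin g x) = 0 := fun x => congrArg (fun φ => lin φ x) h
  Hom.mk ((lin g).codRestrict _ h') (fun a m => Subtype.ext (lin_act g a m)) fun m =>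
    Module.Flat.rTensor_preserves_injective_linearMap (LinearMap.ker (lin f)).subtype
      Subtype.val_injective (by
        refine Eq.trans ?_ ((lin_coact g m).trans (kerCoact_spec f ((lin g).codRestrict _ h' m)).symm)
        exact (LinearMap.rTensor_comp_apply A _ _ _).symm)

/-- The kernel is a kernel in the categorical sense. -/
noncomputable def kerIsLimit : IsLimit (KernelFork.ofι (kerι f) (kerι_comp f)) :=
  KernelFork.IsLimit.ofι _ _ (fun g h => kerLift f g h) (fun _ _ => rfl)
    fun _ _ _ hm => hom_ext (LinearMap.ext fun x => Subtype.ext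
      (congrArg (fun φ => lin φ x) hm))

instance : HasKernels (YetterDrinfeld k A) := ⟨fun f => ⟨⟨_, kerIsLimit f⟩⟩⟩

/-- The cokernel of a morphism. -/
noncomputable def coker : YetterDrinfeld k A where
  carrier := N.carrier ⧸ LinearMap.range (lin f)
  act := TensorProduct.lift (LinearMap.flip ((LinearMap.range (lin f)).liftQ
    (LinearMap.compr₂ (TensorProduct.mk k A N.carrier) ((LinearMap.range (lin f)).mkQ ∘ₗ N.act)).flip
    (by
      rintro _ ⟨m, rfl⟩
      ext a
      simp only [LinearMap.flip_apply, LinearMap.compr₂_apply, TensorProduct.mk_apply,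
        LinearMap.comp_apply, ← lin_act, LinearMap.zero_apply]
      exact (Submodule.Quotient.mk_eq_zero _).2 ⟨_, rfl⟩)))
  coact := (LinearMap.range (lin f)).liftQ ((LinearMap.range (lin f)).mkQ.rTensor A ∘ₗ N.coact) (by
      rintro _ ⟨m, rfl⟩
      rw [LinearMap.mem_ker, LinearMap.comp_apply, ← lin_coact, ← LinearMap.comp_apply,
        ← LinearMap.rTensor_comp, LinearMap.range_mkQ_comp, LinearMap.rTensor_zero,
        LinearMap.zero_apply])
  isYetterDrinfeld := N.isYetterDrinfeld.of_surjective (g := (LinearMap.range (lin f)).mkQ)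
    (fun _ _ => rfl) (fun _ => rfl) (Submodule.mkQ_surjective _)

/-- The projection to the cokernel. -/
noncomputable def cokerπ : N ⟶ coker f :=
  Hom.mk (LinearMap.range (lin f)).mkQ (fun _ _ => rfl) (fun _ => rfl)

theorem comp_cokerπ : f ≫ cokerπ f = 0 := hom_ext (LinearMap.range_mkQ_comp (lin f))

/-- The universal property of the cokernel. -/
noncomputable def cokerDesc (g : N ⟶ P) (h : f ≫ g = 0) : coker f ⟶ P :=
  have h' : ∀ x, lin g (lin f x) = 0 := fun x => congrArg (fun φ => lin φ x) h
  Hom.mk ((LinearMap.range (lin f)).liftQ (lin g) (by rintro _ ⟨m, rfl⟩; exact h' m))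
    (fun a m => by
      obtain ⟨m, rfl⟩ := Submodule.mkQ_surjective _ m
      exact lin_act g a m) (fun m => by
      obtain ⟨m, rfl⟩ := Submodule.mkQ_surjective _ m
      refine Eq.trans ?_ (lin_coact g m)
      change LinearMap.rTensor A _ (LinearMap.rTensor A (LinearMap.range (lin f)).mkQ (N.coact m)) = _
      rw [← LinearMap.comp_apply, ← LinearMap.rTensor_comp]
      rfl)

/-- The cokernel is a cokernel in the categorical sense. -/
noncomputable def cokerIsColimit : IsColimit (CokernelCofork.ofπ (cokerπ f) (comp_cokerπ f)) :=
  CokernelCofork.IsColimit.ofπ _ _ (fun g h => cokerDesc f g h) (fun _ _ => rfl)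
    fun _ _ _ hm => hom_ext (LinearMap.ext fun x => by
      obtain ⟨x, rfl⟩ := Submodule.mkQ_surjective _ x
      exact congrArg (fun φ => lin φ x) hm)

instance : HasCokernels (YetterDrinfeld k A) := ⟨fun f => ⟨⟨_, cokerIsColimit f⟩⟩⟩

theorem injective_of_mono [Mono f] : Function.Injective (lin f) := by
  rw [← LinearMap.ker_eq_bot, Submodule.eq_bot_iff]
  intro x hx
  have h : kerι f = 0 := (cancel_mono f).1 (by rw [kerι_comp, zero_comp])
  exact congrArg (fun φ => lin φ (⟨x, hx⟩ : LinearMap.ker (lin f))) h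

theorem surjective_of_epi [Epi f] : Function.Surjective (lin f) := by
  have h : cokerπ f = 0 := (cancel_epi f).1 (by rw [comp_cokerπ, comp_zero])
  intro y
  exact (Submodule.Quotient.mk_eq_zero _).1 (congrArg (fun φ => lin φ y) h)

/-- The inverse of a bijective morphism. -/
noncomputable def inv (h : Function.Bijective (lin f)) : N ⟶ M :=
  Hom.mk (LinearEquiv.ofBijective (lin f) h).symm.toLinearMap
    (fun a m => h.1 (by
      obtain ⟨m, rfl⟩ := h.2 m
      have e : ∀ m, (LinearEquiv.ofBijective (lin f) h).symm (lin f m) = m :=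
        (LinearEquiv.ofBijective (lin f) h).symm_apply_apply
      simp only [LinearEquiv.coe_coe]
      rw [e, ← lin_act, e])) (fun m => by
      obtain ⟨m, rfl⟩ := h.2 m
      have e : (LinearEquiv.ofBijective (lin f) h).symm.toLinearMap ∘ₗ lin f = LinearMap.id :=
        LinearMap.ext (LinearEquiv.ofBijective (lin f) h).symm_apply_apply
      have e' := LinearMap.congr_fun e m
      simp only [LinearMap.comp_apply, LinearMap.id_apply] at e'
      rw [← lin_coact, e', ← LinearMap.comp_apply, ← LinearMap.rTensor_comp, e]
      simp)

theorem isIso_of_bijective (h : Function.Bijective (lin f)) : IsIso f :=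
  ⟨inv f h, hom_ext (LinearMap.ext (LinearEquiv.ofBijective (lin f) h).symm_apply_apply),
    hom_ext (LinearMap.ext (LinearEquiv.ofBijective (lin f) h).apply_symm_apply)⟩

end Kernel

noncomputable instance : IsNormalMonoCategory (YetterDrinfeld k A) where
  normalMonoOfMono f _ := ⟨{
    Z := coker f
    g := cokerπ f
    w := comp_cokerπ f
    isLimit := by
      have hk : ∀ x, lin (kerι (cokerπ f)) x ∈ LinearMap.range (lin f) := fun x =>
        (Submodule.Quotient.mk_eq_zero _).1 x.2
      have hb : Function.Bijective (lin (kerLift (cokerπ f) f (comp_cokerπ f))) := by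
        refine ⟨fun x y h => injective_of_mono f (congrArg Subtype.val h), fun y => ?_⟩
        obtain ⟨x, hx⟩ := hk y
        exact ⟨x, Subtype.ext hx⟩
      have := isIso_of_bijective _ hb
      exact (kerIsLimit (cokerπ f)).ofIsoLimit (Iso.symm (Fork.ext
        (asIso (kerLift (cokerπ f) f (comp_cokerπ f))) rfl)) }⟩

noncomputable instance : IsNormalEpiCategory (YetterDrinfeld k A) where
  normalEpiOfEpi f _ := ⟨{
    W := ker f
    g := kerι f
    w := kerι_comp f
    isColimit := by
      have hb : Function.Bijective (lin (cokerDesc (kerι f) f (kerι_comp f))) := by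
        refine ⟨?_, fun y => ?_⟩
        · rw [← LinearMap.ker_eq_bot, Submodule.eq_bot_iff]
          intro x hx
          obtain ⟨x, rfl⟩ := Submodule.mkQ_surjective _ x
          exact (Submodule.Quotient.mk_eq_zero _).2 ⟨⟨x, hx⟩, rfl⟩
        · obtain ⟨x, hx⟩ := surjective_of_epi f y
          exact ⟨Submodule.Quotient.mk x, hx⟩
      have := isIso_of_bijective _ hb
      exact (cokerIsColimit (kerι f)).ofIsoColimit (Cofork.ext
        (asIso (cokerDesc (kerι f) f (kerι_comp f))) rfl) }⟩

noncomputable instance : Abelian (YetterDrinfeld k A) where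

end YetterDrinfeld

section Extensions

universe v w

variable {C : Type w} [Category.{v} C] [Abelian C]

/-- Extensions `0 → N → X → M → 0` of `M` by `N` in an abelian category. -/
structure Extension (M N : C) where
  X : C
  i : N ⟶ X
  p : X ⟶ M
  w : i ≫ p = 0
  shortExact : (ShortComplex.mk i p w).ShortExact

namespace Extension

variable {M N : C}

/-- Equivalence of extensions: an isomorphism of the middle terms which is the identity
on both ends. -/
def Equiv (E F : Extension M N) : Prop := ∃ e : E.X ≅ F.X, E.i ≫ e.hom = F.i ∧ e.hom ≫ F.p = E.p

instance setoid (M N : C) : Setoid (Extension M N) where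
  r := Equiv
  iseqv :=
    { refl := fun E => ⟨Iso.refl _, by simp, by simp⟩
      symm := by
        rintro E F ⟨e, h, h'⟩
        exact ⟨e.symm, by simp [← h], by simp [← h']⟩
      trans := by
        rintro E F G ⟨e, h, h'⟩ ⟨f, g, g'⟩
        exact ⟨e.trans f, by simp [reassoc_of% h, g], by simp [h', g']⟩ }

/-- The skew diagonal `N ⟶ E.X ×_M F.X`, `n ↦ (n, -n)`. -/
noncomputable def skewDiag (E F : Extension M N) : N ⟶ pullback E.p F.p :=
  pullback.lift E.i (-F.i) (by simp [E.w, F.w])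

theorem baerSum_w (E F : Extension M N) :
    skewDiag E F ≫ pullback.fst E.p F.p ≫ E.p = 0 := by
  simp only [skewDiag, pullback.lift_fst_assoc, E.w]

/-- The Baer sum of two extensions: the quotient of the fibre product `E.X ×_M F.X` by the
skew diagonal copy of `N`. -/
noncomputable def baerSum (E F : Extension M N) : Extension M N where
  X := cokernel (skewDiag E F)
  i := pullback.lift E.i 0 (by simp [E.w]) ≫ cokernel.π (skewDiag E F)
  p := cokernel.desc (skewDiag E F) (pullback.fst E.p F.p ≫ E.p) (baerSum_w E F)
  w := by simp only [Category.assoc, cokernel.π_desc, pullback.lift_fst_assoc, E.w]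
  shortExact := by
    have hE := E.shortExact
    have hF := F.shortExact
    have mE : Mono E.i := hE.mono_f
    have mF : Mono F.i := hF.mono_f
    have eE : Epi E.p := hE.epi_g
    have eF : Epi F.p := hF.epi_g
    have : Mono (skewDiag E F) := by
      have : Mono (skewDiag E F ≫ pullback.fst E.p F.p) := by
        simpa only [skewDiag, pullback.lift_fst] using mE
      exact mono_of_mono (skewDiag E F) (pullback.fst E.p F.p)
    refine ShortComplex.ShortExact.mk' ?_ ?_ ?_
    · rw [ShortComplex.exact_iff_exact_up_to_refinements]
      intro T x hx
      obtain ⟨T', q, hq, y, hy⟩ := surjective_up_to_refinements_of_epi (cokernel.π (skewDiag E F)) x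
      dsimp at x hx hy ⊢
      have h1 : (y ≫ pullback.fst E.p F.p) ≫ E.p = 0 := by
        have := congrArg (· ≫ cokernel.desc (skewDiag E F) _ (baerSum_w E F)) hy
        simpa [hx] using this.symm
      have h2 : (y ≫ pullback.snd E.p F.p) ≫ F.p = 0 := by
        rw [Category.assoc, ← pullback.condition, ← Category.assoc, h1]
      let a := hE.exact.lift (y ≫ pullback.fst E.p F.p) h1
      let b := hF.exact.lift (y ≫ pullback.snd E.p F.p) h2
      have ha : a ≫ E.i = y ≫ pullback.fst E.p F.p := hE.exact.lift_f _ _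
      have hb : b ≫ F.i = y ≫ pullback.snd E.p F.p := hF.exact.lift_f _ _
      have key : y = (a + b) ≫ pullback.lift E.i 0 (by simp [E.w]) - b ≫ skewDiag E F := by
        apply pullback.hom_ext
        · simp [skewDiag, ha, pullback.lift_fst]
        · simp [skewDiag, hb, pullback.lift_snd]
      refine ⟨T', q, hq, a + b, ?_⟩
      rw [hy]
      conv_lhs => rw [key]
      simp [Preadditive.sub_comp]
    · refine Preadditive.mono_of_cancel_zero _ fun {T} g hg => ?_
      dsimp at g hg
      rw [← Category.assoc] at hg
      let c := (Abelian.monoIsKernelOfCokernel _ (colimit.isColimit _)).lift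
        (KernelFork.ofι (f := cokernel.π (skewDiag E F)) _ hg)
      have hc : c ≫ skewDiag E F = g ≫ pullback.lift E.i 0 (by simp [E.w]) :=
        Fork.IsLimit.lift_ι (Abelian.monoIsKernelOfCokernel _ (colimit.isColimit _))
      have hc0 : c = 0 := by
        have := congrArg (· ≫ pullback.snd E.p F.p) hc
        simp only [skewDiag, Category.assoc, pullback.lift_snd, comp_zero, Preadditive.comp_neg,
          neg_eq_zero] at this
        exact zero_of_comp_mono _ this
      have := congrArg (· ≫ pullback.fst E.p F.p) hc
      simp only [hc0, zero_comp, Category.assoc, pullback.lift_fst] at this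
      exact zero_of_comp_mono _ this.symm
    · have : Epi (cokernel.π (skewDiag E F) ≫
          cokernel.desc (skewDiag E F) (pullback.fst E.p F.p ≫ E.p) (baerSum_w E F)) := by
        rw [cokernel.π_desc]
        infer_instance
      exact epi_of_epi (cokernel.π (skewDiag E F)) _

theorem baerSum_congr {E E' F F' : Extension M N} (h : E ≈ E') (h' : F ≈ F') :
    baerSum E F ≈ baerSum E' F' := by
  obtain ⟨e, he, he'⟩ := h
  obtain ⟨f, hf, hf'⟩ := h'
  let φ := pullback.map E.p F.p E'.p F'.p e.hom f.hom (𝟙 M) (by simp [he']) (by simp [hf'])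
  have hφ : skewDiag E F ≫ (asIso φ).hom = 𝟙 N ≫ skewDiag E' F' := by
    apply pullback.hom_ext <;> 
      simp [φ, skewDiag, he, hf, pullback.map, pullback.lift_fst, pullback.lift_snd, pullback.lift_fst_assoc, pullback.lift_snd_assoc]
  refine ⟨cokernel.mapIso _ _ (Iso.refl N) (asIso φ) hφ, ?_, ?_⟩
  · simp only [baerSum, cokernel.mapIso_hom, Category.assoc, cokernel.π_desc, asIso_hom]
    rw [← Category.assoc]
    congr 1
    apply pullback.hom_ext <;> simp [φ, he, pullback.map, pullback.lift_fst, pullback.lift_snd, pullback.lift_fst_assoc, pullback.lift_snd_assoc]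
  · apply coequalizer.hom_ext
    simp [baerSum, φ, he', pullback.map, pullback.lift_fst_assoc]

end Extension

/-- `Ext¹(M, N)`: the equivalence classes of extensions of `M` by `N`. -/
def Ext1 (M N : C) : Type (max v w) := Quotient (Extension.setoid M N)

/-- The class of an extension in `Ext¹(M, N)`. -/
def Ext1.mk {M N : C} (E : Extension M N) : Ext1 M N := Quotient.mk _ E

/-- Addition in `Ext¹(M, N)` is the Baer sum. -/
noncomputable instance (M N : C) : Add (Ext1 M N) :=
  ⟨Quotient.map₂ Extension.baerSum fun _ _ h _ _ h' => Extension.baerSum_congr h h'⟩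

end Extensions

section TensorPowers

variable (k A : Type u) [Field k] [Ring A] [Algebra k A]

/-- `A^n ⊗ V`, as `A ⊗ (A ⊗ ⋯ ⊗ (A ⊗ V))`. -/
noncomputable def powL (V : Type u) [AddCommGroup V] [Module k V] : ℕ → ModuleCat.{u} k
  | 0 => ModuleCat.of k V
  | n + 1 => ModuleCat.of k (A ⊗[k] powL V n)

/-- `V ⊗ A^p`, as `((V ⊗ A) ⊗ ⋯ ⊗ A) ⊗ A`. -/
noncomputable def powR (V : Type u) [AddCommGroup V] [Module k V] : ℕ → ModuleCat.{u} k
  | 0 => ModuleCat.of k V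
  | p + 1 => ModuleCat.of k (powR V p ⊗[k] A)

end TensorPowers

namespace YetterDrinfeld

variable {k A : Type u} [Field k] [Ring A] [Bialgebra k A]

section StructureMaps

variable (N : YetterDrinfeld k A)

/-- `a ⊗ (n ⊗ x¹ ⊗ ⋯ ⊗ xᵖ) ↦ ∑ a₁ · n ⊗ a₂ x¹ ⊗ ⋯ ⊗ aₚ₊₁ xᵖ`. -/
noncomputable def diagL : ∀ p : ℕ, A ⊗[k] powR k A N.carrier p →ₗ[k] powR k A N.carrier p
  | 0 => N.act
  | p + 1 => TensorProduct.map (diagL p) (LinearMap.mul' k A) ∘ₗ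
      (TensorProduct.tensorTensorTensorComm k A A (powR k A N.carrier p) A).toLinearMap ∘ₗ
      (Coalgebra.comul (R := k) (A := A)).rTensor (powR k A N.carrier p ⊗[k] A)

/-- `(n ⊗ x¹ ⊗ ⋯ ⊗ xᵖ) ⊗ a ↦ ∑ n ⊗ x¹ a₁ ⊗ ⋯ ⊗ xᵖ aₚ`
(which is `n ⊗ a ↦ ε(a) n` for `p = 0`). -/
noncomputable def diagR : ∀ p : ℕ, powR k A N.carrier p ⊗[k] A →ₗ[k] powR k A N.carrier p
  | 0 => (TensorProduct.rid k N.carrier).toLinearMap ∘ₗ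
      (Coalgebra.counit (R := k) (A := A)).lTensor N.carrier
  | p + 1 => TensorProduct.map (diagR p) (LinearMap.mul' k A) ∘ₗ
      (TensorProduct.tensorTensorTensorComm k (powR k A N.carrier p) A A A).toLinearMap ∘ₗ
      (Coalgebra.comul (R := k) (A := A)).lTensor (powR k A N.carrier p ⊗[k] A)

/-- `(n ⊗ x¹ ⊗ ⋯ ⊗ xᵖ) ⊗ c ↦ ∑ n₀ ⊗ n₁ c ⊗ x¹ ⊗ ⋯ ⊗ xᵖ`. -/
noncomputable def coactFirst :
    ∀ p : ℕ, powR k A N.carrier p ⊗[k] A →ₗ[k] powR k A N.carrier (p + 1)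
  | 0 => (LinearMap.mul' k A).lTensor N.carrier ∘ₗ
      (TensorProduct.assoc k N.carrier A A).toLinearMap ∘ₗ N.coact.rTensor A
  | p + 1 => (coactFirst p).rTensor A ∘ₗ
      (TensorProduct.rightComm k (powR k A N.carrier p) A A).toLinearMap

/-- `n ⊗ x¹ ⊗ ⋯ ⊗ xᵖ ↦ ∑ n ⊗ x¹ ⊗ ⋯ ⊗ (xⁱ)₁ ⊗ (xⁱ)₂ ⊗ ⋯ ⊗ xᵖ`; the index is counted from `0`. -/
noncomputable def comulAt :
    ∀ p : ℕ, Fin p → (powR k A N.carrier p →ₗ[k] powR k A N.carrier (p + 1))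
  | 0 => fun i => i.elim0
  | p + 1 => Fin.lastCases
      ((TensorProduct.assoc k (powR k A N.carrier p) A A).symm.toLinearMap ∘ₗ
        (Coalgebra.comul (R := k) (A := A)).lTensor (powR k A N.carrier p))
      (fun j => (comulAt p j).rTensor A)

variable (M : YetterDrinfeld k A)

/-- `a¹ ⊗ ⋯ ⊗ aⁿ⁺¹ ⊗ m ↦ a¹ ⊗ ⋯ ⊗ aⁱ aⁱ⁺¹ ⊗ ⋯ ⊗ aⁿ⁺¹ ⊗ m`; the index is counted from `0`. -/
noncomputable def mulAt :
    ∀ n : ℕ, Fin n → (powL k A M.carrier (n + 1) →ₗ[k] powL k A M.carrier n)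
  | 0 => fun i => i.elim0
  | n + 1 => Fin.cases
      ((LinearMap.mul' k A).rTensor (powL k A M.carrier n) ∘ₗ
        (TensorProduct.assoc k A A (powL k A M.carrier n)).symm.toLinearMap)
      (fun j => (mulAt n j).lTensor A)

/-- `a¹ ⊗ ⋯ ⊗ aⁿ⁺¹ ⊗ m ↦ ∑ (a¹ ⊗ ⋯ ⊗ aⁿ ⊗ (aⁿ⁺¹)₂ · m) ⊗ (aⁿ⁺¹)₁`. -/
noncomputable def actLast :
    ∀ n : ℕ, powL k A M.carrier (n + 1) →ₗ[k] powL k A M.carrier n ⊗[k] A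
  | 0 => (TensorProduct.comm k A M.carrier).toLinearMap ∘ₗ M.act.lTensor A ∘ₗ
      (TensorProduct.assoc k A A M.carrier).toLinearMap ∘ₗ
      (Coalgebra.comul (R := k) (A := A)).rTensor M.carrier
  | n + 1 => (TensorProduct.assoc k A (powL k A M.carrier n) A).symm.toLinearMap ∘ₗ
      (actLast n).lTensor A

/-- `a¹ ⊗ ⋯ ⊗ aⁿ ⊗ m ↦ ∑ ((a¹)₂ ⊗ ⋯ ⊗ (aⁿ)₂ ⊗ m) ⊗ (a¹)₁ ⋯ (aⁿ)₁`. -/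
noncomputable def splitL :
    ∀ n : ℕ, powL k A M.carrier n →ₗ[k] powL k A M.carrier n ⊗[k] A
  | 0 => (TensorProduct.mk k M.carrier A).flip 1
  | n + 1 => (LinearMap.mul' k A).lTensor (A ⊗[k] powL k A M.carrier n) ∘ₗ
      (TensorProduct.tensorTensorTensorComm k A A (powL k A M.carrier n) A).toLinearMap ∘ₗ
      TensorProduct.map
        ((TensorProduct.comm k A A).toLinearMap ∘ₗ Coalgebra.comul (R := k) (A := A)) (splitL n)

/-- `a¹ ⊗ ⋯ ⊗ aⁿ ⊗ m ↦ ∑ ((a¹)₁ ⊗ ⋯ ⊗ (aⁿ)₁ ⊗ m₀) ⊗ (a¹)₂ ⋯ (aⁿ)₂ m₁`. -/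
noncomputable def splitR :
    ∀ n : ℕ, powL k A M.carrier n →ₗ[k] powL k A M.carrier n ⊗[k] A
  | 0 => M.coact
  | n + 1 => (LinearMap.mul' k A).lTensor (A ⊗[k] powL k A M.carrier n) ∘ₗ
      (TensorProduct.tensorTensorTensorComm k A A (powL k A M.carrier n) A).toLinearMap ∘ₗ
      TensorProduct.map (Coalgebra.comul (R := k) (A := A)) (splitR n)

end StructureMaps

variable (M N : YetterDrinfeld k A)

/-- `Yⁿᵖ(M, N) = Hom(Aⁿ ⊗ M, N ⊗ Aᵖ)`. -/
abbrev Y (n p : ℕ) : Type u := powL k A M.carrier n →ₗ[k] powR k A N.carrier p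

/-- The map `b₀ : Yⁿᵖ → Yⁿ⁺¹ᵖ`. -/
noncomputable def bFirst (n p : ℕ) : Y M N n p →ₗ[k] Y M N (n + 1) p where
  toFun f := diagL N p ∘ₗ f.lTensor A
  map_add' f g := by rw [LinearMap.lTensor_add]; exact LinearMap.comp_add _ _ _
  map_smul' c f := by rw [LinearMap.lTensor_smul]; exact LinearMap.comp_smul _ _ _

/-- The maps `b₁, …, bₙ : Yⁿᵖ → Yⁿ⁺¹ᵖ`; `bMid i` is `bᵢ₊₁`. -/
noncomputable def bMid (n p : ℕ) (i : Fin n) : Y M N n p →ₗ[k] Y M N (n + 1) p where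
  toFun f := f ∘ₗ mulAt M n i
  map_add' _ _ := LinearMap.add_comp _ _ _
  map_smul' _ _ := LinearMap.smul_comp _ _ _

/-- The map `bₙ₊₁ : Yⁿᵖ → Yⁿ⁺¹ᵖ`. -/
noncomputable def bLast (n p : ℕ) : Y M N n p →ₗ[k] Y M N (n + 1) p where
  toFun f := diagR N p ∘ₗ f.rTensor A ∘ₗ actLast M n
  map_add' f g := by rw [LinearMap.rTensor_add, LinearMap.add_comp, LinearMap.comp_add]
  map_smul' c f := by
    rw [LinearMap.rTensor_smul, LinearMap.smul_comp, LinearMap.comp_smul]; rfl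

/-- `d_m = ∑ᵢ (-1)ⁱ bᵢ`. -/
noncomputable def dm (n p : ℕ) : Y M N n p →ₗ[k] Y M N (n + 1) p :=
  bFirst M N n p + ∑ i : Fin n, (-1 : k) ^ (i.val + 1) • bMid M N n p i +
    (-1 : k) ^ (n + 1) • bLast M N n p

/-- The map `c₀ : Yⁿᵖ → Yⁿᵖ⁺¹`. -/
noncomputable def cFirst (n p : ℕ) : Y M N n p →ₗ[k] Y M N n (p + 1) where
  toFun f := coactFirst N p ∘ₗ f.rTensor A ∘ₗ splitL M n
  map_add' f g := by rw [LinearMap.rTensor_add, LinearMap.add_comp, LinearMap.comp_add]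
  map_smul' c f := by
    rw [LinearMap.rTensor_smul, LinearMap.smul_comp, LinearMap.comp_smul]; rfl

/-- The maps `c₁, …, cₚ : Yⁿᵖ → Yⁿᵖ⁺¹`; `cMid i` is `cᵢ₊₁`. -/
noncomputable def cMid (n p : ℕ) (i : Fin p) : Y M N n p →ₗ[k] Y M N n (p + 1) where
  toFun f := comulAt N p i ∘ₗ f
  map_add' _ _ := LinearMap.comp_add _ _ _
  map_smul' _ _ := LinearMap.comp_smul _ _ _

/-- The map `cₚ₊₁ : Yⁿᵖ → Yⁿᵖ⁺¹`. -/
noncomputable def cLast (n p : ℕ) : Y M N n p →ₗ[k] Y M N n (p + 1) where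
  toFun f := f.rTensor A ∘ₗ splitR M n
  map_add' f g := by rw [LinearMap.rTensor_add]; exact LinearMap.add_comp _ _ _
  map_smul' c f := by rw [LinearMap.rTensor_smul]; exact LinearMap.smul_comp _ _ _

/-- `d_c = ∑ᵢ (-1)ⁱ cᵢ`. -/
noncomputable def dc (n p : ℕ) : Y M N n p →ₗ[k] Y M N n (p + 1) :=
  cFirst M N n p + ∑ i : Fin p, (-1 : k) ^ (i.val + 1) • cMid M N n p i +
    (-1 : k) ^ (p + 1) • cLast M N n p

/-- The total complex in degree `r`: the (finite) sum of the `Yⁿᵖ` with `n + p = r`. -/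
abbrev Tot (r : ℕ) : Type u :=
  ∀ q : {q : ℕ × ℕ // q.1 + q.2 = r}, Y M N q.1.1 q.1.2

/-- The component of a cochain of degree `n + p` in `Yⁿᵖ`. -/
noncomputable def Tot.proj {r : ℕ} (n p : ℕ) (h : n + p = r) : Tot M N r →ₗ[k] Y M N n p :=
  LinearMap.proj (⟨(n, p), h⟩ : {q : ℕ × ℕ // q.1 + q.2 = r})

/-- The differential `d_m + (-1)ⁿ d_c` of the total complex. -/
noncomputable def totD (r : ℕ) : Tot M N r →ₗ[k] Tot M N (r + 1) :=
  LinearMap.pi fun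
    | ⟨(0, 0), _⟩ => 0
    | ⟨(n + 1, 0), h⟩ => dm M N n 0 ∘ₗ Tot.proj M N n 0 (by simp only at h; omega)
    | ⟨(0, p + 1), h⟩ => dc M N 0 p ∘ₗ Tot.proj M N 0 p (by simp only at h; omega)
    | ⟨(n + 1, p + 1), h⟩ =>
      dm M N n (p + 1) ∘ₗ Tot.proj M N n (p + 1) (by simp only at h; omega) +
      (-1 : k) ^ (n + 1) •
        (dc M N (n + 1) p ∘ₗ Tot.proj M N (n + 1) p (by simp only at h; omega))

/-- The cocycles of the total complex. -/
noncomputable def cocycles (r : ℕ) : Submodule k (Tot M N r) := LinearMap.ker (totD M N r)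

/-- The coboundaries of the total complex. -/
noncomputable def coboundaries : ∀ r : ℕ, Submodule k (Tot M N r)
  | 0 => ⊥
  | r + 1 => LinearMap.range (totD M N r)

/-- `Hʳ(M, N)`, the cohomology of the total complex. -/
abbrev H (r : ℕ) : Type u :=
  cocycles M N r ⧸ (coboundaries M N r).submoduleOf (cocycles M N r)

variable {M N}

/-- The class of a cocycle. -/
noncomputable def H.mk {r : ℕ} (z : cocycles M N r) : H M N r := Submodule.Quotient.mk z

/-- The component `ω' : A ⊗ M → N` of a cochain of degree one. -/
noncomputable def Tot.actPart (z : Tot M N 1) : A ⊗[k] M.carrier →ₗ[k] N.carrier :=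
  Tot.proj M N 1 0 rfl z

/-- The component `ρ' : M → N ⊗ A` of a cochain of degree one. -/
noncomputable def Tot.coactPart (z : Tot M N 1) : M.carrier →ₗ[k] N.carrier ⊗[k] A :=
  Tot.proj M N 0 1 rfl z

/-- `E` is the extension `0 → N → N ⊕ M → M → 0` in which `N ⊕ M` has the action
`a · (n, m) = (a · n + ω'(a ⊗ m), a · m)` and the coaction
`(n, m) ↦ ρ_N(n) + ρ'(m) + ρ_M(m)`. -/
def IsTwisted (E : Extension M N) (ω' : A ⊗[k] M.carrier →ₗ[k] N.carrier)
    (ρ' : M.carrier →ₗ[k] N.carrier ⊗[k] A) : Prop :=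
  ∃ e : (N.carrier × M.carrier) ≃ₗ[k] E.X.carrier,
    (∀ n, lin E.i n = e (n, 0)) ∧
    (∀ n m, lin E.p (e (n, m)) = m) ∧
    (∀ a n m, E.X.act (a ⊗ₜ e (n, m)) =
      e (N.act (a ⊗ₜ n) + ω' (a ⊗ₜ m), M.act (a ⊗ₜ m))) ∧
    (∀ n m, E.X.coact (e (n, m)) =
      (e.toLinearMap ∘ₗ LinearMap.inl k N.carrier M.carrier).rTensor A (N.coact n + ρ' m) +
      (e.toLinearMap ∘ₗ LinearMap.inr k N.carrier M.carrier).rTensor A (M.coact m))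

end YetterDrinfeld

section AntipodeBijective

open WithConv Coalgebra LinearMap

variable {k A : Type u} [Field k] [Ring A] [HopfAlgebra k A]

/-- Postcomposition with an algebra map, on convolution algebras. -/
def convPost {B B' : Type u} [Ring B] [Algebra k B] [Ring B'] [Algebra k B'] (h : B →ₐ[k] B') :
    WithConv (A →ₗ[k] B) →* WithConv (A →ₗ[k] B') where
  toFun f := toConv (h.toLinearMap ∘ₗ f.ofConv)
  map_one' := by
    apply WithConv.ext
    ext x
    simp [LinearMap.convOne_def]
  map_mul' f g := by
    apply WithConv.ext
    exact LinearMap.algHom_comp_convMul_distrib h f g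

/-- `f ⊗ 1`. -/
abbrev convI1 : WithConv (A →ₗ[k] A) →* WithConv (A →ₗ[k] A ⊗[k] A) :=
  convPost (Algebra.TensorProduct.includeLeft : A →ₐ[k] A ⊗[k] A)

/-- `1 ⊗ f`. -/
abbrev convI2 : WithConv (A →ₗ[k] A) →* WithConv (A →ₗ[k] A ⊗[k] A) :=
  convPost (Algebra.TensorProduct.includeRight : A →ₐ[k] A ⊗[k] A)

theorem conv_comul : toConv (comul (R := k) (A := A)) =
    convI1 (toConv LinearMap.id) * convI2 (toConv LinearMap.id) := by
  apply WithConv.ext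
  ext a
  rw [LinearMap.convMul_apply]
  change comul a = LinearMap.mul' k (A ⊗[k] A) (TensorProduct.map _ _ (comul a))
  induction comul (R := k) a using TensorProduct.induction_on with
  | zero => simp
  | tmul x y => simp [convPost]
  | add x y hx hy => simp only [map_add, ← hx, ← hy]

theorem conv_comul_antipode : toConv (comul (R := k) (A := A) ∘ₗ HopfAlgebra.antipode k) =
    convI2 (toConv (HopfAlgebra.antipode k)) * convI1 (toConv (HopfAlgebra.antipode k (A := A))) := by
  symm
  refine left_inv_eq_right_inv (a := toConv (comul (R := k) (A := A))) ?_
    LinearMap.comul_right_inv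
  have h1 : convI1 (toConv (HopfAlgebra.antipode k (A := A))) * convI1 (toConv LinearMap.id) = 1 := by
    rw [← map_mul, LinearMap.antipode_mul_id, map_one]
  have h2 : convI2 (toConv (HopfAlgebra.antipode k (A := A))) * convI2 (toConv LinearMap.id) = 1 := by
    rw [← map_mul, LinearMap.antipode_mul_id, map_one]
  have h3 : ∀ {G : Type u} [Monoid G] (p q r s : G), q * r = 1 → p * s = 1 →
      p * q * (r * s) = 1 := fun p q r s h h' => by
    rw [mul_assoc, ← mul_assoc q, h, one_mul, h']
  rw [conv_comul]
  exact h3 _ _ _ _ h1 h2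

theorem convI1_mul_comp (a : WithConv (A →ₗ[k] A)) (F : WithConv (A →ₗ[k] A ⊗[k] A))
    (l : A →ₗ[k] A) : l.lTensor A ∘ₗ (convI1 a * F).ofConv =
      (convI1 a * toConv (l.lTensor A ∘ₗ F.ofConv)).ofConv := by
  ext x
  simp only [LinearMap.comp_apply, LinearMap.convMul_apply]
  induction comul (R := k) x using TensorProduct.induction_on with
  | zero => simp
  | add x y hx hy => simp only [map_add, hx, hy]
  | tmul x y =>
    simp only [TensorProduct.map_tmul, LinearMap.mul'_apply, LinearMap.comp_apply]
    induction F.ofConv y using TensorProduct.induction_on with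
    | zero => simp
    | add x y hx hy => simp only [map_add, mul_add, hx, hy]
    | tmul x y => simp [convPost]

theorem mul_convI1_comp (a : WithConv (A →ₗ[k] A)) (F : WithConv (A →ₗ[k] A ⊗[k] A))
    (l : A →ₗ[k] A) : l.lTensor A ∘ₗ (F * convI1 a).ofConv =
      (toConv (l.lTensor A ∘ₗ F.ofConv) * convI1 a).ofConv := by
  ext x
  simp only [LinearMap.comp_apply, LinearMap.convMul_apply]
  induction comul (R := k) x using TensorProduct.induction_on with
  | zero => simp
  | add x y hx hy => simp only [map_add, hx, hy]
  | tmul x y =>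
    simp only [TensorProduct.map_tmul, LinearMap.mul'_apply, LinearMap.comp_apply]
    induction F.ofConv x using TensorProduct.induction_on with
    | zero => simp
    | add x y hx hy => simp only [map_add, add_mul, hx, hy]
    | tmul x y => simp [convPost]

theorem conv_collapse {a t : WithConv (A →ₗ[k] A)}
    (ha : toConv (comul (R := k) (A := A) ∘ₗ a.ofConv) = convI1 a * convI2 a)
    (ht : toConv (comul (R := k) (A := A) ∘ₗ t.ofConv) = convI2 t * convI1 t)
    {l : A →ₗ[k] A} (hl : toConv (l ∘ₗ (a * t).ofConv) = 1) (x : A) :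
    l.lTensor A (comul ((a * t).ofConv x)) = (a * t).ofConv x ⊗ₜ 1 := by
  have h1 : toConv (comul (R := k) (A := A) ∘ₗ (a * t).ofConv) =
      convI1 a * (convI2 (a * t) * convI1 t) := by
    have := congrArg toConv
      (LinearMap.algHom_comp_convMul_distrib (Bialgebra.comulAlgHom k A) a t)
    refine this.trans ?_
    change toConv (comul (R := k) (A := A) ∘ₗ a.ofConv) *
      toConv (comul (R := k) (A := A) ∘ₗ t.ofConv) = _
    rw [ha, ht, map_mul]
    simp only [mul_assoc]
  have h2 : l.lTensor A ∘ₗ (convI2 (a * t)).ofConv = (convI2 (toConv (l ∘ₗ (a * t).ofConv))).ofConv := by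
    ext y
    simp [convPost]
  have h3 : l.lTensor A ∘ₗ (comul (R := k) (A := A) ∘ₗ (a * t).ofConv) = (convI1 (a * t)).ofConv := by
    have := congrArg (fun f => l.lTensor A ∘ₗ f.ofConv) h1
    refine this.trans ?_
    change l.lTensor A ∘ₗ (convI1 a * (convI2 (a * t) * convI1 t)).ofConv = _
    rw [convI1_mul_comp, mul_convI1_comp, h2, hl, map_one, map_mul]
    change (convI1 a * (1 * convI1 t)).ofConv = _
    rw [one_mul]
  exact LinearMap.congr_fun h3 x

theorem conv_descend {a t : WithConv (A →ₗ[k] A)}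
    (ha : toConv (comul (R := k) (A := A) ∘ₗ a.ofConv) = convI1 a * convI2 a)
    (ht : toConv (comul (R := k) (A := A) ∘ₗ t.ofConv) = convI2 t * convI1 t)
    (h : toConv ((HopfAlgebra.antipode k ∘ₗ HopfAlgebra.antipode k) ∘ₗ (a * t).ofConv) = 1) :
    a * t = 1 := by
  have e : ∀ x, counit (R := k) ((a * t).ofConv x) = counit (R := k) x := fun x => by
    have := congrArg (fun f => counit (R := k) (f.ofConv x)) h
    simpa [LinearMap.convOne_def] using this
  have h1 : ∀ x, HopfAlgebra.antipode k ((a * t).ofConv x) = algebraMap k A (counit x) := by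
    intro x
    have := conv_collapse ha ht h x
    generalize hy : (a * t).ofConv x = y at this
    have key : ∀ z : A ⊗[k] A, LinearMap.mul' k A (TensorProduct.comm k A A
        (TensorProduct.map (HopfAlgebra.antipode k) LinearMap.id
          ((HopfAlgebra.antipode k ∘ₗ HopfAlgebra.antipode k).lTensor A z))) =
        HopfAlgebra.antipode k (LinearMap.mul' k A ((HopfAlgebra.antipode k).lTensor A z)) := by
      intro z
      induction z using TensorProduct.induction_on with
      | zero => simp
      | add x y hx hy => simp only [map_add, hx, hy]
      | tmul x y => simp [HopfAlgebra.antipode_mul_antidistrib]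
    have k2 := key (comul y)
    rw [this, HopfAlgebra.mul_antipode_lTensor_comul_apply] at k2
    rw [← e x, hy]
    simpa [Algebra.algebraMap_eq_smul_one] using k2
  have h2 : toConv (HopfAlgebra.antipode k ∘ₗ (a * t).ofConv) = 1 := by
    apply WithConv.ext
    ext x
    exact (h1 x).trans (by simp [LinearMap.convOne_def])
  apply WithConv.ext
  ext x
  have := congrArg (LinearMap.mul' k A) (conv_collapse ha ht h2 x)
  rw [HopfAlgebra.mul_antipode_lTensor_comul_apply, e x] at this
  simpa [LinearMap.convOne_def] using this.symm

/-- The square of the antipode, as an algebra map. -/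
noncomputable def antipodeSq : A →ₐ[k] A := AlgHom.ofLinearMap
  (HopfAlgebra.antipode k ∘ₗ HopfAlgebra.antipode k) (by simp)
  (by simp [HopfAlgebra.antipode_mul_antidistrib])

/-- Compatibility of a linear endomorphism with the comultiplication. -/
theorem conv_comul_coalg {f : A →ₐ[k] A}
    (hf : ∀ x, comul (R := k) (f x) = TensorProduct.map f.toLinearMap f.toLinearMap (comul x)) :
    toConv (comul (R := k) (A := A) ∘ₗ f.toLinearMap) =
      convI1 (toConv f.toLinearMap) * convI2 (toConv f.toLinearMap) := by
  have h := congrArg (convPost (A := A) (Algebra.TensorProduct.map f f)) (conv_comul (k := k) (A := A))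
  rw [map_mul] at h
  have e1 : toConv (comul (R := k) (A := A) ∘ₗ f.toLinearMap) =
      convPost (Algebra.TensorProduct.map f f) (toConv (comul (R := k) (A := A))) := by
    apply WithConv.ext
    ext x
    exact hf x
  rw [e1, h]
  congr 1 <;> (apply WithConv.ext; ext x; simp [convPost])

theorem conv_comul_anticoalg {f : A →ₐ[k] A}
    (hf : ∀ x, comul (R := k) (f x) = TensorProduct.map f.toLinearMap f.toLinearMap (comul x)) :
    toConv (comul (R := k) (A := A) ∘ₗ (f.toLinearMap ∘ₗ HopfAlgebra.antipode k)) =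
      convI2 (toConv (f.toLinearMap ∘ₗ HopfAlgebra.antipode k)) *
      convI1 (toConv (f.toLinearMap ∘ₗ HopfAlgebra.antipode k)) := by
  have h := congrArg (convPost (A := A) (Algebra.TensorProduct.map f f))
    (conv_comul_antipode (k := k) (A := A))
  rw [map_mul] at h
  have e1 : toConv (comul (R := k) (A := A) ∘ₗ (f.toLinearMap ∘ₗ HopfAlgebra.antipode k)) =
      convPost (Algebra.TensorProduct.map f f)
        (toConv (comul (R := k) (A := A) ∘ₗ HopfAlgebra.antipode k)) := by
    apply WithConv.ext
    ext x
    exact hf _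
  rw [e1, h]
  congr 1 <;> (apply WithConv.ext; ext x; simp [convPost])

/-- `∑ S(a)₁ ⊗ S(a)₂ = ∑ S(a₂) ⊗ S(a₁)`. -/
theorem comul_antipode_apply (x : A) : comul (R := k) (HopfAlgebra.antipode k x) =
    TensorProduct.map (HopfAlgebra.antipode k) (HopfAlgebra.antipode k)
      (TensorProduct.comm k A A (comul x)) := by
  have h : _ = _ := congrArg (fun f => f.ofConv x) (conv_comul_antipode (k := k) (A := A))
  simp only [LinearMap.comp_apply, LinearMap.convMul_apply] at h
  rw [h]
  induction comul (R := k) x using TensorProduct.induction_on with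
  | zero => simp
  | add x y hx hy => simp only [map_add, hx, hy]
  | tmul x y => simp [convPost]

theorem comul_antipodeSq (x : A) : comul (R := k) (antipodeSq (k := k) x) =
    TensorProduct.map (antipodeSq (k := k)).toLinearMap (antipodeSq (k := k)).toLinearMap
      (comul x) := by
  change comul (R := k) (HopfAlgebra.antipode k (HopfAlgebra.antipode k x)) = _
  rw [comul_antipode_apply, comul_antipode_apply]
  induction comul (R := k) x using TensorProduct.induction_on with
  | zero => simp
  | add x y hx hy => simp only [map_add, hx, hy]
  | tmul x y => simp [antipodeSq]

theorem comul_antipodeSq_pow (n : ℕ) (x : A) : comul (R := k) ((antipodeSq (k := k) ^ n) x) =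
    TensorProduct.map (antipodeSq (k := k) ^ n).toLinearMap
      (antipodeSq (k := k) ^ n).toLinearMap (comul x) := by
  induction n with
  | zero =>
    change _ = TensorProduct.map LinearMap.id LinearMap.id (comul x)
    simp
  | succ n ih =>
    have e : (antipodeSq (k := k) (A := A) ^ (n + 1)).toLinearMap =
        (antipodeSq (k := k)).toLinearMap ∘ₗ (antipodeSq (k := k) ^ n).toLinearMap := by
      rw [pow_succ']; rfl
    rw [e, TensorProduct.map_comp, LinearMap.comp_apply, ← ih, ← comul_antipodeSq, pow_succ']
    rfl

theorem exists_fitting {V : Type u} [AddCommGroup V] [Module k V] [FiniteDimensional k V]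
    (f : Module.End k V) : ∃ (n : ℕ) (g : Module.End k V),
      f ^ (n + 1) * (f ^ (n + 1) * g) = f ^ (n + 1) ∧ Commute (f ^ (n + 1)) g := by
  have hp : minpoly k f ≠ 0 := minpoly.ne_zero (Algebra.IsIntegral.isIntegral f)
  obtain ⟨q, hq, hq0⟩ := Polynomial.exists_eq_pow_rootMultiplicity_mul_and_not_dvd _ hp 0
  set n := Polynomial.rootMultiplicity 0 (minpoly k f)
  rw [Polynomial.C_0, sub_zero] at hq hq0
  have hc : q.coeff 0 ≠ 0 := fun h => hq0 (Polynomial.X_dvd_iff.2 h)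
  have h0 : Polynomial.aeval f (minpoly k f) = 0 := minpoly.aeval k f
  rw [hq, ← Polynomial.divX_mul_X_add q] at h0
  simp only [map_mul, map_add, map_pow, Polynomial.aeval_X, Polynomial.aeval_C] at h0
  set t := Polynomial.aeval f q.divX with ht
  have htf : Commute f t := by
    have h := congrArg (Polynomial.aeval f) (Polynomial.X_mul (p := q.divX))
    rw [map_mul, map_mul, Polynomial.aeval_X] at h
    exact h
  set s : Module.End k V := (-(q.coeff 0)⁻¹) • t with hs
  have hsf : Commute f s := htf.smul_right _
  have h1 : f ^ n * (f * s) = f ^ n := by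
    have h2 : f ^ n * (t * f) = -(q.coeff 0 • f ^ n) := by
      rw [mul_add, ← Algebra.commutes, ← Algebra.smul_def] at h0
      exact eq_neg_of_add_eq_zero_left h0
    rw [hs, mul_smul_comm, mul_smul_comm, htf.eq, h2, smul_neg, neg_smul, neg_neg, smul_smul,
      inv_mul_cancel₀ hc, one_smul]
  have h2 : ∀ m, f ^ n * (f * s) ^ m = f ^ n := by
    intro m
    induction m with
    | zero => simp
    | succ m ih => rw [pow_succ', ← mul_assoc, h1, ih]
  refine ⟨n, s ^ (n + 1), ?_, (hsf.pow_pow _ _)⟩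
  rw [← hsf.mul_pow, pow_succ', mul_assoc, h2]

/-- The antipode of a finite-dimensional Hopf algebra is bijective. -/
theorem antipode_bijective [FiniteDimensional k A] :
    Function.Bijective (HopfAlgebra.antipode k (A := A)) := by
  obtain ⟨n, g, hg, hc⟩ := exists_fitting (antipodeSq (k := k) (A := A)).toLinearMap
  have hpow : ∀ (m : ℕ) (x : A), ((antipodeSq (k := k) (A := A)).toLinearMap ^ m) x =
      (antipodeSq (k := k) ^ m) x := by
    intro m
    induction m with
    | zero => intro x; rfl
    | succ m ih => intro x; rw [pow_succ', pow_succ']; exact congrArg (fun y => antipodeSq (k := k) y) (ih x)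
  set φ : A →ₐ[k] A := antipodeSq (k := k) ^ (n + 1) with hφ
  have hφφg : ∀ x, φ (φ (g x)) = φ x := fun x => by
    have := LinearMap.congr_fun hg x
    simpa only [Module.End.mul_apply, hpow] using this
  have hcomm : ∀ x, φ (g x) = g (φ x) := fun x => by
    have := LinearMap.congr_fun hc.eq x
    simpa only [Module.End.mul_apply, hpow] using this
  have hπφ : ∀ x, φ (g (φ x)) = φ x := fun x => by rw [← hcomm, hφφg]
  let π : A →ₐ[k] A := AlgHom.ofLinearMap (φ.toLinearMap ∘ₗ g)
    (by
      have := hπφ 1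
      rw [map_one] at this
      exact this)
    (fun x y => by
      change φ (g (x * y)) = φ (g x) * φ (g y)
      have h1 : φ (g (φ (g x) * φ (g y))) = φ (g x) * φ (g y) := by
        rw [← map_mul, hπφ]
      rw [← h1, hcomm (x * y), hcomm (φ (g x) * φ (g y)), map_mul φ x, map_mul φ (φ (g x)), hφφg,
        hφφg])
  have hπ : ∀ x, π x = φ (g x) := fun _ => rfl
  have hφΔ := comul_antipodeSq_pow (k := k) (A := A) (n + 1)
  rw [← hφ] at hφΔ
  have hπΔ : ∀ x, comul (R := k) (π x) = TensorProduct.map π.toLinearMap π.toLinearMap (comul x) := by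
    intro x
    have c1 : π.toLinearMap ∘ₗ φ.toLinearMap = φ.toLinearMap := LinearMap.ext hπφ
    have c2 : π.toLinearMap = g ∘ₗ φ.toLinearMap := LinearMap.ext hcomm
    have c3 : φ.toLinearMap ∘ₗ π.toLinearMap = φ.toLinearMap := LinearMap.ext hφφg
    have e1 : comul (R := k) (π x) =
        TensorProduct.map π.toLinearMap π.toLinearMap (comul (π x)) := by
      rw [hπ, hφΔ, ← LinearMap.comp_apply (TensorProduct.map _ _) (TensorProduct.map _ _),
        ← TensorProduct.map_comp, c1]
    rw [e1]
    conv_lhs => rw [c2]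
    conv_rhs => rw [c2]
    rw [TensorProduct.map_comp, LinearMap.comp_apply, LinearMap.comp_apply, ← hφΔ, ← hφΔ]
    exact congrArg _ (congrArg _ (hφφg x))
  have hcompΔ : ∀ (m : ℕ) (x : A), comul (R := k) ((antipodeSq (k := k) ^ m).comp π x) =
      TensorProduct.map ((antipodeSq (k := k) ^ m).comp π).toLinearMap
        ((antipodeSq (k := k) ^ m).comp π).toLinearMap (comul x) := by
    intro m x
    rw [AlgHom.comp_apply, comul_antipodeSq_pow, hπΔ, ← LinearMap.comp_apply,
      ← TensorProduct.map_comp]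
    rfl
  let a : ℕ → WithConv (A →ₗ[k] A) := fun m => toConv (antipodeSq (k := k) ^ m).toLinearMap
  let t : ℕ → WithConv (A →ₗ[k] A) := fun m =>
    toConv (((antipodeSq (k := k) ^ m).comp π).toLinearMap ∘ₗ HopfAlgebra.antipode k)
  have htop : a (n + 1) * t (n + 1) = 1 := by
    have h1 : a (n + 1) = convPost φ (toConv LinearMap.id) := rfl
    have h2 : t (n + 1) = convPost φ (toConv (HopfAlgebra.antipode k)) := by
      apply WithConv.ext
      ext x
      exact hφφg _
    rw [h1, h2, ← map_mul, LinearMap.id_mul_antipode, map_one]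
  have hstep : ∀ m, a (m + 1) * t (m + 1) = 1 → a m * t m = 1 := by
    intro m hm
    refine conv_descend (conv_comul_coalg (comul_antipodeSq_pow m))
      (conv_comul_anticoalg (hcompΔ m)) ?_
    change convPost antipodeSq (a m * t m) = 1
    rw [map_mul, ← hm]
    congr 1 <;> (apply WithConv.ext; ext x; simp only [a, t, pow_succ']; rfl)
  have hall : ∀ m, a m * t m = 1 → a 0 * t 0 = 1 := by
    intro m
    induction m with
    | zero => exact id
    | succ m ih => exact fun h => ih (hstep m h)
  have h0 : toConv LinearMap.id * convPost π (toConv (HopfAlgebra.antipode k)) = 1 :=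
    hall _ htop
  have hπid : toConv π.toLinearMap = toConv LinearMap.id := by
    have h1 : convPost π (toConv (HopfAlgebra.antipode k)) * convPost π (toConv LinearMap.id) = 1 := by
      rw [← map_mul, LinearMap.antipode_mul_id, map_one]
    have h2 := left_inv_eq_right_inv h0 h1
    exact h2.symm
  have hinj : Function.Injective (HopfAlgebra.antipode k (A := A)) := by
    rw [← LinearMap.ker_eq_bot, Submodule.eq_bot_iff]
    intro x hx
    have hx' : HopfAlgebra.antipode k x = 0 := hx
    have h1 : π x = x := congrArg (fun f => f.ofConv x) hπid
    rw [← h1, hπ, hcomm, hφ, pow_succ]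
    change g ((antipodeSq (k := k) ^ n) (HopfAlgebra.antipode k (HopfAlgebra.antipode k x))) = 0
    rw [hx', map_zero, map_zero, map_zero]
  exact ⟨hinj, LinearMap.injective_iff_surjective.1 hinj⟩

end AntipodeBijective

section DrinfeldDouble

set_option linter.unusedSectionVars false

open Coalgebra

variable (k A : Type u) [Field k] [Ring A] [HopfAlgebra k A] [FiniteDimensional k A]

/-- The inverse `S⁻¹` of the antipode of a finite-dimensional Hopf algebra. -/
noncomputable def antipodeInv : A →ₗ[k] A :=
  (LinearEquiv.ofBijective (HopfAlgebra.antipode k (A := A)) antipode_bijective).symm.toLinearMap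

/-- The underlying space `A* ⊗ A` of the Drinfel'd double of `A`. -/
def DrinfeldDouble : Type u := Module.Dual k A ⊗[k] A

variable {k A}

noncomputable instance : AddCommGroup (DrinfeldDouble k A) :=
  inferInstanceAs (AddCommGroup (Module.Dual k A ⊗[k] A))

noncomputable instance : Module k (DrinfeldDouble k A) :=
  inferInstanceAs (Module k (Module.Dual k A ⊗[k] A))

theorem antipode_antipodeInv (x : A) : HopfAlgebra.antipode k (antipodeInv k A x) = x :=
  (LinearEquiv.ofBijective (HopfAlgebra.antipode k (A := A)) antipode_bijective).apply_symm_apply x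

theorem antipodeInv_antipode (x : A) : antipodeInv k A (HopfAlgebra.antipode k x) = x :=
  (LinearEquiv.ofBijective (HopfAlgebra.antipode k (A := A)) antipode_bijective).symm_apply_apply x

theorem antipodeInv_mul (x y : A) :
    antipodeInv k A (x * y) = antipodeInv k A y * antipodeInv k A x := by
  apply antipode_bijective (k := k).1
  simp [HopfAlgebra.antipode_mul_antidistrib, antipode_antipodeInv]

theorem antipodeInv_one : antipodeInv k A 1 = 1 := by
  apply antipode_bijective (k := k).1
  simp [antipode_antipodeInv]

theorem counit_antipodeInv (x : A) : counit (R := k) (antipodeInv k A x) = counit x := by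
  conv_rhs => rw [← antipode_antipodeInv (k := k) x]
  simp

theorem comul_antipodeInv (x : A) : comul (R := k) (antipodeInv k A x) =
    TensorProduct.map (antipodeInv k A) (antipodeInv k A) (TensorProduct.comm k A A (comul x)) := by
  conv_rhs => rw [← antipode_antipodeInv (k := k) x, comul_antipode_apply]
  induction comul (R := k) (antipodeInv k A x) using TensorProduct.induction_on with
  | zero => simp
  | add x y hx hy => simp only [map_add, ← hx, ← hy]
  | tmul x y => simp [antipodeInv_antipode]

/-- `∑ S⁻¹(a₂) a₁ = ε(a)`. -/
theorem sum_antipodeInv_mul (x : A) : LinearMap.mul' k A (TensorProduct.comm k A A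
    ((antipodeInv k A).lTensor A (comul x))) = algebraMap k A (counit x) := by
  apply antipode_bijective (k := k).1
  have key : ∀ z : A ⊗[k] A, HopfAlgebra.antipode k (LinearMap.mul' k A (TensorProduct.comm k A A
      ((antipodeInv k A).lTensor A z))) =
      LinearMap.mul' k A ((HopfAlgebra.antipode k).rTensor A z) := by
    intro z
    induction z using TensorProduct.induction_on with
    | zero => simp
    | add x y hx hy => simp only [map_add, hx, hy]
    | tmul x y => simp [HopfAlgebra.antipode_mul_antidistrib, antipode_antipodeInv]
  rw [key, HopfAlgebra.mul_antipode_rTensor_comul_apply]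
  simp [Algebra.algebraMap_eq_smul_one]

namespace DrinfeldDouble

variable (k A)

/-- `a ↦ ∑ a₁ ⊗ (a₂ ⊗ a₃)`. -/
noncomputable def comul₃ : A →ₗ[k] A ⊗[k] (A ⊗[k] A) :=
  (comul (R := k) (A := A)).lTensor A ∘ₗ comul

/-- The map sending `x, z` to the operator `q ↦ (w ↦ q(S⁻¹(z) w x))` on `A*`. -/
noncomputable def dualConj : A →ₗ[k] A →ₗ[k] Module.End k (Module.Dual k A) :=
  LinearMap.mk₂ k (fun x z => LinearMap.lcomp k k
      (LinearMap.mulLeft k (antipodeInv k A z) ∘ₗ LinearMap.mulRight k x))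
    (fun x y z => by ext q w; simp [mul_add])
    (fun c x z => by ext q w; simp)
    (fun x z z' => by ext q w; simp [add_mul])
    (fun c x z => by ext q w; simp)

/-- The left multiplication of the convolution algebra `A*`: `(p * q)(w) = ∑ p(w₁) q(w₂)`. -/
noncomputable def dualMul : Module.Dual k A →ₗ[k] Module.End k (Module.Dual k A) :=
  LinearMap.mk₂ k (fun p q => LinearMap.mul' k k ∘ₗ TensorProduct.map p q ∘ₗ comul)
    (fun p p' q => by rw [TensorProduct.map_add_left, LinearMap.add_comp, LinearMap.comp_add])
    (fun c p q => by rw [TensorProduct.map_smul_left, LinearMap.smul_comp, LinearMap.comp_smul])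
    (fun p q q' => by rw [TensorProduct.map_add_right, LinearMap.add_comp, LinearMap.comp_add])
    (fun c p q => by rw [TensorProduct.map_smul_right, LinearMap.smul_comp, LinearMap.comp_smul])

/-- `x ⊗ (y ⊗ z)` acts on `A* ⊗ A` by `q ⊗ b ↦ q(S⁻¹(z) - x) ⊗ y b`. -/
noncomputable def act₃ : A ⊗[k] (A ⊗[k] A) →ₗ[k] Module.End k (Module.Dual k A ⊗[k] A) :=
  TensorProduct.homTensorHomMap (RingHom.id k) (Module.Dual k A) A (Module.Dual k A) A ∘ₗ
    TensorProduct.map (TensorProduct.lift (dualConj k A)) (LinearMap.mul k A) ∘ₗ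
    (TensorProduct.assoc k A A A).symm.toLinearMap ∘ₗ
    (TensorProduct.comm k A A).toLinearMap.lTensor A

/-- `a` acts on `A* ⊗ A` by `q ⊗ b ↦ ∑ q(S⁻¹(a₃) - a₁) ⊗ a₂ b`. -/
noncomputable def actA : A →ₗ[k] Module.End k (Module.Dual k A ⊗[k] A) :=
  act₃ k A ∘ₗ comul₃ k A

/-- `p` acts on `A* ⊗ A` by `q ⊗ b ↦ p * q ⊗ b`. -/
noncomputable def actDual : Module.Dual k A →ₗ[k] Module.End k (Module.Dual k A ⊗[k] A) :=
  LinearMap.rTensorHom A ∘ₗ dualMul k A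

/-- The multiplication of the Drinfel'd double:
`(p ⊗ a) (q ⊗ b) = ∑ p * q(S⁻¹(a₃) - a₁) ⊗ a₂ b`. -/
noncomputable def mulHom :
    Module.Dual k A ⊗[k] A →ₗ[k] Module.End k (Module.Dual k A ⊗[k] A) :=
  LinearMap.mul' k (Module.End k (Module.Dual k A ⊗[k] A)) ∘ₗ
    TensorProduct.map (actDual k A) (actA k A)

variable {k A}

@[simp] theorem dualConj_apply (x z w : A) (q : Module.Dual k A) :
    dualConj k A x z q w = q (antipodeInv k A z * (w * x)) := rfl

@[simp] theorem act₃_tmul (x y z b : A) (q : Module.Dual k A) :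
    act₃ k A (x ⊗ₜ (y ⊗ₜ z)) (q ⊗ₜ b) = dualConj k A x z q ⊗ₜ (y * b) := rfl

@[simp] theorem actDual_tmul (p q : Module.Dual k A) (b : A) :
    actDual k A p (q ⊗ₜ b) = dualMul k A p q ⊗ₜ b := rfl

@[simp] theorem mulHom_tmul (p : Module.Dual k A) (a : A) :
    mulHom k A (p ⊗ₜ a) = actDual k A p * actA k A a := rfl

theorem dualMul_apply (p q : Module.Dual k A) (w : A) :
    dualMul k A p q w = LinearMap.mul' k k (TensorProduct.map p q (comul w)) := rfl

theorem dualMul_mul (p q r : Module.Dual k A) :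
    dualMul k A (dualMul k A p q) r = dualMul k A p (dualMul k A q r) := by
  have := mul_assoc (WithConv.toConv p) (WithConv.toConv q) (WithConv.toConv r)
  exact congrArg WithConv.ofConv this

theorem dualMul_counit : dualMul k A counit = 1 := by
  ext q w
  have := one_mul (WithConv.toConv q)
  exact congrArg (fun f => f.ofConv w) this

theorem dualMul_counit_right (q : Module.Dual k A) : dualMul k A q counit = q := by
  have := mul_one (WithConv.toConv q)
  exact congrArg (fun f => f.ofConv) this

theorem act₃_mul (s t : A ⊗[k] (A ⊗[k] A)) : act₃ k A (s * t) = act₃ k A s * act₃ k A t := by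
  induction s using TensorProduct.induction_on with
  | zero => simp
  | add x y hx hy => simp only [add_mul, map_add, hx, hy]
  | tmul x s =>
  induction s using TensorProduct.induction_on with
  | zero => simp
  | add x y hx hy => simp only [TensorProduct.tmul_add, add_mul, map_add, hx, hy]
  | tmul y z =>
  induction t using TensorProduct.induction_on with
  | zero => simp
  | add x y hx hy => simp only [mul_add, map_add, hx, hy]
  | tmul x' t =>
  induction t using TensorProduct.induction_on with
  | zero => simp
  | add x y hx hy => simp only [TensorProduct.tmul_add, mul_add, map_add, hx, hy]
  | tmul y' z' =>
    refine TensorProduct.ext' fun q b => ?_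
    simp only [Algebra.TensorProduct.tmul_mul_tmul, act₃_tmul, Module.End.mul_apply]
    congr 1
    · ext w
      simp [antipodeInv_mul, mul_assoc]
    · exact mul_assoc _ _ _

theorem comul₃_mul (a b : A) : comul₃ k A (a * b) = comul₃ k A a * comul₃ k A b := by
  change (Algebra.TensorProduct.map (AlgHom.id k A) (Bialgebra.comulAlgHom k A))
    (Bialgebra.comulAlgHom k A (a * b)) = _
  rw [map_mul, map_mul]
  rfl

theorem actA_mul (a b : A) : actA k A (a * b) = actA k A a * actA k A b := by
  simp only [actA, LinearMap.comp_apply, comul₃_mul, act₃_mul]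

theorem actA_one : actA k A 1 = 1 := by
  have h : comul₃ k A 1 = 1 ⊗ₜ (1 ⊗ₜ 1) := by
    simp [comul₃, Algebra.TensorProduct.one_def]
  refine TensorProduct.ext' fun q b => ?_
  rw [actA, LinearMap.comp_apply, h, act₃_tmul]
  simp only [one_mul, Module.End.one_apply]
  congr 1
  ext w
  simp [antipodeInv_one]

theorem actDual_mul (p q : Module.Dual k A) :
    actDual k A (dualMul k A p q) = actDual k A p * actDual k A q :=
  TensorProduct.ext' fun r b => by simp [dualMul_mul]

theorem actDual_counit : actDual k A counit = 1 :=
  TensorProduct.ext' fun r b => by simp [dualMul_counit]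

/-- `(x₁ ⊗ x₂) ⊗ (y ⊗ (z₁ ⊗ z₂)) ↦ x₁ ⊗ ((x₂ ⊗ (y ⊗ z₁)) ⊗ z₂)`. -/
noncomputable def reassoc :
    (A ⊗[k] A) ⊗[k] (A ⊗[k] (A ⊗[k] A)) →ₗ[k] A ⊗[k] ((A ⊗[k] (A ⊗[k] A)) ⊗[k] A) :=
  ((TensorProduct.assoc k A (A ⊗[k] A) A).symm.toLinearMap ∘ₗ
    (TensorProduct.assoc k A A A).symm.toLinearMap.lTensor A).lTensor A ∘ₗ
  (TensorProduct.assoc k A A (A ⊗[k] (A ⊗[k] A))).toLinearMap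

theorem reassoc_comul₃ (a : A) :
    reassoc (TensorProduct.map (comul (R := k) (A := A)) ((comul (R := k) (A := A)).lTensor A)
      (comul₃ k A a)) = ((comul₃ k A).rTensor A).lTensor A (comul₃ k A a) := by
  have : reassoc ∘ₗ TensorProduct.map (comul (R := k) (A := A))
      ((comul (R := k) (A := A)).lTensor A) ∘ₗ comul₃ k A =
      ((comul₃ k A).rTensor A).lTensor A ∘ₗ comul₃ k A := by
    simp only [comul₃, reassoc]
    simp only [coassoc_simps]
  exact LinearMap.congr_fun this a

/-- `x ⊗ (t ⊗ z) ↦ D(q(S⁻¹(z) - x)) F(t)`. -/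
noncomputable def conjMul {B E : Type u} [AddCommMonoid B] [Module k B] [AddCommMonoid E]
    [Module k E] (D : Module.Dual k A →ₗ[k] Module.End k E) (q : Module.Dual k A)
    (F : B →ₗ[k] Module.End k E) : A ⊗[k] (B ⊗[k] A) →ₗ[k] Module.End k E :=
  LinearMap.mul' k (Module.End k E) ∘ₗ
    TensorProduct.map (D ∘ₗ (TensorProduct.lift (dualConj k A)).flip q) F ∘ₗ
    (TensorProduct.assoc k A A B).symm.toLinearMap ∘ₗ
    (TensorProduct.comm k B A).toLinearMap.lTensor A

@[simp] theorem conjMul_tmul {B E : Type u} [AddCommMonoid B] [Module k B] [AddCommMonoid E]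
    [Module k E] (D : Module.Dual k A →ₗ[k] Module.End k E) (q : Module.Dual k A)
    (F : B →ₗ[k] Module.End k E) (x z : A) (t : B) :
    conjMul D q F (x ⊗ₜ (t ⊗ₜ z)) = D (dualConj k A x z q) * F t := rfl

theorem act₃_mul_actDual_aux (q r : Module.Dual k A) (y b : A) (X Z : A ⊗[k] A) :
    conjMul (actDual k A) q (act₃ k A) (reassoc (X ⊗ₜ (y ⊗ₜ Z))) (r ⊗ₜ b) =
      (LinearMap.mul' k k ∘ₗ TensorProduct.map q r ∘ₗ
        LinearMap.mulLeft k (TensorProduct.map (antipodeInv k A) (antipodeInv k A)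
          (TensorProduct.comm k A A Z)) ∘ₗ LinearMap.mulRight k X ∘ₗ comul (R := k)) ⊗ₜ (y * b) := by
  induction X using TensorProduct.induction_on with
  | zero =>
    rw [TensorProduct.zero_tmul, map_zero, map_zero, LinearMap.zero_apply]
    rw [LinearMap.mulRight_zero_eq_zero]
    simp
  | add X X' h h' =>
    rw [TensorProduct.add_tmul, map_add, map_add, LinearMap.add_apply, h, h',
      ← TensorProduct.add_tmul]
    congr 1
    ext w
    simp [mul_add]
  | tmul x₁ x₂ =>
  induction Z using TensorProduct.induction_on with
  | zero =>
    rw [TensorProduct.tmul_zero, TensorProduct.tmul_zero, map_zero, map_zero,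
      LinearMap.zero_apply]
    simp
  | add X X' h h' =>
    rw [TensorProduct.tmul_add, TensorProduct.tmul_add, map_add, map_add, LinearMap.add_apply,
      h, h', ← TensorProduct.add_tmul]
    congr 1
    ext w
    simp [add_mul]
  | tmul z₁ z₂ =>
  simp only [reassoc, LinearMap.comp_apply, LinearEquiv.coe_coe, TensorProduct.assoc_tmul,
    LinearMap.lTensor_tmul, TensorProduct.assoc_symm_tmul, conjMul_tmul, Module.End.mul_apply,
    act₃_tmul, actDual_tmul]
  congr 1
  ext w
  rw [dualMul_apply]
  simp only [LinearMap.comp_apply]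
  induction comul (R := k) w using TensorProduct.induction_on with
  | zero => simp
  | add X X' h h' => simp only [map_add, h, h']
  | tmul w₁ w₂ => simp

theorem act₃_mul_actDual (t : A ⊗[k] (A ⊗[k] A)) (q : Module.Dual k A) :
    act₃ k A t * actDual k A q = conjMul (actDual k A) q (act₃ k A)
      (reassoc (TensorProduct.map comul ((comul (R := k) (A := A)).lTensor A) t)) := by
  induction t using TensorProduct.induction_on with
  | zero => simp
  | add x y hx hy => simp only [add_mul, map_add, hx, hy]
  | tmul x s =>
  induction s using TensorProduct.induction_on with
  | zero => simp
  | add x y hx hy => simp only [TensorProduct.tmul_add, add_mul, map_add, hx, hy]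
  | tmul y z =>
  refine TensorProduct.ext' fun r b => ?_
  rw [TensorProduct.map_tmul, LinearMap.lTensor_tmul, act₃_mul_actDual_aux, Module.End.mul_apply,
    actDual_tmul, act₃_tmul]
  congr 1
  ext w
  rw [dualConj_apply, dualMul_apply, Bialgebra.comul_mul, Bialgebra.comul_mul, comul_antipodeInv]
  rfl

theorem actA_mul_actDual (a : A) (q : Module.Dual k A) :
    actA k A a * actDual k A q = conjMul (actDual k A) q (actA k A) (comul₃ k A a) := by
  rw [actA, LinearMap.comp_apply, act₃_mul_actDual, reassoc_comul₃]
  generalize comul₃ k A a = t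
  induction t using TensorProduct.induction_on with
  | zero => simp
  | add x y hx hy => simp only [map_add, hx, hy]
  | tmul x s =>
  induction s using TensorProduct.induction_on with
  | zero => simp
  | add x y hx hy => simp only [TensorProduct.tmul_add, map_add, hx, hy]
  | tmul y z => rfl

/-- Operators `D(p)` and `F(a)` satisfying the relations of the Drinfel'd double define a
representation of it. -/
theorem map_mulHom {E : Type u} [AddCommMonoid E] [Module k E]
    {D : Module.Dual k A →ₗ[k] Module.End k E} {F : A →ₗ[k] Module.End k E}
    (hD : ∀ p q, D (dualMul k A p q) = D p * D q) (hF : ∀ a b, F (a * b) = F a * F b)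
    (hFD : ∀ a q, F a * D q = conjMul D q F (comul₃ k A a)) (s t : Module.Dual k A ⊗[k] A) :
    LinearMap.mul' k (Module.End k E) (TensorProduct.map D F (mulHom k A s t)) =
      LinearMap.mul' k (Module.End k E) (TensorProduct.map D F s) *
        LinearMap.mul' k (Module.End k E) (TensorProduct.map D F t) := by
  have h1 : ∀ p (t : Module.Dual k A ⊗[k] A),
      LinearMap.mul' k (Module.End k E) (TensorProduct.map D F (actDual k A p t)) =
        D p * LinearMap.mul' k (Module.End k E) (TensorProduct.map D F t) := by
    intro p t
    induction t using TensorProduct.induction_on with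
    | zero => simp
    | add x y hx hy => simp only [map_add, hx, hy, mul_add]
    | tmul q b => simp [hD, mul_assoc]
  have h2 : ∀ a (t : Module.Dual k A ⊗[k] A),
      LinearMap.mul' k (Module.End k E) (TensorProduct.map D F (actA k A a t)) =
        F a * LinearMap.mul' k (Module.End k E) (TensorProduct.map D F t) := by
    intro a t
    induction t using TensorProduct.induction_on with
    | zero => simp
    | add x y hx hy => simp only [map_add, hx, hy, mul_add]
    | tmul q b =>
    rw [TensorProduct.map_tmul, LinearMap.mul'_apply, ← mul_assoc, hFD, actA,
      LinearMap.comp_apply]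
    generalize comul₃ k A a = u
    induction u using TensorProduct.induction_on with
    | zero => simp
    | add x y hx hy => simp only [map_add, LinearMap.add_apply, hx, hy, add_mul]
    | tmul x s =>
    induction s using TensorProduct.induction_on with
    | zero => simp
    | add x y hx hy =>
      simp only [TensorProduct.tmul_add, map_add, LinearMap.add_apply, hx, hy, add_mul]
    | tmul y z =>
      rw [act₃_tmul, TensorProduct.map_tmul, LinearMap.mul'_apply, conjMul_tmul, hF, mul_assoc]
  induction s using TensorProduct.induction_on with
  | zero => simp
  | add x y hx hy => simp only [map_add, LinearMap.add_apply, hx, hy, add_mul]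
  | tmul p a =>
    rw [mulHom_tmul, Module.End.mul_apply, h1, h2, TensorProduct.map_tmul, LinearMap.mul'_apply,
      mul_assoc]

theorem mulHom_mulHom (s t : Module.Dual k A ⊗[k] A) :
    mulHom k A (mulHom k A s t) = mulHom k A s * mulHom k A t :=
  map_mulHom actDual_mul actA_mul actA_mul_actDual s t

theorem mulHom_one : mulHom k A (counit ⊗ₜ 1) = 1 := by
  rw [mulHom_tmul, actA_one, actDual_counit, mul_one]

theorem mulHom_apply_one (t : Module.Dual k A ⊗[k] A) : mulHom k A t (counit ⊗ₜ 1) = t := by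
  have h : ∀ a : A, actA k A a (counit ⊗ₜ 1) = counit ⊗ₜ a := by
    intro a
    have key : ∀ u : A ⊗[k] (A ⊗[k] A), act₃ k A u (counit ⊗ₜ 1) =
        counit ⊗ₜ (TensorProduct.rid k A ((counit (R := k) (A := A)).lTensor A
          (TensorProduct.lid k (A ⊗[k] A) ((counit (R := k) (A := A)).rTensor (A ⊗[k] A) u)))) := by
      intro u
      induction u using TensorProduct.induction_on with
      | zero => simp
      | add x y hx hy => simp only [map_add, LinearMap.add_apply, hx, hy, TensorProduct.tmul_add]
      | tmul x s =>
      induction s using TensorProduct.induction_on with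
      | zero => simp
      | add x y hx hy =>
        simp only [TensorProduct.tmul_add, map_add, LinearMap.add_apply, hx, hy]
      | tmul y z =>
        have e : dualConj k A x z counit = (counit (R := k) x * counit (R := k) z) • counit := by
          ext w
          simp [counit_antipodeInv]
          ring
        simp [e, TensorProduct.smul_tmul, mul_smul]
    rw [actA, LinearMap.comp_apply, key]
    congr 1
    have e1 : ∀ z : A ⊗[k] A, TensorProduct.lid k (A ⊗[k] A)
        ((counit (R := k) (A := A)).rTensor (A ⊗[k] A) ((comul (R := k) (A := A)).lTensor A z)) =
        comul (TensorProduct.lid k A ((counit (R := k) (A := A)).rTensor A z)) := by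
      intro z
      induction z using TensorProduct.induction_on with
      | zero => simp
      | add x y hx hy => simp only [map_add, hx, hy]
      | tmul x y => simp
    rw [comul₃, LinearMap.comp_apply, e1, rTensor_counit_comul]
    simp
  induction t using TensorProduct.induction_on with
  | zero => simp
  | add x y hx hy => simp only [map_add, LinearMap.add_apply, hx, hy]
  | tmul p a => rw [mulHom_tmul, Module.End.mul_apply, h, actDual_tmul, dualMul_counit_right]

/-- The Drinfel'd double as an algebra: `A* ⊗ A` with unit `ε ⊗ 1` and multiplication
`(p ⊗ a) (q ⊗ b) = ∑ p * q(S⁻¹(a₃) - a₁) ⊗ a₂ b`. -/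
noncomputable instance : Ring (DrinfeldDouble k A) where
  __ := (inferInstance : AddCommGroup (DrinfeldDouble k A))
  mul s t := mulHom k A s t
  one := (counit (R := k) (A := A) : Module.Dual k A) ⊗ₜ[k] (1 : A)
  left_distrib s t t' := (mulHom k A s).map_add t t'
  right_distrib s s' t := congrArg (fun f => f t) ((mulHom k A).map_add s s')
  zero_mul t := congrArg (fun f => f t) (mulHom k A).map_zero
  mul_zero s := (mulHom k A s).map_zero
  mul_assoc s t r := congrArg (fun f => f r) (mulHom_mulHom s t)
  one_mul t := congrArg (fun f => f t) mulHom_one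
  mul_one t := mulHom_apply_one t

end DrinfeldDouble

end DrinfeldDouble

section ToDouble

open Coalgebra

set_option linter.unusedSectionVars false

namespace YetterDrinfeld

variable {k A : Type u} [Field k] [Ring A] [HopfAlgebra k A] [FiniteDimensional k A]
  (M : YetterDrinfeld k A)

/-- The action of `A*` on `M` given by `p · m = ∑ p(m₁) m₀`. -/
noncomputable def dualOp : Module.Dual k A →ₗ[k] Module.End k M.carrier where
  toFun p := (TensorProduct.rid k M.carrier).toLinearMap ∘ₗ p.lTensor M.carrier ∘ₗ M.coact
  map_add' p q := by rw [LinearMap.lTensor_add, LinearMap.add_comp, LinearMap.comp_add]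
  map_smul' c p := by
    rw [LinearMap.lTensor_smul, LinearMap.smul_comp, LinearMap.comp_smul]; rfl

/-- The action of `A` on `M`. -/
noncomputable def actOp : A →ₗ[k] Module.End k M.carrier := TensorProduct.curry M.act

@[simp] theorem actOp_apply (a : A) (m : M.carrier) : M.actOp a m = M.act (a ⊗ₜ m) := rfl

theorem dualOp_apply (p : Module.Dual k A) (m : M.carrier) :
    M.dualOp p m = TensorProduct.rid k M.carrier (p.lTensor M.carrier (M.coact m)) := rfl

/-- The action of the Drinfel'd double on `M`: `(p ⊗ a) · m = ∑ p((a · m)₁) (a · m)₀`. -/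
noncomputable def doubleOp : Module.Dual k A ⊗[k] A →ₗ[k] Module.End k M.carrier :=
  LinearMap.mul' k (Module.End k M.carrier) ∘ₗ TensorProduct.map M.dualOp M.actOp

theorem actOp_mul (a b : A) : M.actOp (a * b) = M.actOp a * M.actOp b :=
  LinearMap.ext fun m => M.isYetterDrinfeld.mul_act a b m

theorem actOp_one : M.actOp 1 = 1 :=
  LinearMap.ext fun m => M.isYetterDrinfeld.one_act m

theorem dualOp_counit : M.dualOp counit = 1 :=
  LinearMap.ext fun m => M.isYetterDrinfeld.counit m

theorem dualOp_mul (p q : Module.Dual k A) :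
    M.dualOp (DrinfeldDouble.dualMul k A p q) = M.dualOp p * M.dualOp q := by
  ext m
  have h1 : ∀ z : M.carrier ⊗[k] A, TensorProduct.rid k M.carrier
      ((DrinfeldDouble.dualMul k A p q).lTensor M.carrier z) =
      TensorProduct.rid k M.carrier ((LinearMap.mul' k k ∘ₗ TensorProduct.map p q).lTensor M.carrier
        ((comul (R := k) (A := A)).lTensor M.carrier z)) := by
    intro z
    induction z using TensorProduct.induction_on with
    | zero => simp
    | add x y hx hy => simp only [map_add, hx, hy]
    | tmul x y => simp [DrinfeldDouble.dualMul_apply]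
  rw [dualOp_apply, h1, ← M.isYetterDrinfeld.coassoc, Module.End.mul_apply, M.dualOp_apply q]
  induction M.coact m using TensorProduct.induction_on with
  | zero => simp
  | add x y hx hy => simp only [map_add, hx, hy]
  | tmul x y =>
    rw [LinearMap.rTensor_tmul, LinearMap.lTensor_tmul, TensorProduct.rid_tmul, map_smul,
      dualOp_apply]
    induction M.coact x using TensorProduct.induction_on with
    | zero => simp
    | add x y hx hy => simp only [map_add, TensorProduct.add_tmul, smul_add, hx, hy]
    | tmul v w => simp [smul_smul, mul_comm]

theorem actOp_mul_dualOp (a : A) (q : Module.Dual k A) :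
    M.actOp a * M.dualOp q =
      DrinfeldDouble.conjMul M.dualOp q M.actOp (DrinfeldDouble.comul₃ k A a) := by
  ext m
  have hc : DrinfeldDouble.comul₃ k A a =
      TensorProduct.assoc k A A A ((comul (R := k)).rTensor A (comul a)) :=
    (Coalgebra.coassoc_apply a).symm
  -- `(n ⊗ x), z ↦ q(S⁻¹(z) x) n`
  let g : A → M.carrier ⊗[k] A →ₗ[k] M.carrier := fun z =>
    (TensorProduct.rid k M.carrier).toLinearMap ∘ₗ
      (q ∘ₗ LinearMap.mulLeft k (antipodeInv k A z)).lTensor M.carrier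
  have h1 : ∀ (z : A) (s : A ⊗[k] A),
      DrinfeldDouble.conjMul M.dualOp q M.actOp (TensorProduct.assoc k A A A (s ⊗ₜ z)) m =
      g z ((LinearMap.mul' k A).lTensor M.carrier (TensorProduct.assoc k M.carrier A A
        (M.coact.rTensor A (TensorProduct.comm k A M.carrier (M.act.lTensor A
          (TensorProduct.assoc k A A M.carrier (s ⊗ₜ m))))))) := by
    intro z s
    induction s using TensorProduct.induction_on with
    | zero => simp
    | add x y hx hy => simp only [TensorProduct.add_tmul, map_add, LinearMap.add_apply, hx, hy]
    | tmul x y =>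
      simp only [TensorProduct.assoc_tmul, DrinfeldDouble.conjMul_tmul, Module.End.mul_apply,
        actOp_apply, LinearMap.lTensor_tmul, TensorProduct.comm_tmul, LinearMap.rTensor_tmul]
      rw [dualOp_apply]
      induction M.coact (M.act (y ⊗ₜ m)) using TensorProduct.induction_on with
      | zero => simp
      | add x y hx hy => simp only [TensorProduct.add_tmul, map_add, hx, hy]
      | tmul v w => simp [g]
  let σ : A ⊗[k] A →ₗ[k] A := LinearMap.mul' k A ∘ₗ (TensorProduct.comm k A A).toLinearMap ∘ₗ
    (antipodeInv k A).lTensor A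
  let κ : A ⊗[k] A → M.carrier := fun t => TensorProduct.rid k M.carrier (q.lTensor M.carrier
    (TensorProduct.map M.act (LinearMap.mul' k A)
      (TensorProduct.tensorTensorTensorComm k A A M.carrier A (t ⊗ₜ M.coact m))))
  have κ0 : κ 0 = 0 := by simp [κ]
  have κadd : ∀ s t, κ (s + t) = κ s + κ t := by
    intro s t
    simp only [κ, TensorProduct.add_tmul, map_add]
  have h2 : ∀ (z : A) (s : A ⊗[k] A),
      g z (TensorProduct.map M.act (LinearMap.mul' k A)
        (TensorProduct.tensorTensorTensorComm k A A M.carrier A (s ⊗ₜ M.coact m))) =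
      κ (σ.lTensor A (TensorProduct.assoc k A A A (s ⊗ₜ z))) := by
    intro z s
    induction s using TensorProduct.induction_on with
    | zero => simp [κ0]
    | add x y hx hy => simp only [TensorProduct.add_tmul, map_add, κadd, hx, hy]
    | tmul x y =>
      simp only [κ, TensorProduct.assoc_tmul, LinearMap.lTensor_tmul]
      induction M.coact m using TensorProduct.induction_on with
      | zero => simp
      | add x y hx hy => simp only [TensorProduct.tmul_add, map_add, hx, hy]
      | tmul v w => simp [g, σ, mul_assoc]
  have h3 : ∀ t : A ⊗[k] A,
      DrinfeldDouble.conjMul M.dualOp q M.actOp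
        (TensorProduct.assoc k A A A ((comul (R := k)).rTensor A t)) m =
      κ (σ.lTensor A (TensorProduct.assoc k A A A ((comul (R := k)).rTensor A t))) := by
    intro t
    induction t using TensorProduct.induction_on with
    | zero => simp [κ0]
    | add x y hx hy => simp only [map_add, LinearMap.add_apply, κadd, hx, hy]
    | tmul c z =>
      rw [LinearMap.rTensor_tmul, h1, ← h2]
      exact congrArg (g z) (M.isYetterDrinfeld.compat c m)
  have h4 : σ ∘ₗ comul (R := k) = Algebra.linearMap k A ∘ₗ counit (R := k) :=
    LinearMap.ext fun x => sum_antipodeInv_mul x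
  rw [hc, h3, Coalgebra.coassoc_apply, ← LinearMap.comp_apply (σ.lTensor A),
    ← LinearMap.lTensor_comp, h4, LinearMap.lTensor_comp, LinearMap.comp_apply,
    Coalgebra.lTensor_counit_comul, LinearMap.lTensor_tmul, Algebra.linearMap_apply, map_one,
    Module.End.mul_apply, dualOp_apply, actOp_apply]
  simp only [κ]
  induction M.coact m using TensorProduct.induction_on with
  | zero => simp
  | add x y hx hy => simp only [TensorProduct.tmul_add, map_add, hx, hy]
  | tmul v w => simp

theorem doubleOp_mul (s t : DrinfeldDouble k A) :
    M.doubleOp (s * t) = M.doubleOp s * M.doubleOp t :=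
  DrinfeldDouble.map_mulHom M.dualOp_mul M.actOp_mul M.actOp_mul_dualOp s t

theorem doubleOp_one : M.doubleOp (1 : DrinfeldDouble k A) = 1 := by
  change M.dualOp counit * M.actOp 1 = 1
  rw [dualOp_counit, actOp_one, one_mul]

/-- The structure of a left module over the Drinfel'd double on `M`. -/
@[reducible] noncomputable def doubleModule : Module (DrinfeldDouble k A) M.carrier where
  smul t m := M.doubleOp t m
  one_smul m := congrArg (fun f => f m) M.doubleOp_one
  mul_smul s t m := congrArg (fun f => f m) (M.doubleOp_mul s t)
  smul_zero t := (M.doubleOp t).map_zero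
  smul_add t := (M.doubleOp t).map_add
  add_smul s t m := congrArg (fun f => f m) (M.doubleOp.map_add s t)
  zero_smul m := congrArg (fun f => f m) M.doubleOp.map_zero

/-- `M` as a left module over the Drinfel'd double. -/
noncomputable def toDouble : ModuleCat.{u} (DrinfeldDouble k A) :=
  letI := M.doubleModule
  ModuleCat.of (DrinfeldDouble k A) M.carrier

end YetterDrinfeld

end ToDouble

/-! Over a field, an extension of M by N splits as a sequence of vector spaces, so its middle term
may be taken to be N ⊕ M with block triangular structure maps. The diagonal blocks are those of N
and M; the only freedom lies in the off-diagonal blocks ω : A ⊗ M → N and ρ : M → N ⊗ A. The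
Yetter-Drinfel'd axioms for the sum then reduce to three identities, collected in `IsTwisting`. They
are linear in (ω, ρ), because a product of two off-diagonal blocks would have to pass from M to N
twice. The unit and counit axioms follow from these three (`isTwisting_iff`). The identities are the
components of bidegree (2,0), (1,1) and (0,2) of the total differential, so block structures on N ⊕
M are the same as 1-cocycles (`mem_cocycles_one_iff`).

An equivalence between two such extensions is the identity on N and on the quotient M, hence a shear
(n, m) ↦ (n + f(m), m). It respects the structures exactly when the difference of the two cocycles
is the coboundary of f (`twist_equiv_of`, `exists_of_twist_equiv`, `mem_coboundaries_one_iff`). With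
`exists_twist_equiv` this gives the bijection of (a). Adding the N-components on the fibre product
identifies the Baer sum with the sum of cocycles (`baerSum_twist`), so the bijection is a group
isomorphism.

For (b), Ext¹ is invariant under additive equivalences of abelian categories (`Ext1.mapEquiv`), so
it suffices that `toDoubleFunctor` is an equivalence. When A is finite-dimensional, a coaction of A
is the same as an action of A*, and the Yetter-Drinfel'd condition becomes the rule of D(A) for
moving an element of A past a functional. Full faithfulness is read off from the subspaces ε ⊗ A and
A* ⊗ 1. Essential surjectivity rests on `isYetterDrinfeld_of_double`, where a cancellation ∑ a₂
S⁻¹(a₁) = ε(a) turns the commutation rule back into the Yetter-Drinfel'd condition. -/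

/-! ### Extensions and Baer sums under an equivalence of abelian categories. -/

section ExtensionTransfer

universe v w v' w'

variable {C : Type w} [Category.{v} C] [Abelian C]

namespace Extension

variable {M N : C}

/-- A morphism of extensions which is the identity on both ends is an equivalence. -/
theorem equiv_of_hom {E F : Extension M N} (φ : E.X ⟶ F.X) (hi : E.i ≫ φ = F.i)
    (hp : φ ≫ F.p = E.p) : E ≈ F := by
  let ψ : ShortComplex.mk E.i E.p E.w ⟶ ShortComplex.mk F.i F.p F.w :=
    { τ₁ := 𝟙 N, τ₂ := φ, τ₃ := 𝟙 M, comm₁₂ := by simp [hi], comm₂₃ := by simp [hp] }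
  have h1 : IsIso ψ.τ₁ := inferInstanceAs (IsIso (𝟙 N))
  have h3 : IsIso ψ.τ₃ := inferInstanceAs (IsIso (𝟙 M))
  -- The five lemma for short exact sequences.
  have h2 : IsIso φ := ShortComplex.isIso₂_of_shortExact_of_isIso₁₃ ψ E.shortExact F.shortExact
  exact ⟨asIso φ, hi, hp⟩

/-- Written as a difference of the two inclusions of N, the skew diagonal is killed by any map that
agrees on the two copies of N. That is the form in which maps out of a Baer sum are produced. -/
theorem skewDiag_eq (E F : Extension M N) : skewDiag E F =
    pullback.lift E.i 0 (by simp [E.w]) - pullback.lift 0 F.i (by simp [F.w]) := by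
  apply pullback.hom_ext <;> simp [skewDiag, pullback.lift_fst, pullback.lift_snd]

/-- A morphism from the fibre product which restricts to the inclusion of `N` on both summands
identifies its target with the Baer sum. -/
theorem baerSum_equiv {E F G : Extension M N} (φ : pullback E.p F.p ⟶ G.X)
    (hE : pullback.lift E.i 0 (by simp [E.w]) ≫ φ = G.i)
    (hF : pullback.lift 0 F.i (by simp [F.w]) ≫ φ = G.i)
    (hp : φ ≫ G.p = pullback.fst E.p F.p ≫ E.p) : baerSum E F ≈ G := by
  have h0 : skewDiag E F ≫ φ = 0 := by
    rw [skewDiag_eq, Preadditive.sub_comp, hE, hF, sub_self]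
  -- It is enough to have some morphism out of the quotient compatible with both ends; its
  -- invertibility is automatic.
  refine equiv_of_hom (cokernel.desc _ φ h0) ?_ ?_
  · simp only [baerSum, Category.assoc, cokernel.π_desc, hE]
  · apply coequalizer.hom_ext
    change cokernel.π _ ≫ _ ≫ _ = cokernel.π _ ≫ cokernel.desc _ _ _
    rw [cokernel.π_desc, cokernel.π_desc_assoc, hp]

variable {D : Type w'} [Category.{v'} D] [Abelian D] (Φ : C ⥤ D) [Φ.Additive] [Φ.IsEquivalence]

/-- The image of an extension under an equivalence of categories. -/
abbrev map (E : Extension M N) : Extension (Φ.obj M) (Φ.obj N) where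
  X := Φ.obj E.X
  i := Φ.map E.i
  p := Φ.map E.p
  w := by rw [← Φ.map_comp, E.w, Φ.map_zero]
  shortExact := ShortComplex.ShortExact.map_of_exact E.shortExact Φ

/-- Fullness lifts the isomorphism of middle terms and faithfulness lifts the two triangles; this
yields injectivity on Ext¹. -/
theorem map_equiv_map_iff {E F : Extension M N} : E.map Φ ≈ F.map Φ ↔ E ≈ F := by
  constructor
  · rintro ⟨e, hi, hp⟩
    exact ⟨Φ.preimageIso (X := E.X) (Y := F.X) e, Φ.map_injective (by simpa using hi),
      Φ.map_injective (by simpa using hp)⟩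
  · rintro ⟨e, hi, hp⟩
    exact ⟨Φ.mapIso e, (Φ.map_comp _ _).symm.trans (congrArg (fun f => Φ.map f) hi),
      (Φ.map_comp _ _).symm.trans (congrArg (fun f => Φ.map f) hp)⟩

/-- Essential surjectivity supplies the middle term and fullness the two maps, which gives
surjectivity on Ext¹. -/
theorem exists_map_equiv (G : Extension (Φ.obj M) (Φ.obj N)) :
    ∃ E : Extension M N, E.map Φ ≈ G := by
  let e := Φ.objObjPreimageIso G.X
  let i : N ⟶ Φ.objPreimage G.X := Φ.preimage (G.i ≫ e.inv)
  let p : Φ.objPreimage G.X ⟶ M := Φ.preimage (e.hom ≫ G.p)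
  have hi : Φ.map i = G.i ≫ e.inv := Φ.map_preimage _
  have hp : Φ.map p = e.hom ≫ G.p := Φ.map_preimage _
  have w : i ≫ p = 0 := Φ.map_injective (by simp [hi, hp, G.w])
  -- The image sequence is isomorphic to the given one, and an equivalence reflects short exactness.
  have h : ((ShortComplex.mk i p w).map Φ).ShortExact := by
    refine (ShortComplex.shortExact_iff_of_iso ?_).2 G.shortExact
    exact ShortComplex.isoMk (Iso.refl _) e (Iso.refl _) 
      ((Category.id_comp _).trans
      (by simp [hi] : G.i = Φ.map i ≫ e.hom)) (hp.symm.trans (Category.comp_id _).symm)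
  refine ⟨⟨_, i, p, w, (ShortExact.shortExact_map_iff Φ).1 h⟩, e, ?_, ?_⟩
  · simp [map, hi]
  · simp [map, hp]

/-- An equivalence preserves pullbacks, so the image of the quotient map, precomposed with the
comparison of fibre products, satisfies the criterion of `baerSum_equiv`. The cokernels themselves
need not be compared. -/
theorem map_baerSum (E F : Extension M N) :
    (baerSum E F).map Φ ≈ baerSum (E.map Φ) (F.map Φ) := by
  refine Setoid.symm (baerSum_equiv ((PreservesPullback.iso Φ E.p F.p).inv ≫
    Φ.map (cokernel.π (skewDiag E F))) ?_ ?_ ?_)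
  · have h : pullback.lift (f := Φ.map E.p) (g := Φ.map F.p) (Φ.map E.i) 0
        (by rw [← Φ.map_comp, E.w, Φ.map_zero, zero_comp]) ≫
        (PreservesPullback.iso Φ E.p F.p).inv =
        Φ.map (pullback.lift E.i 0 (by simp [E.w])) := by
      rw [Iso.comp_inv_eq]
      apply pullback.hom_ext
      · simp [pullback.lift_fst]
      · simp [pullback.lift_snd]
    rw [reassoc_of% h]
    exact (Φ.map_comp _ _).symm
  · have h : pullback.lift (f := Φ.map E.p) (g := Φ.map F.p) 0 (Φ.map F.i)
        (by rw [← Φ.map_comp, F.w, Φ.map_zero, zero_comp]) ≫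
        (PreservesPullback.iso Φ E.p F.p).inv =
        Φ.map (pullback.lift 0 F.i (by simp [F.w])) := by
      rw [Iso.comp_inv_eq]
      apply pullback.hom_ext
      · simp [pullback.lift_fst]
      · simp [pullback.lift_snd]
    rw [reassoc_of% h]
    -- The Baer sum uses the first copy of N for its inclusion. The second copy gives the same map,
    -- since the two differ by the skew diagonal, which the quotient kills.
    refine (Φ.map_comp _ _).symm.trans (congrArg (fun f => Φ.map f) ?_)
    change _ = pullback.lift E.i 0 (by simp [E.w]) ≫ cokernel.π (skewDiag E F)
    exact (sub_eq_zero.1 ((Preadditive.sub_comp _ _ _).symm.trans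
      ((congrArg (· ≫ cokernel.π (skewDiag E F)) (skewDiag_eq E F)).symm.trans
        (cokernel.condition (skewDiag E F))))).symm
  · simp only [map, baerSum, Category.assoc, ← Φ.map_comp, cokernel.π_desc]
    rw [Φ.map_comp, PreservesPullback.iso_inv_fst_assoc]

end Extension

theorem Ext1.mk_eq_mk {M N : C} {E F : Extension M N} : Ext1.mk E = Ext1.mk F ↔ E ≈ F :=
  Quotient.eq

/-- An additive equivalence of abelian categories induces isomorphisms on `Ext¹`. -/
noncomputable def Ext1.mapEquiv {D : Type w'} [Category.{v'} D] [Abelian D] (Φ : C ⥤ D)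
    [Φ.Additive] [Φ.IsEquivalence] (M N : C) : Ext1 M N ≃+ Ext1 (Φ.obj M) (Φ.obj N) where
  toEquiv := Equiv.ofBijective
    (Quotient.map (Extension.map Φ) fun _ _ h => (Extension.map_equiv_map_iff Φ).2 h) (by
      constructor
      · rintro ⟨E⟩ ⟨F⟩ h
        exact Ext1.mk_eq_mk.2 ((Extension.map_equiv_map_iff Φ).1 (Ext1.mk_eq_mk.1 h))
      · rintro ⟨G⟩
        obtain ⟨E, hE⟩ := Extension.exists_map_equiv Φ G
        exact ⟨Ext1.mk E, Ext1.mk_eq_mk.2 hE⟩)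
  map_add' := by
    rintro ⟨E⟩ ⟨F⟩
    exact Ext1.mk_eq_mk.2 (Extension.map_baerSum Φ E F)

end ExtensionTransfer

/-! ### Compatibility and coassociativity expressions with the two structure maps as independent
arguments. -/

section MixedCompatibility

open LinearMap

variable {k A V W U V' U' : Type u} [Field k] [Ring A] [Bialgebra k A]
  [AddCommGroup V] [Module k V] [AddCommGroup W] [Module k W] [AddCommGroup U] [Module k U]
  [AddCommGroup V'] [Module k V'] [AddCommGroup U'] [Module k U']

/-- The map `a ⊗ v ↦ ∑ act(a₂ ⊗ v)₀ ⊗ act(a₂ ⊗ v)₁ a₁` for an action `A ⊗ V → W` and a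
coaction `W → U ⊗ A` between different spaces. -/
noncomputable def ydLeftMixed (act : A ⊗[k] V →ₗ[k] W) (coact : W →ₗ[k] U ⊗[k] A) :
    A ⊗[k] V →ₗ[k] U ⊗[k] A :=
  (mul' k A).lTensor U ∘ₗ (TensorProduct.assoc k U A A).toLinearMap ∘ₗ
    coact.rTensor A ∘ₗ (TensorProduct.comm k A W).toLinearMap ∘ₗ act.lTensor A ∘ₗ
    (TensorProduct.assoc k A A V).toLinearMap ∘ₗ (Coalgebra.comul (R := k) (A := A)).rTensor V

/-- The map `a ⊗ w ↦ ∑ act(a₁ ⊗ w₀) ⊗ a₂ w₁` for a coaction `W → V ⊗ A` and an action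
`A ⊗ V → U` between different spaces. -/
noncomputable def ydRightMixed (act : A ⊗[k] V →ₗ[k] U) (coact : W →ₗ[k] V ⊗[k] A) :
    A ⊗[k] W →ₗ[k] U ⊗[k] A :=
  TensorProduct.map act (mul' k A) ∘ₗ
    (TensorProduct.tensorTensorTensorComm k A A V A).toLinearMap ∘ₗ
    TensorProduct.map (Coalgebra.comul (R := k) (A := A)) coact

/-- The map `v ↦ ∑ c'(v₀) ⊗ v₁`. -/
noncomputable def iterCoact (c : V →ₗ[k] W ⊗[k] A) (c' : W →ₗ[k] U ⊗[k] A) :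
    V →ₗ[k] U ⊗[k] (A ⊗[k] A) :=
  (TensorProduct.assoc k U A A).toLinearMap ∘ₗ c'.rTensor A ∘ₗ c

/-- Additivity in each argument, here and in the next lemmas, lets the axioms for a block structure
be expanded block by block. -/
theorem ydLeftMixed_add_left (f g : A ⊗[k] V →ₗ[k] W) (c : W →ₗ[k] U ⊗[k] A) :
    ydLeftMixed (f + g) c = ydLeftMixed f c + ydLeftMixed g c := by
  simp only [ydLeftMixed, lTensor_add, add_comp, comp_add]

theorem ydLeftMixed_add_right (f : A ⊗[k] V →ₗ[k] W) (c d : W →ₗ[k] U ⊗[k] A) :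
    ydLeftMixed f (c + d) = ydLeftMixed f c + ydLeftMixed f d := by
  simp only [ydLeftMixed, rTensor_add, add_comp, comp_add]

theorem ydRightMixed_add_left (f g : A ⊗[k] V →ₗ[k] U) (c : W →ₗ[k] V ⊗[k] A) :
    ydRightMixed (f + g) c = ydRightMixed f c + ydRightMixed g c := by
  simp only [ydRightMixed, TensorProduct.map_add_left, add_comp]

theorem ydRightMixed_add_right (f : A ⊗[k] V →ₗ[k] U) (c d : W →ₗ[k] V ⊗[k] A) :
    ydRightMixed f (c + d) = ydRightMixed f c + ydRightMixed f d := by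
  simp only [ydRightMixed, TensorProduct.map_add_right, comp_add]

theorem iterCoact_add_left (c d : V →ₗ[k] W ⊗[k] A) (c' : W →ₗ[k] U ⊗[k] A) :
    iterCoact (c + d) c' = iterCoact c c' + iterCoact d c' := by
  simp only [iterCoact, comp_add]

theorem iterCoact_add_right (c : V →ₗ[k] W ⊗[k] A) (c' d' : W →ₗ[k] U ⊗[k] A) :
    iterCoact c (c' + d') = iterCoact c c' + iterCoact c d' := by
  simp only [iterCoact, rTensor_add, add_comp, comp_add]

/-- Naturality in each space involved: a linear map can leave through the target, slide across the
middle between action and coaction, or enter through the source. Applied to the projections of N ×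
M, these rules move a projection inward until it meets a structure map. The lemmas that follow do
the same for the other two expressions. -/
theorem rTensor_comp_ydLeftMixed (g : U →ₗ[k] U') (f : A ⊗[k] V →ₗ[k] W)
    (c : W →ₗ[k] U ⊗[k] A) : g.rTensor A ∘ₗ ydLeftMixed f c = ydLeftMixed f (g.rTensor A ∘ₗ c) := by
  have key : g.rTensor A ∘ₗ (mul' k A).lTensor U ∘ₗ (TensorProduct.assoc k U A A).toLinearMap =
      (mul' k A).lTensor U' ∘ₗ (TensorProduct.assoc k U' A A).toLinearMap ∘ₗ
        (g.rTensor A).rTensor A :=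
    TensorProduct.ext_threefold fun x y z => by simp
  have key' := congrArg (fun φ => φ ∘ₗ c.rTensor A ∘ₗ (TensorProduct.comm k A W).toLinearMap ∘ₗ
    f.lTensor A ∘ₗ (TensorProduct.assoc k A A V).toLinearMap ∘ₗ
    (Coalgebra.comul (R := k) (A := A)).rTensor V) key
  simpa only [ydLeftMixed, comp_assoc, rTensor_comp] using key'

theorem ydLeftMixed_comp (h : W →ₗ[k] V') (f : A ⊗[k] V →ₗ[k] W) (c : V' →ₗ[k] U ⊗[k] A) :
    ydLeftMixed f (c ∘ₗ h) = ydLeftMixed (h ∘ₗ f) c := by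
  have key : h.rTensor A ∘ₗ (TensorProduct.comm k A W).toLinearMap =
      (TensorProduct.comm k A V').toLinearMap ∘ₗ h.lTensor A := TensorProduct.ext' fun x y => by simp
  have key' := congrArg (fun φ => (mul' k A).lTensor U ∘ₗ (TensorProduct.assoc k U A A).toLinearMap ∘ₗ
    c.rTensor A ∘ₗ φ ∘ₗ
    f.lTensor A ∘ₗ (TensorProduct.assoc k A A V).toLinearMap ∘ₗ
    (Coalgebra.comul (R := k) (A := A)).rTensor V) key
  simpa only [ydLeftMixed, comp_assoc, rTensor_comp, lTensor_comp] using key'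

theorem ydLeftMixed_comp_lTensor (h : V' →ₗ[k] V) (f : A ⊗[k] V →ₗ[k] W)
    (c : W →ₗ[k] U ⊗[k] A) :
    ydLeftMixed f c ∘ₗ h.lTensor A = ydLeftMixed (f ∘ₗ h.lTensor A) c := by
  have key : (TensorProduct.assoc k A A V).toLinearMap ∘ₗ
      (Coalgebra.comul (R := k) (A := A)).rTensor V ∘ₗ h.lTensor A =
      (h.lTensor A).lTensor A ∘ₗ (TensorProduct.assoc k A A V').toLinearMap ∘ₗ
      (Coalgebra.comul (R := k) (A := A)).rTensor V' := TensorProduct.ext' fun x y => by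
    simp only [LinearMap.comp_apply, LinearEquiv.coe_coe, lTensor_tmul, rTensor_tmul]
    induction (Coalgebra.comul (R := k) x) using TensorProduct.induction_on with
    | zero => simp
    | tmul x y => simp
    | add p q hp hq => simp only [TensorProduct.add_tmul, map_add, hp, hq]
  simp only [ydLeftMixed, comp_assoc, key, lTensor_comp]

theorem rTensor_comp_ydRightMixed (g : U →ₗ[k] U') (f : A ⊗[k] V →ₗ[k] U)
    (c : W →ₗ[k] V ⊗[k] A) : g.rTensor A ∘ₗ ydRightMixed f c = ydRightMixed (g ∘ₗ f) c := by
  simp only [ydRightMixed, rTensor, ← comp_assoc, ← TensorProduct.map_comp, id_comp]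

theorem ydRightMixed_comp (h : V →ₗ[k] V') (f : A ⊗[k] V' →ₗ[k] U) (c : W →ₗ[k] V ⊗[k] A) :
    ydRightMixed (f ∘ₗ h.lTensor A) c = ydRightMixed f (h.rTensor A ∘ₗ c) := by
  have key : ∀ z : (A ⊗[k] A) ⊗[k] (V ⊗[k] A),
      TensorProduct.map (f ∘ₗ h.lTensor A) (mul' k A)
        (TensorProduct.tensorTensorTensorComm k A A V A z) =
      TensorProduct.map f (mul' k A) (TensorProduct.tensorTensorTensorComm k A A V' A
        (TensorProduct.map LinearMap.id (h.rTensor A) z)) := by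
    have : TensorProduct.map (f ∘ₗ h.lTensor A) (mul' k A) ∘ₗ
        (TensorProduct.tensorTensorTensorComm k A A V A).toLinearMap =
        TensorProduct.map f (mul' k A) ∘ₗ
        (TensorProduct.tensorTensorTensorComm k A A V' A).toLinearMap ∘ₗ
        TensorProduct.map LinearMap.id (h.rTensor A) := by
      ext; simp
    exact LinearMap.congr_fun this
  refine TensorProduct.ext' fun x y => ?_
  simp [ydRightMixed, key]

theorem ydRightMixed_comp_lTensor (h : V' →ₗ[k] W) (f : A ⊗[k] V →ₗ[k] U)
    (c : W →ₗ[k] V ⊗[k] A) :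
    ydRightMixed f c ∘ₗ h.lTensor A = ydRightMixed f (c ∘ₗ h) := by
  simp only [ydRightMixed, lTensor, comp_assoc, ← TensorProduct.map_comp, comp_id]

theorem rTensor_comp_iterCoact (g : U →ₗ[k] U') (c : V →ₗ[k] W ⊗[k] A)
    (c' : W →ₗ[k] U ⊗[k] A) :
    g.rTensor (A ⊗[k] A) ∘ₗ iterCoact c c' = iterCoact c (g.rTensor A ∘ₗ c') := by
  have key : g.rTensor (A ⊗[k] A) ∘ₗ (TensorProduct.assoc k U A A).toLinearMap =
      (TensorProduct.assoc k U' A A).toLinearMap ∘ₗ (g.rTensor A).rTensor A :=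
    TensorProduct.ext_threefold fun x y z => by simp
  have key' := congrArg (fun φ => φ ∘ₗ c'.rTensor A ∘ₗ c) key
  simpa only [iterCoact, comp_assoc, rTensor_comp] using key'

theorem iterCoact_comp (h : W →ₗ[k] V') (c : V →ₗ[k] W ⊗[k] A) (c' : V' →ₗ[k] U ⊗[k] A) :
    iterCoact c (c' ∘ₗ h) = iterCoact (h.rTensor A ∘ₗ c) c' := by
  simp only [iterCoact, rTensor_comp, comp_assoc]

theorem iterCoact_comp_right (h : V' →ₗ[k] V) (c : V →ₗ[k] W ⊗[k] A) (c' : W →ₗ[k] U ⊗[k] A) :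
    iterCoact (c ∘ₗ h) c' = iterCoact c c' ∘ₗ h := by
  simp only [iterCoact, comp_assoc]

/-- Tensoring the decomposition of the identity of V × W into its two projectors shows that an
element is recovered from its two components. -/
theorem prod_rTensor_ext {B : Type u} [AddCommGroup B] [Module k B] {x y : (V × W) ⊗[k] B}
    (h1 : (fst k V W).rTensor B x = (fst k V W).rTensor B y)
    (h2 : (snd k V W).rTensor B x = (snd k V W).rTensor B y) : x = y := by
  have key : ∀ z : (V × W) ⊗[k] B,
      z = (inl k V W).rTensor B ((fst k V W).rTensor B z) +
        (inr k V W).rTensor B ((snd k V W).rTensor B z) := fun z => by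
    rw [← rTensor_comp_apply, ← rTensor_comp_apply, ← LinearMap.add_apply, ← rTensor_add]
    have : inl k V W ∘ₗ fst k V W + inr k V W ∘ₗ snd k V W = LinearMap.id := by ext <;> simp
    rw [this, rTensor_id_apply]
  rw [key x, key y, h1, h2]

end MixedCompatibility

/-! ### Twisted structures on N × M and the identities that characterise them. -/

namespace YetterDrinfeld

open LinearMap

variable {k A : Type u} [Field k] [Ring A] [Bialgebra k A] (M N : YetterDrinfeld k A)
  (ω : A ⊗[k] M.carrier →ₗ[k] N.carrier) (ρ : M.carrier →ₗ[k] N.carrier ⊗[k] A)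

/-- The action `a · (n, m) = (a · n + ω(a ⊗ m), a · m)`. -/
noncomputable def twistAct : A ⊗[k] (N.carrier × M.carrier) →ₗ[k] N.carrier × M.carrier :=
  (N.act ∘ₗ (LinearMap.fst k _ _).lTensor A + ω ∘ₗ (LinearMap.snd k _ _).lTensor A).prod
    (M.act ∘ₗ (LinearMap.snd k _ _).lTensor A)

/-- The coaction `(n, m) ↦ ρ_N(n) + ρ(m) + ρ_M(m)`. -/
noncomputable def twistCoact : N.carrier × M.carrier →ₗ[k] (N.carrier × M.carrier) ⊗[k] A :=
  (LinearMap.inl k _ _).rTensor A ∘ₗ (N.coact ∘ₗ LinearMap.fst k _ _ + ρ ∘ₗ LinearMap.snd k _ _) +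
    (LinearMap.inr k _ _).rTensor A ∘ₗ M.coact ∘ₗ LinearMap.snd k _ _

/-- The conditions under which `ω` and `ρ` define a Yetter-Drinfel'd structure on `N × M`. -/
structure IsTwisting : Prop where
  act : ∀ a b m, ω ((a * b) ⊗ₜ m) = N.act (a ⊗ₜ ω (b ⊗ₜ m)) + ω (a ⊗ₜ M.act (b ⊗ₜ m))
  coact : iterCoact ρ N.coact + iterCoact M.coact ρ =
    (Coalgebra.comul (R := k) (A := A)).lTensor N.carrier ∘ₗ ρ
  compat : ydLeftMixed ω N.coact + ydLeftMixed M.act ρ =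
    ydRightMixed N.act ρ + ydRightMixed ω M.coact

variable {M N}

theorem twistAct_apply (a : A) (n : N.carrier) (m : M.carrier) :
    twistAct M N ω (a ⊗ₜ (n, m)) = (N.act (a ⊗ₜ n) + ω (a ⊗ₜ m), M.act (a ⊗ₜ m)) := by
  simp [twistAct]

theorem fst_comp_twistAct : LinearMap.fst k _ _ ∘ₗ twistAct M N ω =
    N.act ∘ₗ (LinearMap.fst k _ _).lTensor A + ω ∘ₗ (LinearMap.snd k _ _).lTensor A := rfl

theorem snd_comp_twistAct : LinearMap.snd k _ _ ∘ₗ twistAct M N ω = M.act ∘ₗ (LinearMap.snd k _ _).lTensor A := rfl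

theorem fst_comp_twistCoact : (LinearMap.fst k _ _).rTensor A ∘ₗ twistCoact M N ρ =
    N.coact ∘ₗ LinearMap.fst k _ _ + ρ ∘ₗ LinearMap.snd k _ _ := by
  simp only [twistCoact, comp_add, ← comp_assoc, ← rTensor_comp, fst_comp_inl, fst_comp_inr,
    rTensor_zero, LinearMap.zero_comp, add_zero, rTensor_id, id_comp]

theorem snd_comp_twistCoact : (LinearMap.snd k _ _).rTensor A ∘ₗ twistCoact M N ρ =
    M.coact ∘ₗ LinearMap.snd k _ _ := by
  simp only [twistCoact, comp_add, ← comp_assoc, ← rTensor_comp, snd_comp_inl, snd_comp_inr,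
    rTensor_zero, LinearMap.zero_comp, zero_add, rTensor_id, id_comp]

/-- Both twisted structure maps are block triangular, so the N-component consists of the expression
for N itself and of cross terms with exactly one of ω, ρ. The cross terms are one side of the third
condition of `IsTwisting`; the other side comes from `ydRight` below. -/
theorem fst_comp_ydLeft_twist :
    (LinearMap.fst k _ _).rTensor A ∘ₗ ydLeft (twistAct M N ω) (twistCoact M N ρ) =
      ydLeft N.act N.coact ∘ₗ (LinearMap.fst k _ _).lTensor A +
        (ydLeftMixed ω N.coact + ydLeftMixed M.act ρ) ∘ₗ (LinearMap.snd k _ _).lTensor A := by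
  change _ ∘ₗ ydLeftMixed _ _ = ydLeftMixed _ _ ∘ₗ _ + _
  rw [rTensor_comp_ydLeftMixed, fst_comp_twistCoact, ydLeftMixed_add_right, ydLeftMixed_comp,
    ydLeftMixed_comp, fst_comp_twistAct, snd_comp_twistAct, ydLeftMixed_add_left,
    ← ydLeftMixed_comp_lTensor, ← ydLeftMixed_comp_lTensor, ← ydLeftMixed_comp_lTensor, add_comp,
    add_assoc]

theorem snd_comp_ydLeft_twist :
    (LinearMap.snd k _ _).rTensor A ∘ₗ ydLeft (twistAct M N ω) (twistCoact M N ρ) =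
      ydLeft M.act M.coact ∘ₗ (LinearMap.snd k _ _).lTensor A := by
  change _ ∘ₗ ydLeftMixed _ _ = ydLeftMixed _ _ ∘ₗ _
  rw [rTensor_comp_ydLeftMixed, snd_comp_twistCoact, ydLeftMixed_comp, snd_comp_twistAct,
    ← ydLeftMixed_comp_lTensor]

theorem fst_comp_ydRight_twist :
    (LinearMap.fst k _ _).rTensor A ∘ₗ ydRight (twistAct M N ω) (twistCoact M N ρ) =
      ydRight N.act N.coact ∘ₗ (LinearMap.fst k _ _).lTensor A +
        (ydRightMixed N.act ρ + ydRightMixed ω M.coact) ∘ₗ (LinearMap.snd k _ _).lTensor A := by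
  change _ ∘ₗ ydRightMixed _ _ = ydRightMixed _ _ ∘ₗ _ + _
  rw [rTensor_comp_ydRightMixed, fst_comp_twistAct, ydRightMixed_add_left, ydRightMixed_comp,
    ydRightMixed_comp, fst_comp_twistCoact, snd_comp_twistCoact, ydRightMixed_add_right,
    ← ydRightMixed_comp_lTensor, ← ydRightMixed_comp_lTensor, ← ydRightMixed_comp_lTensor,
    add_comp, add_assoc]

theorem snd_comp_ydRight_twist :
    (LinearMap.snd k _ _).rTensor A ∘ₗ ydRight (twistAct M N ω) (twistCoact M N ρ) =
      ydRight M.act M.coact ∘ₗ (LinearMap.snd k _ _).lTensor A := by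
  change _ ∘ₗ ydRightMixed _ _ = ydRightMixed _ _ ∘ₗ _
  rw [rTensor_comp_ydRightMixed, snd_comp_twistAct, ydRightMixed_comp, snd_comp_twistCoact,
    ← ydRightMixed_comp_lTensor]

/-- The same triangularity for coassociativity: ρ enters once, either before the coaction of N or
after that of M. -/
theorem fst_comp_iterCoact_twist :
    (LinearMap.fst k _ _).rTensor (A ⊗[k] A) ∘ₗ iterCoact (twistCoact M N ρ) (twistCoact M N ρ) =
      iterCoact N.coact N.coact ∘ₗ LinearMap.fst k _ _ +
        (iterCoact ρ N.coact + iterCoact M.coact ρ) ∘ₗ LinearMap.snd k _ _ := by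
  rw [rTensor_comp_iterCoact, fst_comp_twistCoact, iterCoact_add_right, iterCoact_comp,
    iterCoact_comp, fst_comp_twistCoact, snd_comp_twistCoact, iterCoact_add_left,
    iterCoact_comp_right, iterCoact_comp_right, iterCoact_comp_right, add_comp, add_assoc]

theorem snd_comp_iterCoact_twist :
    (LinearMap.snd k _ _).rTensor (A ⊗[k] A) ∘ₗ iterCoact (twistCoact M N ρ) (twistCoact M N ρ) =
      iterCoact M.coact M.coact ∘ₗ LinearMap.snd k _ _ := by
  rw [rTensor_comp_iterCoact, snd_comp_twistCoact, iterCoact_comp, snd_comp_twistCoact,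
    iterCoact_comp_right]

theorem iterCoact_coact (M : YetterDrinfeld k A) : iterCoact M.coact M.coact =
    (Coalgebra.comul (R := k) (A := A)).lTensor M.carrier ∘ₗ M.coact :=
  LinearMap.ext M.isYetterDrinfeld.coassoc

theorem ydLeft_eq_ydRight (M : YetterDrinfeld k A) :
    ydLeft M.act M.coact = ydRight M.act M.coact :=
  TensorProduct.ext' M.isYetterDrinfeld.compat

/-- Contraction of the algebra factor with the counit: `n ⊗ a ↦ ε(a) n`. -/
noncomputable def contract (k A V : Type u) [Field k] [Ring A] [Bialgebra k A] [AddCommGroup V]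
    [Module k V] : V ⊗[k] A →ₗ[k] V :=
  (TensorProduct.rid k V).toLinearMap ∘ₗ (Coalgebra.counit (R := k) (A := A)).lTensor V

/-- Contraction of the first of two algebra factors: `n ⊗ (a ⊗ b) ↦ n ⊗ ε(a) b`. -/
noncomputable def contractFirst (k A V : Type u) [Field k] [Ring A] [Bialgebra k A]
    [AddCommGroup V] [Module k V] : V ⊗[k] (A ⊗[k] A) →ₗ[k] V ⊗[k] A :=
  ((TensorProduct.lid k A).toLinearMap ∘ₗ
    (Coalgebra.counit (R := k) (A := A)).rTensor A).lTensor V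

theorem contract_rTensor {V W : Type u} [AddCommGroup V] [Module k V] [AddCommGroup W] [Module k W]
    (g : V →ₗ[k] W) : contract k A W ∘ₗ g.rTensor A = g ∘ₗ contract k A V :=
  TensorProduct.ext' fun x y => by simp [contract]

theorem contractFirst_comul {V : Type u} [AddCommGroup V] [Module k V] :
    contractFirst k A V ∘ₗ (Coalgebra.comul (R := k) (A := A)).lTensor V = LinearMap.id := by
  refine TensorProduct.ext' fun x y => ?_
  simp [contractFirst]

theorem contractFirst_assoc {V W : Type u} [AddCommGroup V] [Module k V] [AddCommGroup W]
    [Module k W] (c : V →ₗ[k] W ⊗[k] A) :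
    contractFirst k A W ∘ₗ (TensorProduct.assoc k W A A).toLinearMap ∘ₗ c.rTensor A =
      (contract k A W ∘ₗ c).rTensor A := by
  have key : contractFirst k A W ∘ₗ (TensorProduct.assoc k W A A).toLinearMap =
      (contract k A W).rTensor A :=
    TensorProduct.ext_threefold fun x y z => by
      simp [contractFirst, contract, TensorProduct.smul_tmul]
  rw [rTensor_comp, ← key, comp_assoc]

theorem contract_comp_coact (M : YetterDrinfeld k A) :
    contract k A M.carrier ∘ₗ M.coact = LinearMap.id := LinearMap.ext M.isYetterDrinfeld.counit

/-- Apply ε to both algebra factors of the hypothesis. With x the contraction of ρ, each of the two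
summands on the left becomes x, by the counit axioms of N and M, and the right side becomes x as
well. Hence x + x = x. This is why `IsTwisting` needs no counit condition. -/
theorem counit_eq_zero_of_twist (h : iterCoact ρ N.coact + iterCoact M.coact ρ =
    (Coalgebra.comul (R := k) (A := A)).lTensor N.carrier ∘ₗ ρ) (m : M.carrier) :
    contract k A N.carrier (ρ m) = 0 := by
  have h1 := congrArg (fun φ => contract k A N.carrier ∘ₗ contractFirst k A N.carrier ∘ₗ φ) h
  simp only [iterCoact, comp_add] at h1
  have e (V W : Type u) [AddCommGroup V] [Module k V] [AddCommGroup W] [Module k W]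
      (c : V →ₗ[k] W ⊗[k] A) (y : M.carrier →ₗ[k] V ⊗[k] A) :
      contractFirst k A W ∘ₗ (TensorProduct.assoc k W A A).toLinearMap ∘ₗ c.rTensor A ∘ₗ y =
      (contract k A W ∘ₗ c).rTensor A ∘ₗ y := by
    rw [← contractFirst_assoc]; rfl
  have e' (c : M.carrier →ₗ[k] N.carrier) : contract k A N.carrier ∘ₗ c.rTensor A ∘ₗ M.coact = c := by
    rw [← comp_assoc, contract_rTensor, comp_assoc, contract_comp_coact, comp_id]
  have e'' : contractFirst k A N.carrier ∘ₗ
      (Coalgebra.comul (R := k) (A := A)).lTensor N.carrier ∘ₗ ρ = ρ := by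
    rw [← comp_assoc, contractFirst_comul, id_comp]
  rw [e, e, e', e'', contract_comp_coact, rTensor_id, id_comp] at h1
  exact LinearMap.congr_fun (add_eq_left.1 h1) m

/-- Each axiom can be tested on the two components. The M-component is the axiom for M, and the
N-component is the axiom for N plus the matching identity of `IsTwisting`. -/
theorem isTwisting_iff : IsTwisting M N ω ρ ↔
    IsYetterDrinfeld (twistAct M N ω) (twistCoact M N ρ) := by
  have hf : ∀ z, (LinearMap.fst k _ _).rTensor A (twistCoact M N ρ z) = N.coact z.1 + ρ z.2 :=
    LinearMap.congr_fun (fst_comp_twistCoact ρ)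
  have hs : ∀ z, (LinearMap.snd k _ _).rTensor A (twistCoact M N ρ z) = M.coact z.2 :=
    LinearMap.congr_fun (snd_comp_twistCoact ρ)
  constructor
  · intro h
    -- Taking a = b = 1 gives ω(1 ⊗ m) = ω(1 ⊗ m) + ω(1 ⊗ m), so the unit axiom costs nothing.
    have hω1 : ∀ m, ω (1 ⊗ₜ m) = 0 := fun m => by
      have := h.act 1 1 m
      rw [one_mul, N.isYetterDrinfeld.one_act, M.isYetterDrinfeld.one_act] at this
      simpa using this
    have hρ1 : ∀ m, TensorProduct.rid k N.carrier
        ((Coalgebra.counit (R := k) (A := A)).lTensor N.carrier (ρ m)) = 0 := fun m => by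
      exact counit_eq_zero_of_twist ρ h.coact m
    refine ⟨?_, ?_, ?_, ?_, ?_⟩
    · rintro ⟨n, m⟩
      rw [twistAct_apply, hω1, N.isYetterDrinfeld.one_act, M.isYetterDrinfeld.one_act, add_zero]
    · rintro a b ⟨n, m⟩
      simp only [twistAct_apply, N.isYetterDrinfeld.mul_act, M.isYetterDrinfeld.mul_act, h.act,
        TensorProduct.tmul_add, map_add, add_assoc]
    · intro z
      apply prod_rTensor_ext
      · refine (LinearMap.congr_fun (fst_comp_iterCoact_twist ρ) z).trans ?_
        rw [h.coact, iterCoact_coact, yd_comul_natural, hf]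
        simp
      · refine (LinearMap.congr_fun (snd_comp_iterCoact_twist ρ) z).trans ?_
        rw [iterCoact_coact, yd_comul_natural, hs]
        simp
    · intro z
      refine Prod.ext ?_ ?_
      · change LinearMap.fst k _ _ _ = _
        rw [yd_counit_natural, hf, map_add, map_add, hρ1, add_zero, N.isYetterDrinfeld.counit]
      · change LinearMap.snd k _ _ _ = _
        rw [yd_counit_natural, hs, M.isYetterDrinfeld.counit]
    · intro a z
      apply prod_rTensor_ext
      · refine (LinearMap.congr_fun (fst_comp_ydLeft_twist ω ρ) _).trans
          (Eq.trans ?_ (LinearMap.congr_fun (fst_comp_ydRight_twist ω ρ) _).symm)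
        rw [h.compat, ydLeft_eq_ydRight]
      · refine (LinearMap.congr_fun (snd_comp_ydLeft_twist ω ρ) _).trans
          (Eq.trans ?_ (LinearMap.congr_fun (snd_comp_ydRight_twist ω ρ) _).symm)
        rw [ydLeft_eq_ydRight]
  · intro h
    -- On vectors (0, m) the contribution of N alone vanishes and only the cross terms of the
    -- N-component remain.
    refine ⟨fun a b m => ?_, ?_, ?_⟩
    · simpa [twistAct_apply] using congrArg Prod.fst (h.mul_act a b (0, m))
    · have h1 : iterCoact (twistCoact M N ρ) (twistCoact M N ρ) =
        (Coalgebra.comul (R := k) (A := A)).lTensor _ ∘ₗ twistCoact M N ρ := LinearMap.ext h.coassoc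
      have h2 := congrArg (fun φ => (LinearMap.fst k _ _).rTensor (A ⊗[k] A) ∘ₗ φ) h1
      simp only [fst_comp_iterCoact_twist] at h2
      ext m
      have h3 := LinearMap.congr_fun h2 (0, m)
      simp only [LinearMap.comp_apply, yd_comul_natural, hf, LinearMap.add_apply] at h3
      simpa using h3
    · have h1 : ydLeft (twistAct M N ω) (twistCoact M N ρ) =
        ydRight (twistAct M N ω) (twistCoact M N ρ) := TensorProduct.ext' h.compat
      have h2 := congrArg (fun φ => (LinearMap.fst k _ _).rTensor A ∘ₗ φ) h1
      simp only [fst_comp_ydLeft_twist, fst_comp_ydRight_twist] at h2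
      refine TensorProduct.ext' fun a m => ?_
      have h3 := LinearMap.congr_fun h2 (a ⊗ₜ (0, m))
      simpa using h3

end YetterDrinfeld

/-! ### Every extension is a twisted sum; equivalences and Baer sums of twisted sums. -/

namespace YetterDrinfeld

open LinearMap

variable {k A : Type u} [Field k] [Ring A] [Bialgebra k A] {M N : YetterDrinfeld k A}

/-- Exactness of the underlying linear maps makes the comparison from N to the kernel of p
bijective, and bijective morphisms are isomorphisms; mono and epi are tested on elements. -/
theorem shortExact_of_exact {X : YetterDrinfeld k A} (i : N ⟶ X) (p : X ⟶ M) (w : i ≫ p = 0)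
    (hi : Function.Injective (lin i)) (hp : Function.Surjective (lin p))
    (h : ∀ x, lin p x = 0 → ∃ n, lin i n = x) : (ShortComplex.mk i p w).ShortExact := by
  have hb : Function.Bijective (lin (kerLift p i w)) := by
    refine ⟨fun x y e => hi (congrArg Subtype.val e), fun y => ?_⟩
    obtain ⟨x, hx⟩ := h y.1 y.2
    exact ⟨x, Subtype.ext hx⟩
  have := isIso_of_bijective _ hb
  refine ShortComplex.ShortExact.mk' (ShortComplex.exact_of_f_is_kernel _
    ((kerIsLimit p).ofIsoLimit (Iso.symm (Fork.ext (asIso (kerLift p i w)) rfl)))) ?_ ?_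
  · exact ⟨fun g g' e => hom_ext (LinearMap.ext fun x => hi (congrArg (fun φ => lin φ x) e))⟩
  · refine ⟨fun g g' e => hom_ext (LinearMap.ext fun x => ?_)⟩
    obtain ⟨x, rfl⟩ := hp x
    exact congrArg (fun φ => lin φ x) e

/-- The inclusion of the kernel of p factors through i by categorical exactness; evaluating the
factorisation at x gives the preimage. -/
theorem exact_of_extension (E : Extension M N) (x : E.X.carrier) (hx : lin E.p x = 0) :
    ∃ n, lin E.i n = x := by
  have : Mono E.i := E.shortExact.mono_f
  have h := congrArg (fun φ => lin φ (⟨x, hx⟩ : LinearMap.ker (lin E.p)))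
    (E.shortExact.exact.lift_f (kerι E.p) (kerι_comp E.p))
  exact ⟨_, h⟩

theorem p_i (E : Extension M N) (n : N.carrier) : lin E.p (lin E.i n) = 0 :=
  congrArg (fun φ => lin φ n) E.w

variable {ω ω' : A ⊗[k] M.carrier →ₗ[k] N.carrier} {ρ ρ' : M.carrier →ₗ[k] N.carrier ⊗[k] A}

theorem twistCoact_apply (z : N.carrier × M.carrier) : twistCoact M N ρ z =
    (LinearMap.inl k _ _).rTensor A (N.coact z.1 + ρ z.2) +
      (LinearMap.inr k _ _).rTensor A (M.coact z.2) := rfl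

theorem IsTwisting.add (h : IsTwisting M N ω ρ) (h' : IsTwisting M N ω' ρ') :
    IsTwisting M N (ω + ω') (ρ + ρ') where
  act a b m := by
    simp only [LinearMap.add_apply, h.act, h'.act, TensorProduct.tmul_add, map_add]
    abel
  coact := by
    rw [iterCoact_add_left, iterCoact_add_right, comp_add, ← h.coact, ← h'.coact]
    abel
  compat := by
    have e := congrArg₂ (· + ·) h.compat h'.compat
    rw [ydLeftMixed_add_left, ydLeftMixed_add_right, ydRightMixed_add_left, ydRightMixed_add_right,
      add_add_add_comm, e, add_add_add_comm]

/-- The extension `0 → N → N ⊕ M → M → 0` with the twisted structure on the middle term. -/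
noncomputable def twist (h : IsTwisting M N ω ρ) : Extension M N :=
  let X : YetterDrinfeld k A := ⟨N.carrier × M.carrier, twistAct M N ω, twistCoact M N ρ,
    (isTwisting_iff ω ρ).1 h⟩
  let i : N ⟶ X := Hom.mk (N := X) (LinearMap.inl k _ _)
    (fun a n => by simp [X, twistAct_apply]) (fun n => by simp [X, twistCoact_apply])
  let p : X ⟶ M := Hom.mk (M := X) (LinearMap.snd k _ _)
    (fun a z => congrArg Prod.snd (twistAct_apply ω a z.1 z.2))
    (LinearMap.congr_fun (snd_comp_twistCoact ρ))
  have w : i ≫ p = 0 := hom_ext (LinearMap.snd_comp_inl k _ _)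
  ⟨X, i, p, w, shortExact_of_exact i p w LinearMap.inl_injective LinearMap.snd_surjective
    fun z hz => ⟨z.1, Prod.ext rfl (Eq.symm hz)⟩⟩

theorem isTwisted_twist (h : IsTwisting M N ω ρ) : IsTwisted (twist h) ω ρ :=
  ⟨LinearEquiv.refl k _, fun _ => rfl, fun _ _ => rfl, fun a n m => twistAct_apply ω a n m,
    fun _ _ => rfl⟩

/-- The shear (n, m) ↦ (n + f(m), m) carries one twisted structure to the other precisely because of
the two hypotheses on f. -/
theorem twist_equiv_of (h : IsTwisting M N ω ρ) (h' : IsTwisting M N ω' ρ')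
    (f : M.carrier →ₗ[k] N.carrier)
    (hω : ∀ a m, ω (a ⊗ₜ m) - ω' (a ⊗ₜ m) = N.act (a ⊗ₜ f m) - f (M.act (a ⊗ₜ m)))
    (hρ : ∀ m, ρ m - ρ' m = N.coact (f m) - f.rTensor A (M.coact m)) : twist h ≈ twist h' := by
  let g : N.carrier × M.carrier →ₗ[k] N.carrier × M.carrier :=
    (LinearMap.fst k _ _ + f ∘ₗ LinearMap.snd k _ _).prod (LinearMap.snd k _ _)
  have h1 : LinearMap.fst k _ _ ∘ₗ g = LinearMap.fst k _ _ + f ∘ₗ LinearMap.snd k _ _ := rfl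
  have h2 : LinearMap.snd k _ _ ∘ₗ g = LinearMap.snd k _ _ := rfl
  have hf : ∀ z, (LinearMap.fst k _ _).rTensor A (twistCoact M N ρ z) = N.coact z.1 + ρ z.2 :=
    LinearMap.congr_fun (fst_comp_twistCoact ρ)
  have hs : ∀ z, (LinearMap.snd k _ _).rTensor A (twistCoact M N ρ z) = M.coact z.2 :=
    LinearMap.congr_fun (snd_comp_twistCoact ρ)
  let φ : (twist h).X ⟶ (twist h').X := Hom.mk (M := (twist h).X) (N := (twist h').X) g
    (fun a z => by
      refine (congrArg g (twistAct_apply ω a z.1 z.2)).trans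
        (Eq.trans ?_ (twistAct_apply ω' a (z.1 + f z.2) z.2).symm)
      refine Prod.ext ?_ rfl
      change N.act (a ⊗ₜ z.1) + ω (a ⊗ₜ z.2) + f (M.act (a ⊗ₜ z.2)) =
        N.act (a ⊗ₜ (z.1 + f z.2)) + ω' (a ⊗ₜ z.2)
      rw [TensorProduct.tmul_add, map_add, eq_add_of_sub_eq (hω a z.2)]
      abel)
    (fun (z : N.carrier × M.carrier) => by
      change g.rTensor A (twistCoact M N ρ z) = twistCoact M N ρ' (z.1 + f z.2, z.2)
      apply prod_rTensor_ext
      · rw [← rTensor_comp_apply, h1, rTensor_add, LinearMap.add_apply, rTensor_comp_apply, hf, hs]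
        refine Eq.trans ?_ (LinearMap.congr_fun (fst_comp_twistCoact ρ') _).symm
        simp only [LinearMap.add_apply, LinearMap.comp_apply, fst_apply, snd_apply, map_add]
        rw [eq_add_of_sub_eq (hρ z.2)]
        abel
      · rw [← rTensor_comp_apply, h2, hs]
        exact (LinearMap.congr_fun (snd_comp_twistCoact ρ') (z.1 + f z.2, z.2)).symm)
  refine Extension.equiv_of_hom φ (hom_ext (LinearMap.ext fun n => ?_)) (hom_ext rfl)
  change g (n, 0) = (n, 0)
  simp [g]

/-- An equivalence fixes N and induces the identity on the quotient M, so it has to be a shear.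
Comparing N-components at (0, m) then yields the two formulas. -/
theorem exists_of_twist_equiv (h : IsTwisting M N ω ρ) (h' : IsTwisting M N ω' ρ')
    (e : twist h ≈ twist h') : ∃ f : M.carrier →ₗ[k] N.carrier,
      (∀ a m, ω (a ⊗ₜ m) - ω' (a ⊗ₜ m) = N.act (a ⊗ₜ f m) - f (M.act (a ⊗ₜ m))) ∧
      ∀ m, ρ m - ρ' m = N.coact (f m) - f.rTensor A (M.coact m) := by
  obtain ⟨e, hi, hp⟩ := e
  let g : N.carrier × M.carrier →ₗ[k] N.carrier × M.carrier := lin e.hom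
  have g1 : ∀ n, g (n, 0) = (n, 0) := fun n => congrArg (fun φ => lin φ n) hi
  have g2 : ∀ z, (g z).2 = z.2 := fun z =>
    congrArg (fun φ : (twist h).X ⟶ M => lin φ z) hp
  -- The shearing map is the N-component of the image of (0, m).
  let f := LinearMap.fst k _ _ ∘ₗ g ∘ₗ LinearMap.inr k _ _
  have g3 : ∀ n m, g (n, m) = (n + f m, m) := fun n m => by
    have : ((n, m) : N.carrier × M.carrier) = (n, 0) + (0, m) := by simp
    refine Prod.ext ?_ (g2 _)
    rw [this, map_add, g1]
    rfl
  have h1 : LinearMap.fst k _ _ ∘ₗ g = LinearMap.fst k _ _ + f ∘ₗ LinearMap.snd k _ _ :=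
    LinearMap.ext fun z => congrArg Prod.fst (g3 z.1 z.2)
  refine ⟨f, fun a m => ?_, fun m => ?_⟩
  · have h3 := congrArg Prod.fst (lin_act e.hom a ((0, m) : N.carrier × M.carrier))
    change (g (twistAct M N ω (a ⊗ₜ (0, m)))).1 = (twistAct M N ω' (a ⊗ₜ g (0, m))).1 at h3
    rw [twistAct_apply, g3, g3, twistAct_apply] at h3
    simp only [TensorProduct.tmul_zero, map_zero, zero_add] at h3
    rw [sub_eq_sub_iff_add_eq_add, h3]
  · have h3 := congrArg ((LinearMap.fst k N.carrier M.carrier).rTensor A)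
      (lin_coact e.hom ((0, m) : N.carrier × M.carrier))
    change (LinearMap.fst k N.carrier M.carrier).rTensor A
      (g.rTensor A (twistCoact M N ρ (0, m))) =
      (LinearMap.fst k N.carrier M.carrier).rTensor A (twistCoact M N ρ' (g (0, m))) at h3
    rw [← rTensor_comp_apply, h1, rTensor_add, LinearMap.add_apply, rTensor_comp_apply] at h3
    have hf := fun ρ => LinearMap.congr_fun (fst_comp_twistCoact (M := M) (N := N) ρ)
    have hs := fun ρ => LinearMap.congr_fun (snd_comp_twistCoact (M := M) (N := N) ρ)
    simp only [LinearMap.comp_apply] at hf hs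
    rw [hf, hs, g3, hf] at h3
    simp only [LinearMap.add_apply, LinearMap.comp_apply, fst_apply, snd_apply, map_zero,
      zero_add] at h3
    rw [sub_eq_sub_iff_add_eq_add, h3]

/-- A linear section of p identifies X with N × M. The cocycle measures the failure of that section
to be linear over A and colinear. -/
theorem exists_twist_equiv (E : Extension M N) :
    ∃ (ω : A ⊗[k] M.carrier →ₗ[k] N.carrier) (ρ : M.carrier →ₗ[k] N.carrier ⊗[k] A)
      (h : IsTwisting M N ω ρ), twist h ≈ E := by
  have : Mono E.i := E.shortExact.mono_f
  have : Epi E.p := E.shortExact.epi_g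
  have hi := injective_of_mono E.i
  -- Here the ground field is used: the section exists only as a linear map.
  obtain ⟨s, hs⟩ := (lin E.p).exists_rightInverse_of_surjective
    (LinearMap.range_eq_top.2 (surjective_of_epi E.p))
  have hs' : ∀ m, lin E.p (s m) = m := LinearMap.congr_fun hs
  let g : N.carrier × M.carrier →ₗ[k] E.X.carrier := (lin E.i).coprod s
  have gp : lin E.p ∘ₗ g = LinearMap.snd k _ _ := by
    ext z
    · simp [g, p_i]
    · simp [g, hs']
  have gb : Function.Bijective g := by
    constructor
    · rw [← LinearMap.ker_eq_bot, Submodule.eq_bot_iff]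
      rintro ⟨n, m⟩ hz
      have hz' : lin E.i n + s m = 0 := by simpa [g] using hz
      have hm : m = 0 := by
        have := congrArg (lin E.p) hz'
        rwa [map_add, p_i, hs', zero_add, map_zero] at this
      subst hm
      rw [map_zero, add_zero, ← map_zero (lin E.i)] at hz'
      rw [hi hz']
      rfl
    · intro x
      obtain ⟨n, hn⟩ := exact_of_extension E (x - s (lin E.p x)) (by rw [map_sub, hs', sub_self])
      exact ⟨(n, lin E.p x), by simp [g, hn]⟩
  let e := LinearEquiv.ofBijective g gb
  have eg : ∀ x, g (e.symm x) = x := e.apply_symm_apply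
  have ge : ∀ x, e.symm (g x) = x := e.symm_apply_apply
  have esnd : LinearMap.snd k _ _ ∘ₗ e.symm.toLinearMap = lin E.p := by
    rw [← gp]
    ext x
    exact congrArg (lin E.p) (eg x)
  -- The retraction onto N complementary to s; ω and ρ below are the N-components of the structure
  -- maps on the image of s.
  let r : E.X.carrier →ₗ[k] N.carrier := LinearMap.fst k _ _ ∘ₗ e.symm.toLinearMap
  have ri : ∀ n, r (lin E.i n) = n := fun n => by
    have : g (n, 0) = lin E.i n := by simp [g]
    rw [← this]
    exact congrArg Prod.fst (ge _)
  let ω : A ⊗[k] M.carrier →ₗ[k] N.carrier := r ∘ₗ E.X.act ∘ₗ s.lTensor A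
  let ρ : M.carrier →ₗ[k] N.carrier ⊗[k] A := r.rTensor A ∘ₗ E.X.coact ∘ₗ s
  have hact : ∀ a z, g (twistAct M N ω (a ⊗ₜ z)) = E.X.act (a ⊗ₜ g z) := by
    rintro a ⟨n, m⟩
    refine e.symm.injective ((ge _).trans (Prod.ext ?_ ?_))
    · rw [twistAct_apply]
      change _ = r (E.X.act (a ⊗ₜ (lin E.i n + s m)))
      rw [TensorProduct.tmul_add, map_add, map_add, ← lin_act, ri]
      rfl
    · rw [twistAct_apply]
      refine Eq.trans ?_ (LinearMap.congr_fun esnd _).symm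
      rw [lin_act]
      exact congrArg (fun y => M.act (a ⊗ₜ y)) (LinearMap.congr_fun gp (n, m)).symm
  have hcoact : ∀ z, g.rTensor A (twistCoact M N ρ z) = E.X.coact (g z) := by
    rintro ⟨n, m⟩
    -- After transport to N × M by the inverse of g the equality can be checked on the two
    -- components.
    have h1 : e.symm.toLinearMap.rTensor A (g.rTensor A (twistCoact M N ρ (n, m))) =
        e.symm.toLinearMap.rTensor A (E.X.coact (g (n, m))) := by
      rw [← rTensor_comp_apply, show e.symm.toLinearMap ∘ₗ g = LinearMap.id from LinearMap.ext ge,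
        rTensor_id_apply]
      apply prod_rTensor_ext
      · refine (LinearMap.congr_fun (fst_comp_twistCoact ρ) (n, m)).trans ?_
        rw [← rTensor_comp_apply]
        change _ = r.rTensor A (E.X.coact (lin E.i n + s m))
        rw [map_add, map_add, ← lin_coact, ← rTensor_comp_apply,
          show r ∘ₗ lin E.i = LinearMap.id from LinearMap.ext ri, rTensor_id_apply]
        rfl
      · refine (LinearMap.congr_fun (snd_comp_twistCoact ρ) (n, m)).trans ?_
        rw [← rTensor_comp_apply, esnd, lin_coact]
        exact congrArg M.coact (LinearMap.congr_fun gp (n, m)).symm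
    exact (Module.Flat.rTensor_preserves_injective_linearMap _ e.symm.injective) h1
  -- No cocycle identity is computed: the twisted structure is the structure of X pulled back along
  -- the injection g, and the converse half of `isTwisting_iff` extracts the identities.
  have h : IsTwisting M N ω ρ := (isTwisting_iff ω ρ).2
    (E.X.isYetterDrinfeld.of_injective hact hcoact gb.1)
  refine ⟨ω, ρ, h, Extension.equiv_of_hom (Hom.mk (M := (twist h).X) g hact hcoact)
    (hom_ext (LinearMap.ext fun n => ?_)) (hom_ext gp)⟩
  change g (n, 0) = _
  simp [g]

/-- Two points of the fibre product share their M-component, so adding their N-components gives a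
map to N × M. It intertwines the pair of structures with the one twisted by the sums, and restricts
to the inclusion of N on each copy. -/
theorem baerSum_twist (h : IsTwisting M N ω ρ) (h' : IsTwisting M N ω' ρ') :
    Extension.baerSum (twist h) (twist h') ≈ twist (h.add h') := by
  let P := pullback (twist h).p (twist h').p
  let u : P.carrier →ₗ[k] N.carrier × M.carrier := lin (pullback.fst (twist h).p (twist h').p)
  let v : P.carrier →ₗ[k] N.carrier × M.carrier := lin (pullback.snd (twist h).p (twist h').p)
  have huv : ∀ x, (v x).2 = (u x).2 := fun x =>
    (congrArg (fun φ => lin φ x) (pullback.condition (f := (twist h).p) (g := (twist h').p))).symm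
  let g : P.carrier →ₗ[k] N.carrier × M.carrier :=
    (LinearMap.fst k _ _ ∘ₗ u + LinearMap.fst k _ _ ∘ₗ v).prod (LinearMap.snd k _ _ ∘ₗ u)
  have hu : ∀ a x, u (P.act (a ⊗ₜ x)) = twistAct M N ω (a ⊗ₜ u x) := lin_act _
  have hv : ∀ a x, v (P.act (a ⊗ₜ x)) = twistAct M N ω' (a ⊗ₜ v x) := lin_act _
  have hu' : ∀ x, u.rTensor A (P.coact x) = twistCoact M N ρ (u x) := lin_coact _
  have hv' : ∀ x, v.rTensor A (P.coact x) = twistCoact M N ρ' (v x) := lin_coact _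
  have hf := fun ρ => LinearMap.congr_fun (fst_comp_twistCoact (M := M) (N := N) ρ)
  have hs := fun ρ => LinearMap.congr_fun (snd_comp_twistCoact (M := M) (N := N) ρ)
  simp only [LinearMap.comp_apply] at hf hs
  let φ : P ⟶ (twist (h.add h')).X := Hom.mk (N := (twist (h.add h')).X) g
    (fun a x => by
      change ((u (P.act (a ⊗ₜ x))).1 + (v (P.act (a ⊗ₜ x))).1, (u (P.act (a ⊗ₜ x))).2) =
        twistAct M N (ω + ω') (a ⊗ₜ ((u x).1 + (v x).1, (u x).2))
      rw [hu, hv, ← Prod.mk.eta (p := u x), ← Prod.mk.eta (p := v x), twistAct_apply,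
        twistAct_apply, twistAct_apply, huv]
      simp only [LinearMap.add_apply, TensorProduct.tmul_add, map_add]
      rw [add_add_add_comm])
    (fun x => by
      change g.rTensor A (P.coact x) =
        twistCoact M N (ρ + ρ') ((u x).1 + (v x).1, (u x).2)
      apply prod_rTensor_ext
      · rw [← rTensor_comp_apply, show LinearMap.fst k _ _ ∘ₗ g =
          LinearMap.fst k _ _ ∘ₗ u + LinearMap.fst k _ _ ∘ₗ v from rfl, rTensor_add,
          LinearMap.add_apply, rTensor_comp_apply, rTensor_comp_apply, hu', hv', hf, hf, hf]
        simp only [LinearMap.add_apply, LinearMap.comp_apply, fst_apply, snd_apply, map_add, huv]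
        rw [add_add_add_comm]
      · rw [← rTensor_comp_apply, show LinearMap.snd k _ _ ∘ₗ g = LinearMap.snd k _ _ ∘ₗ u from rfl,
          rTensor_comp_apply, hu', hs, hs]
        rfl)
  -- The categorical pullback is accessible only through its two projections, so the values of a
  -- lift are read off from them.
  have key : ∀ {T : YetterDrinfeld k A} (a : T ⟶ (twist h).X) (b : T ⟶ (twist h').X)
      (w : a ≫ (twist h).p = b ≫ (twist h').p) (t : T.carrier),
      u (lin (pullback.lift a b w) t) = lin a t ∧ v (lin (pullback.lift a b w) t) = lin b t :=
    fun a b w t => ⟨congrArg (fun φ => lin φ t) (pullback.lift_fst a b w),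
      congrArg (fun φ => lin φ t) (pullback.lift_snd a b w)⟩
  refine Extension.baerSum_equiv φ (hom_ext (LinearMap.ext fun n => ?_))
    (hom_ext (LinearMap.ext fun n => ?_)) (hom_ext rfl)
  · obtain ⟨h1, h2⟩ := key (twist h).i 0 (by simp [(twist h).w]) n
    refine Prod.ext ?_ ?_
    · exact (congrArg₂ (fun a b : N.carrier × M.carrier => a.1 + b.1) h1 h2).trans (add_zero n)
    · have h3 := congrArg Prod.snd h1
      exact h3
  · obtain ⟨h1, h2⟩ := key 0 (twist h').i (by simp [(twist h').w]) n
    refine Prod.ext ?_ ?_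
    · exact (congrArg₂ (fun a b : N.carrier × M.carrier => a.1 + b.1) h1 h2).trans (zero_add n)
    · have h3 := congrArg Prod.snd h1
      exact h3

end YetterDrinfeld

/-! ### The total complex in degrees 0, 1, 2, and the isomorphism of H¹ with Ext¹. -/

namespace YetterDrinfeld

open LinearMap

variable {k A : Type u} [Field k] [Ring A] [Bialgebra k A] {M N : YetterDrinfeld k A}

/-- For p = 0 the last face of `dm` still splits the last algebra element and discards its first leg
through ε; the counit axiom undoes the splitting. -/
theorem contract_act (M : YetterDrinfeld k A) (a : A) (m : M.carrier) :
    contract k A M.carrier (TensorProduct.comm k A M.carrier (M.act.lTensor A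
      (TensorProduct.assoc k A A M.carrier (Coalgebra.comul a ⊗ₜ m)))) = M.act (a ⊗ₜ m) := by
  have key : ∀ t : A ⊗[k] A, contract k A M.carrier (TensorProduct.comm k A M.carrier
      (M.act.lTensor A (TensorProduct.assoc k A A M.carrier (t ⊗ₜ m)))) =
      M.act (TensorProduct.lid k A ((Coalgebra.counit (R := k)).rTensor A t) ⊗ₜ m) := by
    intro t
    induction t using TensorProduct.induction_on with
    | zero => simp
    | tmul x y => simp [contract, ← TensorProduct.smul_tmul']
    | add p q hp hq => simp only [TensorProduct.add_tmul, map_add, hp, hq]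
  rw [key, Coalgebra.rTensor_counit_comul, TensorProduct.lid_tmul, one_smul]

/-- For p = 1 one leg of the algebra element acts on the module factor through ε, so only right
multiplication on the single algebra factor is left. -/
theorem map_contract_mul (V : Type u) [AddCommGroup V] [Module k V] :
    TensorProduct.map (contract k A V) (mul' k A) ∘ₗ
      (TensorProduct.tensorTensorTensorComm k V A A A).toLinearMap ∘ₗ
      (Coalgebra.comul (R := k) (A := A)).lTensor (V ⊗[k] A) =
    (mul' k A).lTensor V ∘ₗ (TensorProduct.assoc k V A A).toLinearMap := by
  refine TensorProduct.ext_threefold fun n x a => ?_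
  have key : ∀ t : A ⊗[k] A, TensorProduct.map (contract k A V) (mul' k A)
      (TensorProduct.tensorTensorTensorComm k V A A A ((n ⊗ₜ x) ⊗ₜ t)) =
      n ⊗ₜ (x * TensorProduct.lid k A ((Coalgebra.counit (R := k)).rTensor A t)) := by
    intro t
    induction t using TensorProduct.induction_on with
    | zero => simp
    | tmul y z => simp [contract, TensorProduct.smul_tmul]
    | add p q hp hq => simp only [TensorProduct.tmul_add, map_add, mul_add, hp, hq]
  simp [key]

/-- For n = 0 the product of first legs in the face c₀ is empty, hence the factor 1. -/
theorem mul_coact_one (N : YetterDrinfeld k A) (n : N.carrier) :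
    (mul' k A).lTensor N.carrier (TensorProduct.assoc k N.carrier A A (N.coact n ⊗ₜ 1)) =
      N.coact n := by
  induction N.coact n using TensorProduct.induction_on with
  | zero => simp
  | tmul y z => simp
  | add p q hp hq => simp only [TensorProduct.add_tmul, map_add, hp, hq]

/-- The left side has the literal shape of a differential without middle faces; the summand 0 is the
empty sum. -/
theorem alternating_zero {V : Type u} [AddCommGroup V] [Module k V] (x y : V) :
    x + 0 + (-1 : k) ^ (0 + 1) • y = x - y := by simp [sub_eq_add_neg]

theorem alternating_one {V : Type u} [AddCommGroup V] [Module k V] (x y z : V) :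
    x + (-1 : k) ^ (0 + 1) • y + (-1 : k) ^ (1 + 1) • z = x - y + z := by simp [sub_eq_add_neg]

/-- The sign (-1)ⁿ of the total differential at n = 1 is what regroups the four terms of bidegree
(1,1) into the two sides of the compatibility identity. -/
theorem sub_add_neg_one_smul_eq_zero_iff {V : Type u} [AddCommGroup V] [Module k V]
    (x y v w : V) : x - y + (-1 : k) ^ 1 • (v - w) = 0 ↔ v + y = x + w := by
  rw [pow_one, neg_one_smul, ← sub_eq_add_neg, sub_eq_zero, sub_eq_sub_iff_add_eq_add, eq_comm,
    add_comm x, add_comm v]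

theorem dm_zero (p : ℕ) (f : Y M N 0 p) :
    dm M N 0 p f = bFirst M N 0 p f - bLast M N 0 p f := by
  rw [dm, Finset.univ_eq_empty, Finset.sum_empty]
  exact alternating_zero (k := k) (bFirst M N 0 p f) (bLast M N 0 p f)

theorem dm_one (p : ℕ) (f : Y M N 1 p) :
    dm M N 1 p f = bFirst M N 1 p f - bMid M N 1 p 0 f + bLast M N 1 p f := by
  rw [dm, Fin.sum_univ_one]
  exact alternating_one (k := k) (bFirst M N 1 p f) (bMid M N 1 p 0 f) (bLast M N 1 p f)

theorem dc_zero (n : ℕ) (f : Y M N n 0) :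
    dc M N n 0 f = cFirst M N n 0 f - cLast M N n 0 f := by
  rw [dc, Finset.univ_eq_empty, Finset.sum_empty]
  exact alternating_zero (k := k) (cFirst M N n 0 f) (cLast M N n 0 f)

theorem dc_one (n : ℕ) (f : Y M N n 1) :
    dc M N n 1 f = cFirst M N n 1 f - cMid M N n 1 0 f + cLast M N n 1 f := by
  rw [dc, Fin.sum_univ_one]
  exact alternating_one (k := k) (cFirst M N n 1 f) (cMid M N n 1 0 f) (cLast M N n 1 f)

theorem dm_zero_zero_apply (f : M.carrier →ₗ[k] N.carrier) (a : A) (m : M.carrier) :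
    dm M N 0 0 f (a ⊗ₜ[k] m) = N.act (a ⊗ₜ f m) - f (M.act (a ⊗ₜ m)) := by
  have h : bLast M N 0 0 f (a ⊗ₜ[k] m) = f (M.act (a ⊗ₜ m)) := by
    rw [← contract_act]
    exact LinearMap.congr_fun (contract_rTensor (k := k) (A := A) f) _
  exact (LinearMap.congr_fun (dm_zero 0 f) (a ⊗ₜ[k] m)).trans (congrArg (_ - ·) h)

theorem dc_zero_zero_apply (f : M.carrier →ₗ[k] N.carrier) (m : M.carrier) :
    dc M N 0 0 f m = N.coact (f m) - f.rTensor A (M.coact m) :=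
  (LinearMap.congr_fun (dc_zero 0 f) m).trans
    (congrArg (· - f.rTensor A (M.coact m)) (mul_coact_one N (f m)))

theorem dm_one_zero_apply (ω : A ⊗[k] M.carrier →ₗ[k] N.carrier) (a b : A) (m : M.carrier) :
    dm M N 1 0 ω (a ⊗ₜ[k] (b ⊗ₜ[k] m)) =
      N.act (a ⊗ₜ ω (b ⊗ₜ m)) - ω ((a * b) ⊗ₜ m) + ω (a ⊗ₜ M.act (b ⊗ₜ m)) := by
  have key : ∀ z : M.carrier ⊗[k] A, contract k A N.carrier (ω.rTensor A
      ((TensorProduct.assoc k A M.carrier A).symm (a ⊗ₜ z))) =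
      ω (a ⊗ₜ contract k A M.carrier z) := by
    intro z
    induction z using TensorProduct.induction_on with
    | zero => simp
    | tmul x y => simp [contract]
    | add p q hp hq => simp only [TensorProduct.tmul_add, map_add, hp, hq]
  have h : bLast M N 1 0 ω (a ⊗ₜ[k] (b ⊗ₜ[k] m)) = ω (a ⊗ₜ M.act (b ⊗ₜ m)) := by
    rw [← contract_act]
    exact key _
  exact (LinearMap.congr_fun (dm_one 0 ω) (a ⊗ₜ[k] (b ⊗ₜ[k] m))).trans (congrArg (_ + ·) h)

/-- This differential and the one computed in `dc_one_zero` meet in bidegree (1,1). Each supplies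
two of the four cross terms of the Yetter-Drinfel'd identity. -/
theorem dm_zero_one (ρ : M.carrier →ₗ[k] N.carrier ⊗[k] A) :
    dm M N 0 1 ρ = ydRightMixed N.act ρ - ydLeftMixed M.act ρ := by
  have h1 : bFirst M N 0 1 ρ = ydRightMixed N.act ρ := TensorProduct.ext' fun a m => rfl
  have h2 : bLast M N 0 1 ρ = ydLeftMixed M.act ρ :=
    congrArg (fun φ => φ ∘ₗ ρ.rTensor A ∘ₗ actLast M 0) (map_contract_mul N.carrier)
  exact (dm_zero 1 ρ).trans (congrArg₂ (· - ·) h1 h2)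

theorem dc_one_zero (ω : A ⊗[k] M.carrier →ₗ[k] N.carrier) :
    dc M N 1 0 ω = ydLeftMixed ω N.coact - ydRightMixed ω M.coact := by
  have h1 : cFirst M N 1 0 ω = ydLeftMixed ω N.coact := by
    -- `splitL` exchanges the legs of Δ(a) and multiplies by the empty product 1; the exchange
    -- matches the one built into `ydLeftMixed`.
    have key : ∀ (m : M.carrier) (t : A ⊗[k] A), ω.rTensor A ((mul' k A).lTensor (A ⊗[k] M.carrier)
        (TensorProduct.tensorTensorTensorComm k A A M.carrier A
          (TensorProduct.comm k A A t ⊗ₜ (m ⊗ₜ 1)))) =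
        TensorProduct.comm k A N.carrier (ω.lTensor A (TensorProduct.assoc k A A M.carrier
          (t ⊗ₜ m))) := by
      intro m t
      induction t using TensorProduct.induction_on with
      | zero => simp
      | tmul x y => simp
      | add p q hp hq => simp only [TensorProduct.add_tmul, map_add, hp, hq]
    exact TensorProduct.ext' fun a m => congrArg (fun x => (mul' k A).lTensor N.carrier
      (TensorProduct.assoc k N.carrier A A (N.coact.rTensor A x))) (key m (Coalgebra.comul a))
  have h2 : cLast M N 1 0 ω = ydRightMixed ω M.coact := by
    have : TensorProduct.map ω (mul' k A) = ω.rTensor A ∘ₗ (mul' k A).lTensor _ := by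
      rw [rTensor_comp_lTensor]
    rw [ydRightMixed, this]
    rfl
  exact (dc_zero 1 ω).trans (congrArg₂ (· - ·) h1 h2)

/-- `powR` brackets to the left and `iterCoact` to the right. The associator accounts for the
difference and, being invertible, does not affect vanishing. -/
theorem dc_zero_one (ρ : M.carrier →ₗ[k] N.carrier ⊗[k] A) :
    dc M N 0 1 ρ = (TensorProduct.assoc k N.carrier A A).symm.toLinearMap ∘ₗ
      (iterCoact ρ N.coact - (Coalgebra.comul (R := k) (A := A)).lTensor N.carrier ∘ₗ ρ +
        iterCoact M.coact ρ) := by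
  have e : ∀ {V W : Type u} [AddCommGroup V] [Module k V] [AddCommGroup W] [Module k W]
      (c : V →ₗ[k] W ⊗[k] A) (c' : W →ₗ[k] N.carrier ⊗[k] A), c'.rTensor A ∘ₗ c =
      (TensorProduct.assoc k N.carrier A A).symm.toLinearMap ∘ₗ iterCoact c c' := by
    intros
    refine LinearMap.ext fun m => ?_
    simp [iterCoact]
  -- `coactFirst` moves the existing algebra factor aside before the coaction of N is applied; the
  -- scalar multiplied in is the 1 from `splitL` in degree 0.
  have key : ∀ z : N.carrier ⊗[k] A, ((mul' k A).lTensor N.carrier ∘ₗ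
      (TensorProduct.assoc k N.carrier A A).toLinearMap ∘ₗ N.coact.rTensor A).rTensor A
      (TensorProduct.rightComm k N.carrier A A (z ⊗ₜ[k] (1 : A))) = N.coact.rTensor A z := by
    intro z
    induction z using TensorProduct.induction_on with
    | zero => simp
    | tmul x y => simp [mul_coact_one]
    | add p q hp hq => simp only [TensorProduct.add_tmul, map_add, hp, hq]
  have h1 : cFirst M N 0 1 ρ =
      (TensorProduct.assoc k N.carrier A A).symm.toLinearMap ∘ₗ iterCoact ρ N.coact :=
    Eq.trans (b := N.coact.rTensor A ∘ₗ ρ) (LinearMap.ext fun m => key (ρ m)) (e ρ N.coact)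
  have h2 : cMid M N 0 1 0 ρ = (TensorProduct.assoc k N.carrier A A).symm.toLinearMap ∘ₗ
      (Coalgebra.comul (R := k) (A := A)).lTensor N.carrier ∘ₗ ρ := rfl
  have h3 : cLast M N 0 1 ρ =
      (TensorProduct.assoc k N.carrier A A).symm.toLinearMap ∘ₗ iterCoact M.coact ρ := e M.coact ρ
  rw [comp_add, comp_sub]
  exact (dc_one 0 ρ).trans (congrArg₂ (· + ·) (congrArg₂ (· - ·) h1 h2) h3)

/-- The target of the differential has three components: (2,0) carries multiplicativity of the
action, (0,2) coassociativity, and (1,1) the compatibility of the two. -/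
theorem mem_cocycles_one_iff (z : Tot M N 1) : z ∈ cocycles M N 1 ↔
    IsTwisting M N (Tot.actPart z) (Tot.coactPart z) := by
  have h20 : totD M N 1 z ⟨(2, 0), rfl⟩ = dm M N 1 0 (Tot.actPart z) := rfl
  have h11 : totD M N 1 z ⟨(1, 1), rfl⟩ = dm M N 0 1 (Tot.coactPart z) +
      (-1 : k) ^ 1 • dc M N 1 0 (Tot.actPart z) := rfl
  have h02 : totD M N 1 z ⟨(0, 2), rfl⟩ = dc M N 0 1 (Tot.coactPart z) := rfl
  have e20 : dm M N 1 0 (Tot.actPart z) = 0 ↔ ∀ a b m, Tot.actPart z ((a * b) ⊗ₜ m) =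
      N.act (a ⊗ₜ Tot.actPart z (b ⊗ₜ m)) + Tot.actPart z (a ⊗ₜ M.act (b ⊗ₜ m)) := by
    have h0 : ∀ x y w : N.carrier, x - y + w = 0 ↔ y = x + w := fun x y w => by
      rw [sub_add_eq_add_sub, sub_eq_zero, eq_comm]
    have ext0 : ∀ φ : A ⊗[k] (A ⊗[k] M.carrier) →ₗ[k] N.carrier,
        (∀ a b m, φ (a ⊗ₜ (b ⊗ₜ m)) = 0) → φ = 0 := fun φ hφ => by
      ext a b m
      exact hφ a b m
    constructor
    · intro h a b m
      exact (h0 _ _ _).1 ((dm_one_zero_apply (Tot.actPart z) a b m).symm.trans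
        (LinearMap.congr_fun h (a ⊗ₜ[k] (b ⊗ₜ[k] m))))
    · intro h
      exact ext0 _ fun a b m => (dm_one_zero_apply (Tot.actPart z) a b m).trans
        ((h0 _ _ _).2 (h a b m))
  have e11 : dm M N 0 1 (Tot.coactPart z) + (-1 : k) ^ 1 • dc M N 1 0 (Tot.actPart z) = 0 ↔
      ydLeftMixed (Tot.actPart z) N.coact + ydLeftMixed M.act (Tot.coactPart z) =
        ydRightMixed N.act (Tot.coactPart z) + ydRightMixed (Tot.actPart z) M.coact := by
    rw [dm_zero_one, dc_one_zero]
    exact sub_add_neg_one_smul_eq_zero_iff (k := k) _ _ _ _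
  have e02 : dc M N 0 1 (Tot.coactPart z) = 0 ↔
      iterCoact (Tot.coactPart z) N.coact + iterCoact M.coact (Tot.coactPart z) =
        (Coalgebra.comul (R := k) (A := A)).lTensor N.carrier ∘ₗ Tot.coactPart z := by
    have h0 : ∀ x y w : M.carrier →ₗ[k] N.carrier ⊗[k] (A ⊗[k] A),
        (TensorProduct.assoc k N.carrier A A).symm.toLinearMap ∘ₗ (x - y + w) = 0 ↔ x + w = y := by
      intro x y w
      rw [sub_add_eq_add_sub, ← sub_eq_zero (b := y)]
      refine ⟨fun h => LinearMap.ext fun m => ?_, fun h => by rw [h, LinearMap.comp_zero]⟩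
      exact (TensorProduct.assoc k N.carrier A A).symm.map_eq_zero_iff.1 (LinearMap.congr_fun h m)
    rw [dc_zero_one]
    exact h0 _ _ _
  constructor
  · intro h
    have h' : ∀ q, totD M N 1 z q = 0 := congrFun h
    exact ⟨e20.1 (h20.symm.trans (h' _)), e02.1 (h02.symm.trans (h' _)),
      e11.1 (h11.symm.trans (h' _))⟩
  · intro h
    refine funext fun q => ?_
    -- All other index pairs contradict n + p = 2.
    match q with
    | ⟨(2, 0), _⟩ => exact h20.trans (e20.2 h.act)
    | ⟨(1, 1), _⟩ => exact h11.trans (e11.2 h.compat)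
    | ⟨(0, 2), _⟩ => exact h02.trans (e02.2 h.coact)
    | ⟨(0, 0), e⟩ => simp at e
    | ⟨(0, 1), e⟩ => simp at e
    | ⟨(0, p + 3), e⟩ => simp at e
    | ⟨(1, 0), e⟩ => simp at e
    | ⟨(1, p + 2), e⟩ => simp at e; omega
    | ⟨(2, p + 1), e⟩ => simp at e
    | ⟨(n + 3, p), e⟩ => simp at e; omega

theorem Tot.ext_one {z z' : Tot M N 1} (h : Tot.actPart z = Tot.actPart z')
    (h' : Tot.coactPart z = Tot.coactPart z') : z = z' := by
  refine funext fun q => ?_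
  match q with
  | ⟨(1, 0), _⟩ => exact h
  | ⟨(0, 1), _⟩ => exact h'
  | ⟨(0, 0), e⟩ => simp at e
  | ⟨(0, p + 2), e⟩ => simp at e
  | ⟨(1, p + 1), e⟩ => simp at e
  | ⟨(n + 2, p), e⟩ => simp at e; omega

theorem Tot.exists_one (ω : A ⊗[k] M.carrier →ₗ[k] N.carrier)
    (ρ : M.carrier →ₗ[k] N.carrier ⊗[k] A) :
    ∃ z : Tot M N 1, Tot.actPart z = ω ∧ Tot.coactPart z = ρ :=
  ⟨fun
    | ⟨(1, 0), _⟩ => ω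
    | ⟨(0, 1), _⟩ => ρ
    -- The default value is never taken by a pair with n + p = 1; it only completes the match.
    | _ => 0, rfl, rfl⟩

/-- A cochain of degree 0 is a single linear map f, and the two components of its differential are
the discrepancies produced by the shear along f. -/
theorem mem_coboundaries_one_iff (z : Tot M N 1) : z ∈ coboundaries M N 1 ↔
    ∃ f : M.carrier →ₗ[k] N.carrier,
      (∀ a m, Tot.actPart z (a ⊗ₜ m) = N.act (a ⊗ₜ f m) - f (M.act (a ⊗ₜ m))) ∧
      ∀ m, Tot.coactPart z m = N.coact (f m) - f.rTensor A (M.coact m) := by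
  have h10 : ∀ x : Tot M N 0, Tot.actPart (totD M N 0 x) = dm M N 0 0 (Tot.proj M N 0 0 rfl x) :=
    fun _ => rfl
  have h01 : ∀ x : Tot M N 0, Tot.coactPart (totD M N 0 x) = dc M N 0 0 (Tot.proj M N 0 0 rfl x) :=
    fun _ => rfl
  constructor
  · rintro ⟨x, rfl⟩
    exact ⟨Tot.proj M N 0 0 rfl x, dm_zero_zero_apply _, dc_zero_zero_apply _⟩
  · rintro ⟨f, h1, h2⟩
    let x : Tot M N 0 := fun
      | ⟨(0, 0), _⟩ => f
      | _ => 0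
    have hx : Tot.proj M N 0 0 rfl x = f := rfl
    refine ⟨x, Tot.ext_one ?_ ?_⟩
    · rw [h10, hx]
      exact TensorProduct.ext' fun a m => (dm_zero_zero_apply f a m).trans (h1 a m).symm
    · rw [h01, hx]
      exact LinearMap.ext fun m => (dc_zero_zero_apply f m).trans (h2 m).symm

/-- The extension defined by a `1`-cocycle. -/
noncomputable def twistOfCocycle (z : cocycles M N 1) : Extension M N :=
  twist ((mem_cocycles_one_iff z.1).1 z.2)

/-- One direction makes the map H¹ → Ext¹ well defined, the other makes it injective. -/
theorem twistOfCocycle_equiv_iff (z z' : cocycles M N 1) :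
    twistOfCocycle z ≈ twistOfCocycle z' ↔ z.1 - z'.1 ∈ coboundaries M N 1 := by
  rw [mem_coboundaries_one_iff]
  constructor
  · exact exists_of_twist_equiv _ _
  · rintro ⟨f, h1, h2⟩
    exact twist_equiv_of _ _ f h1 h2

variable (M N) in
/-- The isomorphism of the first cohomology group with the group of extensions. -/
noncomputable def hOneEquivExt : H M N 1 ≃+ Ext1 M N where
  toEquiv := Equiv.ofBijective
    (Quotient.lift (fun z => Ext1.mk (twistOfCocycle z)) fun z z' h =>
      Ext1.mk_eq_mk.2 ((twistOfCocycle_equiv_iff z z').2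
        ((Submodule.quotientRel_def (p := (coboundaries M N 1).submoduleOf _)).1 h))) (by
      constructor
      · rintro ⟨z⟩ ⟨z'⟩ h
        exact (Submodule.Quotient.eq _).2
          ((twistOfCocycle_equiv_iff z z').1 (Ext1.mk_eq_mk.1 h))
      · rintro ⟨E⟩
        obtain ⟨ω, ρ, h, e⟩ := exists_twist_equiv E
        obtain ⟨z, rfl, rfl⟩ := Tot.exists_one ω ρ
        exact ⟨H.mk ⟨z, (mem_cocycles_one_iff z).2 h⟩, Ext1.mk_eq_mk.2 e⟩)
  map_add' := by
    rintro ⟨z⟩ ⟨z'⟩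
    -- The extension of the sum of two cocycles is by definition the twist attached to
    -- `IsTwisting.add`.
    exact Ext1.mk_eq_mk.2 (Setoid.symm (baerSum_twist ((mem_cocycles_one_iff z.1).1 z.2)
      ((mem_cocycles_one_iff z'.1).1 z'.2)))

theorem hOneEquivExt_mk (z : cocycles M N 1) :
    hOneEquivExt M N (H.mk z) = Ext1.mk (twistOfCocycle z) := rfl

end YetterDrinfeld

/-! ### Slices of a tensor by functionals. -/

section EvalRight

open LinearMap

variable {k A : Type u} [Field k] [Ring A] [Algebra k A]

/-- Evaluation of the second tensor factor: `v ⊗ a ↦ p(a) v`. -/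
noncomputable def evalRight (V : Type u) [AddCommGroup V] [Module k V] (p : Module.Dual k A) :
    V ⊗[k] A →ₗ[k] V :=
  (TensorProduct.rid k V).toLinearMap ∘ₗ p.lTensor V

@[simp] theorem evalRight_tmul {V : Type u} [AddCommGroup V] [Module k V] (p : Module.Dual k A)
    (v : V) (a : A) : evalRight V p (v ⊗ₜ a) = p a • v := by simp [evalRight]

theorem rTensor_evalRight {V W : Type u} [AddCommGroup V] [Module k V] [AddCommGroup W]
    [Module k W] (p : Module.Dual k A) (g : V →ₗ[k] W) (z : V ⊗[k] A) :
    evalRight W p (g.rTensor A z) = g (evalRight V p z) := by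
  induction z using TensorProduct.induction_on with
  | zero => simp
  | add x y hx hy => simp only [map_add, hx, hy]
  | tmul v a => simp

end EvalRight

/-! ### From operators satisfying the relations of the double to Yetter-Drinfel'd modules. -/

section OfDouble

open Coalgebra LinearMap

variable {k A : Type u} [Field k] [Ring A] [HopfAlgebra k A] [FiniteDimensional k A]

/-- `∑ a₂ S⁻¹(a₁) = ε(a)`. -/
theorem sum_mul_antipodeInv (x : A) : LinearMap.mul' k A (TensorProduct.comm k A A
    ((antipodeInv k A).rTensor A (comul x))) = algebraMap k A (counit x) := by
  -- S is injective and reverses products, so applying it reduces the claim to ∑ a₁ S(a₂) = ε(a).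
  apply antipode_bijective (k := k).1
  have key : ∀ z : A ⊗[k] A, HopfAlgebra.antipode k (LinearMap.mul' k A (TensorProduct.comm k A A
      ((antipodeInv k A).rTensor A z))) =
      LinearMap.mul' k A ((HopfAlgebra.antipode k).lTensor A z) := by
    intro z
    induction z using TensorProduct.induction_on with
    | zero => simp
    | add x y hx hy => simp only [map_add, hx, hy]
    | tmul x y => simp [HopfAlgebra.antipode_mul_antidistrib, antipode_antipodeInv]
  rw [key, HopfAlgebra.mul_antipode_lTensor_comul_apply]
  simp [Algebra.algebraMap_eq_smul_one]

/-- Expansion along a finite basis of A recovers a tensor from its slices. -/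
theorem sum_evalRight_coord {V : Type u} [AddCommGroup V] [Module k V] (z : V ⊗[k] A) :
    ∑ i, evalRight V ((Module.finBasis k A).coord i) z ⊗ₜ[k] Module.finBasis k A i = z := by
  induction z using TensorProduct.induction_on with
  | zero => simp
  | add x y hx hy => simp only [map_add, TensorProduct.add_tmul, Finset.sum_add_distrib, hx, hy]
  | tmul v a =>
    simp only [evalRight_tmul, TensorProduct.smul_tmul, ← TensorProduct.tmul_sum,
      Module.Basis.coord_apply, Module.Basis.sum_repr]

/-- Identities in V ⊗ A, such as those involving a coaction, thereby become identities between
operators on V indexed by functionals. -/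
theorem evalRight_ext {V : Type u} [AddCommGroup V] [Module k V] {z w : V ⊗[k] A}
    (h : ∀ p : Module.Dual k A, evalRight V p z = evalRight V p w) : z = w := by
  rw [← sum_evalRight_coord z, ← sum_evalRight_coord w]
  simp only [h]

section Construction

variable {V : Type u} [AddCommGroup V] [Module k V] (D : Module.Dual k A →ₗ[k] Module.End k V)

/-- The coaction corresponding to an action of the dual space. -/
noncomputable def coactOfDual : V →ₗ[k] V ⊗[k] A :=
  ∑ i, (TensorProduct.mk k V A).flip (Module.finBasis k A i) ∘ₗ D ((Module.finBasis k A).coord i)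

/-- Expanding p in the dual basis shows that the slices of the coaction are the given operators; the
choice of basis plays no further role. -/
theorem evalRight_coactOfDual (p : Module.Dual k A) (v : V) :
    evalRight V p (coactOfDual D v) = D p v := by
  have hp : p = ∑ i, p (Module.finBasis k A i) • (Module.finBasis k A).coord i := by
    refine (Module.finBasis k A).ext fun j => ?_
    simp
  conv_rhs => rw [hp, map_sum, LinearMap.sum_apply]
  simp [coactOfDual]

variable {D} (F : A →ₗ[k] Module.End k V)

/-- The module axioms are those of F, and pairing with functionals turns the comodule axioms into
those of D. For the compatibility, pair with q. The side ∑ a₁ · m₀ ⊗ a₂ m₁ becomes ∑ F(a₁) D(q(a₂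
-)) m, which the commutation rule rewrites as ∑ D(q(a₄ S⁻¹(a₃) - a₁)) F(a₂) m. Cancelling a₄ S⁻¹(a₃)
leaves ∑ D(q(- a₁)) F(a₂) m, the pairing of the other side. -/
theorem isYetterDrinfeld_of_double (hD1 : D counit = 1) (hF1 : F 1 = 1)
    (hD : ∀ p q, D (DrinfeldDouble.dualMul k A p q) = D p * D q)
    (hF : ∀ a b, F (a * b) = F a * F b)
    (hFD : ∀ a q, F a * D q = DrinfeldDouble.conjMul D q F (DrinfeldDouble.comul₃ k A a)) :
    IsYetterDrinfeld (TensorProduct.lift F) (coactOfDual D) where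
  one_act m := by simp [hF1]
  mul_act a b m := by simp [hF]
  coassoc m := by
    apply (TensorProduct.assoc k V A A).symm.injective
    -- Slicing the last factor by q and then the remaining one by p reduces coassociativity to D(p *
    -- q) = D(p) D(q).
    refine evalRight_ext fun q => evalRight_ext fun p => ?_
    rw [LinearEquiv.symm_apply_apply, rTensor_evalRight, evalRight_coactOfDual,
      evalRight_coactOfDual, ← Module.End.mul_apply, ← hD, ← evalRight_coactOfDual]
    induction coactOfDual D m using TensorProduct.induction_on with
    | zero => simp
    | add x y hx hy => simp only [map_add, hx, hy]
    | tmul v a =>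
      rw [evalRight_tmul, DrinfeldDouble.dualMul_apply, lTensor_tmul]
      induction comul (R := k) a using TensorProduct.induction_on with
      | zero => simp
      | add x y hx hy => simp only [TensorProduct.tmul_add, map_add, add_smul, hx, hy]
      | tmul x y => simp [smul_smul, mul_comm]
  counit m := (evalRight_coactOfDual D counit m).trans (by rw [hD1]; rfl)
  compat a m := by
    refine evalRight_ext fun q => ?_
    -- Inserting S cancels the S⁻¹ hidden in `conjMul`, so the third argument multiplies on the left
    -- without a twist.
    let H : A ⊗[k] (A ⊗[k] A) →ₗ[k] V := LinearMap.applyₗ m ∘ₗ DrinfeldDouble.conjMul D q F ∘ₗ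
      ((HopfAlgebra.antipode k (A := A)).lTensor A).lTensor A
    have hH : ∀ x y c, H (x ⊗ₜ (y ⊗ₜ c)) =
        D (q ∘ₗ LinearMap.mulLeft k c ∘ₗ LinearMap.mulRight k x) (F y m) := by
      intro x y c
      have : DrinfeldDouble.dualConj k A x (HopfAlgebra.antipode k c) q =
          q ∘ₗ LinearMap.mulLeft k c ∘ₗ LinearMap.mulRight k x := by
        ext w
        simp [antipodeInv_antipode]
      simp [H, this]
    -- σ(x ⊗ y) = y S⁻¹(x), which composed with Δ is the counit.
    let σ : A ⊗[k] A →ₗ[k] A := LinearMap.mul' k A ∘ₗ (TensorProduct.comm k A A).toLinearMap ∘ₗ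
      (antipodeInv k A).rTensor A
    have hσ : σ ∘ₗ comul (R := k) = Algebra.linearMap k A ∘ₗ counit (R := k) :=
      LinearMap.ext fun x => sum_mul_antipodeInv x
    -- The four legs are rebracketed so that the third and fourth are adjacent, ready for σ.
    let α : (A ⊗[k] (A ⊗[k] A)) ⊗[k] A →ₗ[k] A ⊗[k] (A ⊗[k] (A ⊗[k] A)) :=
      (TensorProduct.assoc k A A A).toLinearMap.lTensor A ∘ₗ
        (TensorProduct.assoc k A (A ⊗[k] A) A).toLinearMap
    have h1 : ∀ t : A ⊗[k] A, evalRight V q ((mul' k A).lTensor V (TensorProduct.assoc k V A A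
        ((coactOfDual D).rTensor A (TensorProduct.comm k A V ((TensorProduct.lift F).lTensor A
          (TensorProduct.assoc k A A V (t ⊗ₜ m))))))) =
        H (((TensorProduct.mk k A A).flip 1).lTensor A t) := by
      intro t
      induction t using TensorProduct.induction_on with
      | zero => simp
      | add x y hx hy => simp only [TensorProduct.add_tmul, map_add, hx, hy]
      | tmul x y =>
        have key : ∀ z : V ⊗[k] A, evalRight V q ((mul' k A).lTensor V
            (TensorProduct.assoc k V A A (z ⊗ₜ x))) =
            evalRight V (q ∘ₗ LinearMap.mulLeft k 1 ∘ₗ LinearMap.mulRight k x) z := by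
          intro z
          induction z using TensorProduct.induction_on with
          | zero => simp
          | add x y hx hy => simp only [TensorProduct.add_tmul, map_add, hx, hy]
          | tmul v w => simp
        simp only [TensorProduct.assoc_tmul, lTensor_tmul, TensorProduct.comm_tmul, rTensor_tmul,
          flip_apply, TensorProduct.mk_apply, hH, key, evalRight_coactOfDual,
          TensorProduct.lift.tmul]
    have h2 : ∀ (u : A ⊗[k] (A ⊗[k] A)) (y : A),
        DrinfeldDouble.conjMul D (q ∘ₗ LinearMap.mulLeft k y) F u m =
          H ((σ.lTensor A).lTensor A (α (u ⊗ₜ y))) := by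
      intro u y
      induction u using TensorProduct.induction_on with
      | zero => simp
      | add u u' hu hu' => simp only [TensorProduct.add_tmul, map_add, LinearMap.add_apply, hu, hu']
      | tmul x s =>
      induction s using TensorProduct.induction_on with
      | zero => simp
      | add u u' hu hu' =>
        simp only [TensorProduct.tmul_add, TensorProduct.add_tmul, map_add, LinearMap.add_apply,
          hu, hu']
      | tmul x' z =>
        have e : DrinfeldDouble.dualConj k A x z (q ∘ₗ LinearMap.mulLeft k y) =
            q ∘ₗ LinearMap.mulLeft k (y * antipodeInv k A z) ∘ₗ LinearMap.mulRight k x := by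
          ext w
          simp
        simp [α, σ, hH, e]
    -- The commutation rule is used here, for the functional q(y -), where y is the second leg.
    have h3 : ∀ t : A ⊗[k] A, evalRight V q (TensorProduct.map (TensorProduct.lift F) (mul' k A)
        (TensorProduct.tensorTensorTensorComm k A A V A (t ⊗ₜ coactOfDual D m))) =
        H ((σ.lTensor A).lTensor A (α ((DrinfeldDouble.comul₃ k A).rTensor A t))) := by
      intro t
      induction t using TensorProduct.induction_on with
      | zero => simp
      | add x y hx hy => simp only [TensorProduct.add_tmul, map_add, hx, hy]
      | tmul x y =>
        rw [rTensor_tmul, ← h2, ← hFD, Module.End.mul_apply, ← evalRight_coactOfDual]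
        induction coactOfDual D m using TensorProduct.induction_on with
        | zero => simp
        | add x y hx hy => simp only [TensorProduct.tmul_add, map_add, hx, hy]
        | tmul v w => simp
    have h4 : α ∘ₗ (DrinfeldDouble.comul₃ k A).rTensor A ∘ₗ comul (R := k) =
        ((comul (R := k) (A := A)).lTensor A).lTensor A ∘ₗ DrinfeldDouble.comul₃ k A := by
      simp only [DrinfeldDouble.comul₃, α]
      simp only [coassoc_simps]
    -- The last two legs collapse to ε, leaving a₁ ⊗ (a₂ ⊗ 1), the argument that `h1` assigns to the
    -- other side.
    have h5 : (σ.lTensor A).lTensor A ∘ₗ ((comul (R := k) (A := A)).lTensor A).lTensor A ∘ₗ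
        DrinfeldDouble.comul₃ k A = ((TensorProduct.mk k A A).flip 1).lTensor A ∘ₗ comul := by
      have e : (Algebra.linearMap k A ∘ₗ counit (R := k)).lTensor A ∘ₗ comul (R := k) =
          (TensorProduct.mk k A A).flip 1 := by
        ext x
        simp [lTensor_comp]
      rw [DrinfeldDouble.comul₃, ← LinearMap.comp_assoc, ← LinearMap.comp_assoc, ← lTensor_comp,
        ← lTensor_comp, ← lTensor_comp, hσ, e]
    refine (h1 (comul a)).trans (Eq.trans ?_ (h3 (comul a)).symm)
    have h6 := LinearMap.congr_fun h4 a
    have h7 := LinearMap.congr_fun h5 a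
    simp only [LinearMap.comp_apply] at h6 h7
    rw [h6, h7]

end Construction

end OfDouble

/-! ### The functor to modules over the Drinfel'd double is fully faithful. -/

namespace YetterDrinfeld

open LinearMap Coalgebra

variable {k A : Type u} [Field k] [Ring A] [HopfAlgebra k A] [FiniteDimensional k A]

set_option linter.unusedSectionVars false

theorem lin_dualOp {M N : YetterDrinfeld k A} (f : M ⟶ N) (p : Module.Dual k A) (m : M.carrier) :
    lin f (M.dualOp p m) = N.dualOp p (lin f m) := by
  change lin f (evalRight _ p (M.coact m)) = evalRight _ p (N.coact (lin f m))
  rw [← rTensor_evalRight, lin_coact]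

theorem lin_doubleOp {M N : YetterDrinfeld k A} (f : M ⟶ N) (t : DrinfeldDouble k A)
    (m : M.carrier) : lin f (M.doubleOp t m) = N.doubleOp t (lin f m) := by
  induction t using TensorProduct.induction_on with
  | zero => simp
  | add x y hx hy => simp only [map_add, LinearMap.add_apply, hx, hy]
  | tmul p a =>
    change lin f (M.dualOp p (M.act (a ⊗ₜ m))) = N.dualOp p (N.act (a ⊗ₜ lin f m))
    rw [lin_dualOp, lin_act]

theorem doubleOp_counit_tmul (M : YetterDrinfeld k A) (a : A) (m : M.carrier) :
    M.doubleOp (counit ⊗ₜ a) m = M.act (a ⊗ₜ m) := by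
  change M.dualOp counit (M.act (a ⊗ₜ m)) = _
  rw [dualOp_counit]
  rfl

theorem doubleOp_tmul_one (M : YetterDrinfeld k A) (p : Module.Dual k A) (m : M.carrier) :
    M.doubleOp (p ⊗ₜ 1) m = evalRight _ p (M.coact m) := by
  change M.dualOp p (M.act (1 ⊗ₜ m)) = _
  rw [M.isYetterDrinfeld.one_act]
  rfl

/-- Scalars act through multiples of the unit of D(A), so additive maps commuting with the double
are automatically linear over k. -/
theorem doubleOp_smul_one (M : YetterDrinfeld k A) (c : k) (m : M.carrier) :
    M.doubleOp (c • (1 : DrinfeldDouble k A)) m = c • m := by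
  refine (congrArg (fun φ => φ m) (M.doubleOp.map_smul c (1 : DrinfeldDouble k A))).trans ?_
  exact congrArg (fun φ : Module.End k M.carrier => c • φ m) M.doubleOp_one

variable (k A) in
/-- The functor from Yetter-Drinfel'd modules to modules over the Drinfel'd double. -/
noncomputable def toDoubleFunctor : YetterDrinfeld k A ⥤ ModuleCat.{u} (DrinfeldDouble k A) where
  obj M := M.toDouble
  map {M N} f := 
    letI := M.doubleModule
    letI := N.doubleModule
    ModuleCat.ofHom (X := M.carrier) (Y := N.carrier) (R := DrinfeldDouble k A)
      { toFun := lin f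
        map_add' := (lin f).map_add
        map_smul' := lin_doubleOp f }

instance : (toDoubleFunctor k A).Additive where
  map_add := rfl

instance : (toDoubleFunctor k A).Faithful where
  map_injective {M N _ _} h := hom_ext (LinearMap.ext fun m =>
    congrArg (fun φ : M.toDouble ⟶ N.toDouble => φ.hom m) h)

/-- Elements ε ⊗ a see the action, and elements p ⊗ 1 see the slices of the coaction. A map
commuting with all of them is therefore linear over A, and colinear because slices determine
tensors. -/
instance : (toDoubleFunctor k A).Full where
  map_surjective {M N} g := by
    let φ : M.carrier → N.carrier := g.hom
    have hadd : ∀ x y, φ (x + y) = φ x + φ y := g.hom.map_add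
    have hsmul : ∀ (t : DrinfeldDouble k A) x, φ (M.doubleOp t x) = N.doubleOp t (φ x) :=
      g.hom.map_smul
    let f : M.carrier →ₗ[k] N.carrier :=
      { toFun := φ
        map_add' := hadd
        map_smul' := fun c x => by
          have := hsmul (c • 1) x
          rwa [doubleOp_smul_one, doubleOp_smul_one] at this }
    have h1 : ∀ a m, f (M.act (a ⊗ₜ m)) = N.act (a ⊗ₜ f m) := fun a m => by
      rw [← doubleOp_counit_tmul, ← doubleOp_counit_tmul]
      exact hsmul _ _
    have h2 : ∀ m, f.rTensor A (M.coact m) = N.coact (f m) := fun m =>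
      evalRight_ext fun p => by
        rw [rTensor_evalRight, ← doubleOp_tmul_one, ← doubleOp_tmul_one]
        exact hsmul _ _
    exact ⟨Hom.mk f h1 h2, rfl⟩

end YetterDrinfeld

/-! ### A* and A inside the double, and their commutation rule. -/

namespace DrinfeldDouble

open LinearMap Coalgebra

variable {k A : Type u} [Field k] [Ring A] [HopfAlgebra k A] [FiniteDimensional k A]

noncomputable instance : Algebra k (DrinfeldDouble k A) :=
  Algebra.ofModule (fun c s t => congrArg (fun φ => φ t) ((mulHom k A).map_smul c s))
    (fun c s t => (mulHom k A s).map_smul c t)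

variable (k A) in
/-- The inclusion of `A*` into the Drinfel'd double. -/
noncomputable def inclDual : Module.Dual k A →ₗ[k] DrinfeldDouble k A :=
  (TensorProduct.mk k (Module.Dual k A) A).flip 1

variable (k A) in
/-- The inclusion of `A` into the Drinfel'd double. -/
noncomputable def inclA : A →ₗ[k] DrinfeldDouble k A :=
  TensorProduct.mk k (Module.Dual k A) A counit

theorem inclDual_mul_tmul (p q : Module.Dual k A) (a : A) :
    inclDual k A p * (show DrinfeldDouble k A from q ⊗ₜ a) = dualMul k A p q ⊗ₜ[k] a := by
  change mulHom k A (p ⊗ₜ 1) (q ⊗ₜ a) = _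
  rw [mulHom_tmul, actA_one, mul_one, actDual_tmul]

theorem inclDual_mul (p q : Module.Dual k A) :
    inclDual k A (dualMul k A p q) = inclDual k A p * inclDual k A q :=
  (inclDual_mul_tmul p q 1).symm

/-- Simple tensors factor as a functional times an algebra element, so a representation of the
double is determined by its restrictions to A* and A. -/
theorem inclDual_mul_inclA (p : Module.Dual k A) (a : A) :
    inclDual k A p * inclA k A a = p ⊗ₜ[k] a :=
  (inclDual_mul_tmul p counit a).trans (by rw [dualMul_counit_right])

/-- The functional ε is neutral for convolution, so only the part of the product coming from a
survives. For t in A* this is the commutation rule. -/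
theorem inclA_mul_eq (a : A) (t : DrinfeldDouble k A) : inclA k A a * t = actA k A a t := by
  change mulHom k A (counit ⊗ₜ a) t = _
  rw [mulHom_tmul, actDual_counit, one_mul]

theorem inclA_eq (a : A) : inclA k A a = actA k A a (counit ⊗ₜ 1) :=
  (mul_one (inclA k A a)).symm.trans (inclA_mul_eq a 1)

theorem inclA_mul (a b : A) : inclA k A (a * b) = inclA k A a * inclA k A b := by
  rw [inclA_mul_eq, inclA_eq, inclA_eq, actA_mul, Module.End.mul_apply]

end DrinfeldDouble

/-! ### Essential surjectivity, hence the equivalence of categories. -/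

namespace YetterDrinfeld

open LinearMap Coalgebra

variable {k A : Type u} [Field k] [Ring A] [HopfAlgebra k A] [FiniteDimensional k A]

open DrinfeldDouble in
/-- Every module over the Drinfel'd double comes from a Yetter-Drinfel'd module. -/
theorem exists_doubleOp_eq_smul (V : Type u) [AddCommGroup V] [Module (DrinfeldDouble k A) V] :
    ∃ (M : YetterDrinfeld k A) (e : M.carrier ≃+ V), ∀ (t : DrinfeldDouble k A) m,
      e (M.doubleOp t m) = t • e m := by
  -- The vector space structure is not given; it is obtained by restriction along k → D(A).
  let : Module k V := Module.compHom V (algebraMap k (DrinfeldDouble k A))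
  have : IsScalarTower k (DrinfeldDouble k A) V :=
    ⟨fun c t v => by rw [Algebra.smul_def, mul_smul]; rfl⟩
  let L : DrinfeldDouble k A →ₐ[k] Module.End k V := Algebra.lsmul k k V
  let D : Module.Dual k A →ₗ[k] Module.End k V := L.toLinearMap ∘ₗ inclDual k A
  let F : A →ₗ[k] Module.End k V := L.toLinearMap ∘ₗ inclA k A
  have hD1 : D counit = 1 := map_one L
  have hF1 : F 1 = 1 := map_one L
  have hD : ∀ p q, D (dualMul k A p q) = D p * D q := fun p q =>
    (congrArg L (inclDual_mul p q)).trans (map_mul L _ _)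
  have hF : ∀ a b, F (a * b) = F a * F b := fun a b =>
    (congrArg L (inclA_mul a b)).trans (map_mul L _ _)
  -- L' is L viewed on the tensor product A* ⊗ A underlying the double, so that lemmas on tensors
  -- apply to it.
  obtain ⟨L', hL'⟩ : ∃ L' : Module.Dual k A ⊗[k] A →ₗ[k] Module.End k V, ∀ t, L' t = L t :=
    ⟨L.toLinearMap, fun _ => rfl⟩
  have hDF : ∀ p a, D p * F a = L' (p ⊗ₜ[k] a) := fun p a =>
    (map_mul L _ _).symm.trans ((congrArg L (inclDual_mul_inclA p a)).trans (hL' _).symm)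
  -- In D(A) the product of a and q is the action of a on q ⊗ 1; writing each resulting simple
  -- tensor as a functional times an algebra element gives the required rule.
  have hFD : ∀ a q, F a * D q = conjMul D q F (comul₃ k A a) := by
    intro a q
    refine (map_mul L _ _).symm.trans
      ((congrArg L (inclA_mul_eq a _)).trans ((hL' _).symm.trans ?_))
    have key : ∀ u : A ⊗[k] (A ⊗[k] A), L' (act₃ k A u (q ⊗ₜ[k] 1)) = conjMul D q F u := by
      intro u
      induction u using TensorProduct.induction_on with
      | zero => simp
      | add x y hx hy => simp only [map_add, LinearMap.add_apply, hx, hy]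
      | tmul x s =>
      induction s using TensorProduct.induction_on with
      | zero => simp
      | add x y hx hy =>
        simp only [TensorProduct.tmul_add, map_add, LinearMap.add_apply, hx, hy]
      | tmul y z => rw [act₃_tmul, conjMul_tmul, hDF, mul_one]
    exact key (comul₃ k A a)
  let M : YetterDrinfeld k A := ⟨V, TensorProduct.lift F, coactOfDual D,
    isYetterDrinfeld_of_double F hD1 hF1 hD hF hFD⟩
  have hM : M.doubleOp = L' := by
    refine TensorProduct.ext' fun p a => LinearMap.ext fun m => ?_
    rw [← hDF]
    exact (evalRight_coactOfDual D p _).trans (congrArg (D p)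
      (TensorProduct.lift.tmul a m : TensorProduct.lift F (a ⊗ₜ m) = F a m))
  exact ⟨M, AddEquiv.refl V, fun t m =>
    congrArg (fun φ : Module.End k V => φ m) ((LinearMap.congr_fun hM t).trans (hL' t))⟩

instance : (toDoubleFunctor k A).EssSurj where
  mem_essImage X := by
    obtain ⟨M, e, he⟩ := exists_doubleOp_eq_smul (k := k) (A := A) X
    let _ := M.doubleModule
    let e' : M.carrier ≃ₗ[DrinfeldDouble k A] X := { e with map_smul' := he }
    exact ⟨M, ⟨e'.toModuleIso⟩⟩

instance : (toDoubleFunctor k A).IsEquivalence where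

end YetterDrinfeld

theorem mainTheorem1 {k : Type u} [Field k] :
    (∀ (A : Type u) [Ring A] [Bialgebra k A] (M N : YetterDrinfeld k A),
      ∃ Φ : YetterDrinfeld.H M N 1 ≃+ Ext1 M N,
        ∀ z : YetterDrinfeld.cocycles M N 1, ∃ E : Extension M N,
          YetterDrinfeld.IsTwisted E (YetterDrinfeld.Tot.actPart z.1)
            (YetterDrinfeld.Tot.coactPart z.1) ∧
          Φ (YetterDrinfeld.H.mk z) = Ext1.mk E) ∧
    (∀ (A : Type u) [Ring A] [HopfAlgebra k A] [FiniteDimensional k A]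
      (M N : YetterDrinfeld k A),
      Nonempty (YetterDrinfeld.H M N 1 ≃+ Ext1 M.toDouble N.toDouble)) :=
  ⟨fun _ _ _ M N => ⟨YetterDrinfeld.hOneEquivExt M N, fun z =>
      ⟨YetterDrinfeld.twistOfCocycle z, YetterDrinfeld.isTwisted_twist _,
        YetterDrinfeld.hOneEquivExt_mk z⟩⟩,
    -- Part (b) is part (a) followed by transport of Ext¹ along the equivalence, whose value on
    -- objects is `toDouble` by definition.
    fun A _ _ _ M N => ⟨(YetterDrinfeld.hOneEquivExt M N).trans
      (Ext1.mapEquiv (YetterDrinfeld.toDoubleFunctor k A) M N)⟩⟩
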